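/- Let $\alpha,\beta:\mathbb R\to[0,\infty)$ be measurable functions that vanish on $(-\infty,0]$, are not almost everywhere zero, and have finite bimoments $\iint_{\mathbb R_+^2}\frac{x^jy^k}{x+y}\,\alpha(x)\beta(y)\,dx\,dy<\infty$ for all $j,k\ge 0$. Put $\alpha^\star(x)=\alpha(-x)$, $\beta^\star(y)=\beta(-y)$, let $\operatorname{supp}$ denote the support of the corresponding measure, and let $\Omega=\mathbb C\setminus(\operatorname{supp}\alpha\cup\operatorname{supp}\beta^\star)$. The Cauchy biorthogonal polynomials are real polynomials $p_j,q_j$ $(j\ge 0)$ of exact degree $j$, with equal and positive leading coefficients, such that $\iint_{\mathbb R_+^2} p_j(x)q_k(y)\frac{\alpha(x)\beta(y)}{x+y}\,dx\,dy=\delta_{jk}$. Put $p_j^{(0)}=p_j$, $q_j^{(0)}=q_j$ and $$p_j^{(1)}(z)=\int_{\mathbb R_+}\frac{p_j(x)\alpha(x)}{z-x}dx,\quad p_j^{(2)}(z)=\int_{\mathbb R_+}\frac{p_j^{(1)}(-y)\beta(y)}{z+y}dy,\quad q_j^{(1)}(w)=\int_{\mathbb R_+}\frac{q_j(y)\beta(y)}{w-y}dy,\quad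 q_j^{(2)}(w)=\int_{\mathbb R_+}\frac{q_j^{(1)}(-x)\alpha(x)}{w+x}dx .$$ For a density $a$ let $W_a(z)=\int_{\mathbb R}\frac{a(x)}{z-x}dx$; further let $W_{\alpha^\star\beta}(w)=-\iint_{\mathbb R_+^2}\frac{\alpha(x)\beta(y)}{(w+x)(x+y)}dx\,dy$, $W_{\beta^\star\alpha}(z)=-\iint_{\mathbb R_+^2}\frac{\alpha(x)\beta(y)}{(z+y)(x+y)}dx\,dy$, and $$\mathbb F(w,z)=\begin{bmatrix}0&0&1\\0&1&W_{\beta^\star}(z)+W_\beta(w)\\1&W_\alpha(z)+W_{\alpha^\star}(w)&W_{\alpha^\star}(w)W_{\beta^\star}(z)+W_{\alpha^\star\beta}(w)+W_{\beta^\star\alpha}(z)\end{bmatrix},\qquad \mathbb J=\begin{bmatrix}0&0&1\\0&1&0\\1&0&0\end{bmatrix}.$$ For $n\ge 0$ define the $3\times3$ matrix kernel, with indices $\mu,\nu\in\{0,1,2\}$, by $$[\mathbb H_n(z,w)]_{\mu\nu}=\sum_{j=0}^{n-1}q_j^{(\mu)}(w)\,p_j^{(\nu)}(z)+\frac{\mathbb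 F_{\mu\nu}(w,z)}{z+w}.$$ Consider the Riemann–Hilbert problem of index $n$ for a $3\times 3$ matrix function $\widehat\Gamma$: (1) $\widehat\Gamma$ is analytic on $\Omega$; (2) on the real line $\widehat\Gamma_+=\widehat\Gamma_-V$ with $$V(x)=\begin{bmatrix}1&-2\pi i\,\alpha(x)&0\\0&1&-2\pi i\,\beta^\star(x)\\0&0&1\end{bmatrix},$$ in the sense that $\int_{\mathbb R}\varphi(x)\big(\widehat\Gamma(x+i\varepsilon)-\widehat\Gamma(x-i\varepsilon)V(x)\big)dx\to0$ as $\varepsilon\downarrow0$ for every continuous compactly supported $\varphi$; (3) $\widehat\Gamma(z)=(\mathbf 1+E(z))\operatorname{diag}(z^n,1,z^{-n})$ for $\operatorname{Im}z\ne0$ and $|z|$ large, where the entries of $E(z)$ are bounded by $\frac{C}{|z|}\big(1+\frac1{|\operatorname{Im}z|}\big)$ for some constant $C$. Then Cauchy biorthogonal polynomials exist, and for every $n\ge0$ the Riemann–Hilbert problem has a solution, unique on $\Omega$. If $p_j,q_j$ are the Cauchy biorthogonal polynomials and $\widehat\Gamma$ solves the Riemann–Hilbert problem of index $n$, then for all $z,w\in\mathbb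 C$ with $z\in\Omega$, $-w\in\Omega$ and $z+w\ne0$ the matrix $\widehat\Gamma(-w)$ is invertible and $$\mathbb H_n(z,w)=\frac{\mathbb J\,\widehat\Gamma(-w)^{-1}\,\widehat\Gamma(z)}{z+w}.$$ -/

import Mathlib

open MeasureTheory Set Filter Topology Polynomial

noncomputable section

namespace CauchyBOP

/-- `a` is a density on the positive half-line: measurable, nonnegative, vanishing outside
`(0,∞)` and not almost everywhere zero. -/
structure IsWeight (a : ℝ → ℝ) : Prop where
  measurable : Measurable a
  nonneg : ∀ x, 0 ≤ a x
  eq_zero : ∀ x, x ≤ 0 → a x = 0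
  ne_zero : ¬ a =ᵐ[volume] 0

/-- All bimoments `∬ x ^ j y ^ k α(x) β(y) / (x + y) dx dy` are finite. -/
def FiniteBimoments (α β : ℝ → ℝ) : Prop :=
  ∀ j k : ℕ, IntegrableOn
    (fun s : ℝ × ℝ => s.1 ^ j * s.2 ^ k / (s.1 + s.2) * (α s.1 * β s.2))
    (Ioi 0 ×ˢ Ioi 0)

/-- The Cauchy biorthogonal polynomials of `α(x)dx`, `β(y)dy`: exact degrees, equal and positive
leading coefficients, biorthonormal with respect to the Cauchy kernel. -/
structure IsCauchyBOP (α β : ℝ → ℝ) (p q : ℕ → ℝ[X]) : Prop where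
  natDegree_p : ∀ j, (p j).natDegree = j
  natDegree_q : ∀ j, (q j).natDegree = j
  leadingCoeff_eq : ∀ j, (p j).leadingCoeff = (q j).leadingCoeff
  leadingCoeff_pos : ∀ j, 0 < (p j).leadingCoeff
  biorthogonal : ∀ j k,
    (∫ x in Ioi (0 : ℝ), ∫ y in Ioi (0 : ℝ),
      (p j).eval x * (q k).eval y / (x + y) * (α x * β y)) = if j = k then 1 else 0

/-- `P⁽¹⁾(z) = ∫ P(x) a(x) / (z - x) dx`. -/
def trans₁ (a : ℝ → ℝ) (P : ℝ[X]) (z : ℂ) : ℂ :=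
  ∫ x in Ioi (0 : ℝ), ((P.eval x * a x : ℝ) : ℂ) / (z - x)

/-- `P⁽²⁾(z) = ∫ P⁽¹⁾(-y) b(y) / (z + y) dy`. -/
def trans₂ (a b : ℝ → ℝ) (P : ℝ[X]) (z : ℂ) : ℂ :=
  ∫ y in Ioi (0 : ℝ), trans₁ a P (-(y : ℂ)) * (b y : ℂ) / (z + y)

/-- `(P⁽⁰⁾(z), P⁽¹⁾(z), P⁽²⁾(z))`, with `P⁽⁰⁾ = P`. -/
def trans (a b : ℝ → ℝ) (P : ℝ[X]) (z : ℂ) : Fin 3 → ℂ :=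
  ![aeval z P, trans₁ a P z, trans₂ a b P z]

/-- The reflected density `a⋆(x) = a(-x)`. -/
def star (a : ℝ → ℝ) (x : ℝ) : ℝ := a (-x)

/-- The Weyl function `W_a(z) = ∫ a(x) / (z - x) dx`. -/
def weyl (a : ℝ → ℝ) (z : ℂ) : ℂ := ∫ x : ℝ, (a x : ℂ) / (z - x)

/-- The iterated Weyl function `W_{a⋆b}(z) = -∬ a(x) b(y) / ((z + x) (x + y)) dx dy`. -/
def weylStar (a b : ℝ → ℝ) (z : ℂ) : ℂ :=
  -∫ x in Ioi (0 : ℝ), ∫ y in Ioi (0 : ℝ), ((a x * b y : ℝ) : ℂ) / ((z + x) * (x + y))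

/-- The matrix `𝔽(w,z)`. -/
def matF (α β : ℝ → ℝ) (w z : ℂ) : Matrix (Fin 3) (Fin 3) ℂ :=
  !![0, 0, 1;
     0, 1, weyl (star β) z + weyl β w;
     1, weyl α z + weyl (star α) w,
       weyl (star α) w * weyl (star β) z + weylStar α β w + weylStar β α z]

/-- The matrix `𝕁`. -/
def matJ : Matrix (Fin 3) (Fin 3) ℂ := !![0, 0, 1; 0, 1, 0; 1, 0, 0]

/-- The matrix kernel `ℍ_n(z,w)`; the row index is `μ` and the column index is `ν`. -/
def matH (α β : ℝ → ℝ) (p q : ℕ → ℝ[X]) (n : ℕ) (z w : ℂ) : Matrix (Fin 3) (Fin 3) ℂ :=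
  Matrix.of fun μ ν =>
    (∑ j ∈ Finset.range n, trans β α (q j) w μ * trans α β (p j) z ν)
      + matF α β w z μ ν / (z + w)

/-- The support of the measure `a(x)dx`. -/
def supp (a : ℝ → ℝ) : Set ℝ :=
  (volume.withDensity fun x => ENNReal.ofReal (a x)).support

/-- The domain `ℂ ∖ (supp α ∪ supp β⋆)`. -/
def dom (α β : ℝ → ℝ) : Set ℂ :=
  ((fun x : ℝ => (x : ℂ)) '' (supp α ∪ supp (star β)))ᶜ

/-- The jump matrix on the real line. As `α` lives on the positive and `β⋆` on the negative
half-line, it has at most one nonzero off-diagonal entry at every point. -/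
def jump (α β : ℝ → ℝ) (x : ℝ) : Matrix (Fin 3) (Fin 3) ℂ :=
  !![1, -2 * Real.pi * Complex.I * α x, 0;
     0, 1, -2 * Real.pi * Complex.I * star β x;
     0, 0, 1]

/-- `G` solves the `3 × 3` Riemann–Hilbert problem of index `n`.

* The relation `G₊ = G₋ V` between the boundary values on the real line is understood in the sense
  of vague convergence: `G(x + iε) - G(x - iε) V(x)` tends to zero as `ε ↓ 0` against every
  continuous compactly supported function. The densities are merely measurable, so boundary values
  need not exist pointwise everywhere; the end points of the supports are included.
* `G(z) = (1 + O(1/z)) diag(z ^ n, 1, z ^ (-n))` as `z → ∞` off the real line: the constant in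
  `O(1/z)` is uniform for `|Im z| ≥ 1`, and may grow like `1 / |Im z|` towards the real line,
  which carries the (possibly unbounded) supports. -/
structure IsRHPSolution (α β : ℝ → ℝ) (n : ℕ) (G : ℂ → Matrix (Fin 3) (Fin 3) ℂ) : Prop where
  analytic : ∀ i j, AnalyticOnNhd ℂ (fun z => G z i j) (dom α β)
  jump_rel : ∀ φ : ℝ → ℝ, Continuous φ → HasCompactSupport φ → ∀ i j,
    Tendsto (fun ε : ℝ => ∫ x : ℝ, (φ x : ℂ) *
        (G (x + ε * Complex.I) - G (x - ε * Complex.I) * jump α β x) i j)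
      (𝓝[>] 0) (𝓝 0)
  asymptotic : ∃ (C R : ℝ) (E : ℂ → Matrix (Fin 3) (Fin 3) ℂ), 0 < R ∧
    ∀ z : ℂ, R ≤ ‖z‖ → z.im ≠ 0 →
      G z = (1 + E z) * Matrix.diagonal ![z ^ n, 1, (z ^ n)⁻¹] ∧
      ∀ i j, ‖E z i j‖ ≤ C / ‖z‖ * (1 + 1 / |z.im|)

end CauchyBOP

end

/-! Everything rests on uniqueness for single rows of the Riemann–Hilbert problem. Both sides of the
formula, multiplied by z + w, are as functions of z combinations of such rows, so they agree as soon
as their leading coefficients at infinity do. Boundary values exist only in the vague sense and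
cannot be multiplied; the argument is therefore linear throughout and makes no use of a formula for
det Γ.

Liouville. A function that is holomorphic off ℝ, has no vague jump and is O(|z|^(m-1) (1 + 1/|Im
z|)) is a polynomial of degree < m (`exists_polynomial_of_noJump`): contour integrals over large
squares show that its divided differences at m + 1 nonreal points vanish.

Nondegeneracy. By partial fractions the Stieltjes transform ∫ P(x) α(x) / (x + y) dx has at most deg
P positive zeros. Pairing P with the polynomial that vanishes where this transform changes sign
gives a nonzero number (`exists_nodal_pairing_pos`). Hence the pairing is nondegenerate in degrees <
n, monic orthogonal polynomials exist, and a sign computation at infinity makes their norms positive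
(`pairing_monic_pos`).

Uniqueness. Let a row have leading coefficients zero. Its first entry does not jump, so it is a
polynomial P of degree < n; subtracting (P, C[Pα], C[C[Pα]β⋆]), with C the Cauchy transform, leaves
zero by Liouville. Decay of the third entry beyond z^(-n) then says ⟨P, y^k⟩ = 0 for k < n, so P = 0
(`IsRow.eq_zero`).

Kernel. Put K(z,w) = (z + w) ℍ_n(z,w). For fixed w its row μ starts with the polynomial (z + w) Q +
const, where Q = ∑ q_j^(μ)(w) p_j. The reproducing property identifies ⟨Q, y^k⟩ with the transform
(y^k)^(μ)(w) for k < n, and the recurrence of these transforms in k makes the moments vanish that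
have to vanish (`exists_isRow_kernelMatrix`). Uniqueness gives K(z,w) = V Γ(z) with V independent of
z. Since K(-w,w) = 𝔽(w,-w) = 𝕁 (`matF_neg`), V = 𝕁 Γ(-w)⁻¹. The kernel at one fixed w, normalised by
V⁻¹, also supplies the solution whose existence is claimed. -/

namespace CauchyBOP

open Complex (I)

/-! ### Contour integrals over rectangles -/

/-- The integral of `f` along the positively oriented boundary of `[a, b] × [c, d]`. -/
noncomputable def rectIntegral (f : ℂ → ℂ) (a b c d : ℝ) : ℂ :=
  (∫ x in a..b, f (x + c * I)) - (∫ x in a..b, f (x + d * I))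
    + I * (∫ y in c..d, f (b + y * I)) - I * (∫ y in c..d, f (a + y * I))

/-- The hypotheses put arg ζ in (-π/2, 0), so adding π/2 does not leave the principal branch. This
compares the primitives on two adjacent sides at their common corner. -/
theorem log_I_mul {ζ : ℂ} (h1 : 0 < ζ.re) (h2 : 0 < (I * ζ).re) :
    Complex.log (I * ζ) = Complex.log ζ + Real.pi / 2 * I := by
  have hζ : ζ ≠ 0 := fun h => by simp [h] at h1
  have him : ζ.im < 0 := by simpa using h2
  have harg : |ζ.arg| < Real.pi / 2 := Complex.abs_arg_lt_pi_div_two_iff.2 (Or.inl h1)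
  rw [abs_lt] at harg
  rw [(Complex.log_mul_eq_add_log_iff Complex.I_ne_zero hζ).2, Complex.log_I]
  · ring
  · rw [Complex.arg_I]
    constructor <;> linarith [Real.pi_pos, harg.1, harg.2]

/-- The factor `u` rotates the segment into the right half-plane, where the principal logarithm is a
primitive; as a multiplicative constant it drops out of the derivative. -/
theorem integral_inv_affine {u v c : ℂ} {a b : ℝ} (hu : u ≠ 0)
    (h : ∀ t ∈ uIcc a b, 0 < (u * (c + t * v)).re) :
    v * ∫ t in a..b, ((c + t * v)⁻¹ : ℂ)
      = Complex.log (u * (c + b * v)) - Complex.log (u * (c + a * v)) := by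
  rw [← intervalIntegral.integral_const_mul]
  have hne : ∀ t ∈ uIcc a b, c + (t : ℂ) * v ≠ 0 := fun t ht h0 => by
    have := h t ht
    simp [h0] at this
  apply intervalIntegral.integral_eq_sub_of_hasDerivAt
    (f := fun t : ℝ => Complex.log (u * (c + t * v)))
  · intro t ht
    have h1 : HasDerivAt (fun t : ℝ => u * (c + (t : ℂ) * v)) (u * (1 * v)) t :=
      (((Complex.ofRealCLM.hasDerivAt (x := t)).mul_const v).const_add c).const_mul u
    have h2 := h1.clog_real (Or.inl (h t ht))
    rwa [mul_div_mul_left _ _ hu, one_mul, div_eq_mul_inv] at h2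
  · apply ContinuousOn.intervalIntegrable
    exact continuousOn_const.mul ((by fun_prop : Continuous fun t : ℝ => c + (t : ℂ) * v).continuousOn.inv₀ hne)

/-- The rotations i, -i, 1, -1 serve the bottom, top, right and left sides. At each of the four
corners the adjacent primitives differ by iπ/2, and these add up to 2πi. -/
theorem rectIntegral_inv_sub {a b c d : ℝ} {z₀ : ℂ} (ha : a < z₀.re) (hb : z₀.re < b)
    (hc : c < z₀.im) (hd : z₀.im < d) :
    rectIntegral (fun z => (z - z₀)⁻¹) a b c d = 2 * Real.pi * I := by
  have e1 := integral_inv_affine (u := I) (v := 1) (c := c * I - z₀) (a := a) (b := b)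
    Complex.I_ne_zero (by intro t _; simp; linarith)
  have e2 := integral_inv_affine (u := -I) (v := 1) (c := d * I - z₀) (a := a) (b := b)
    (neg_ne_zero.2 Complex.I_ne_zero) (by intro t _; simp; linarith)
  have e3 := integral_inv_affine (u := 1) (v := I) (c := b - z₀) (a := c) (b := d)
    one_ne_zero (by intro t _; simp; linarith)
  have e4 := integral_inv_affine (u := -1) (v := I) (c := a - z₀) (a := c) (b := d)
    (neg_ne_zero.2 one_ne_zero) (by intro t _; simp; linarith)
  have k1 := log_I_mul (ζ := b + c * I - z₀) (by simp; linarith) (by simp; linarith)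
  have k2 := log_I_mul (ζ := -I * (b + d * I - z₀)) (by simp; linarith) (by simp; linarith)
  have k3 := log_I_mul (ζ := -(a + d * I - z₀)) (by simp; linarith) (by simp; linarith)
  have k4 := log_I_mul (ζ := I * (a + c * I - z₀)) (by simp; linarith) (by simp; linarith)
  have hI : I * I = -1 := Complex.I_mul_I
  unfold rectIntegral
  rw [show (fun x : ℝ => ((x : ℂ) + c * I - z₀)⁻¹) = fun x : ℝ => (c * I - z₀ + x * 1)⁻¹ by
      funext x; congr 1; ring,
    show (fun x : ℝ => ((x : ℂ) + d * I - z₀)⁻¹) = fun x : ℝ => (d * I - z₀ + x * 1)⁻¹ by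
      funext x; congr 1; ring,
    show (fun x : ℝ => ((b : ℂ) + x * I - z₀)⁻¹) = fun x : ℝ => (b - z₀ + x * I)⁻¹ by
      funext x; congr 1; ring,
    show (fun x : ℝ => ((a : ℂ) + x * I - z₀)⁻¹) = fun x : ℝ => (a - z₀ + x * I)⁻¹ by
      funext x; congr 1; ring]
  rw [one_mul] at e1 e2
  rw [e1, e2, e3, e4]
  rw [show I * (↑c * I - z₀ + ↑b * 1) = I * (b + c * I - z₀) by ring, k1,
    show I * (-I * (b + d * I - z₀)) = b + d * I - z₀ by linear_combination -(b + d * I - z₀) * hI] at *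
  rw [show (1 : ℂ) * (b - z₀ + d * I) = b + d * I - z₀ by ring, k2,
    show (1 : ℂ) * (b - z₀ + c * I) = b + c * I - z₀ by ring,
    show -I * (d * I - z₀ + a * 1) = I * -(a + d * I - z₀) by ring, k3,
    show -I * (d * I - z₀ + b * 1) = -I * (b + d * I - z₀) by ring,
    show -1 * (a - z₀ + d * I) = -(a + d * I - z₀) by ring,
    show -1 * (a - z₀ + c * I) = I * (I * (a + c * I - z₀)) by linear_combination -(a + c * I - z₀) * hI, k4,
    show I * (c * I - z₀ + a * 1) = I * (a + c * I - z₀) by ring]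
  ring

theorem rectIntegral_add {f g : ℂ → ℂ} {a b c d : ℝ} {K : Set ℂ} (hf : ContinuousOn f K)
    (hg : ContinuousOn g K) (h1 : ∀ x ∈ uIcc a b, (x + c * I : ℂ) ∈ K)
    (h2 : ∀ x ∈ uIcc a b, (x + d * I : ℂ) ∈ K) (h3 : ∀ y ∈ uIcc c d, (b + y * I : ℂ) ∈ K)
    (h4 : ∀ y ∈ uIcc c d, (a + y * I : ℂ) ∈ K) :
    rectIntegral (fun z => f z + g z) a b c d = rectIntegral f a b c d + rectIntegral g a b c d := by
  have key : ∀ {f : ℂ → ℂ} {γ : ℝ → ℂ} {s t : ℝ}, ContinuousOn f K → Continuous γ →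
      (∀ x ∈ uIcc s t, γ x ∈ K) → IntervalIntegrable (fun x => f (γ x)) volume s t :=
    fun hf hγ h => (hf.comp hγ.continuousOn h).intervalIntegrable
  unfold rectIntegral
  rw [intervalIntegral.integral_add (key hf (by fun_prop) h1) (key hg (by fun_prop) h1),
    intervalIntegral.integral_add (key hf (by fun_prop) h2) (key hg (by fun_prop) h2),
    intervalIntegral.integral_add (key hf (by fun_prop) h3) (key hg (by fun_prop) h3),
    intervalIntegral.integral_add (key hf (by fun_prop) h4) (key hg (by fun_prop) h4)]
  ring

theorem rectIntegral_const_mul (f : ℂ → ℂ) (k : ℂ) (a b c d : ℝ) :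
    rectIntegral (fun z => k * f z) a b c d = k * rectIntegral f a b c d := by
  simp only [rectIntegral, intervalIntegral.integral_const_mul]
  ring

theorem rectIntegral_eq_zero {f : ℂ → ℂ} {a b c d : ℝ}
    (hf : DifferentiableOn ℂ f (uIcc a b ×ℂ uIcc c d)) : rectIntegral f a b c d = 0 := by
  have := Complex.integral_boundary_rect_eq_zero_of_differentiableOn f ⟨a, c⟩ ⟨b, d⟩ hf
  simpa [rectIntegral] using this

/-- The boundary of `[a, b] × [c, d]`. -/
def rectBoundary (a b c d : ℝ) : Set ℂ :=
  {z | z ∈ Icc a b ×ℂ Icc c d ∧ z ∉ Ioo a b ×ℂ Ioo c d}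

theorem rectIntegral_congr {f g : ℂ → ℂ} {a b c d : ℝ} (hab : a ≤ b) (hcd : c ≤ d)
    (h : ∀ z ∈ rectBoundary a b c d, f z = g z) :
    rectIntegral f a b c d = rectIntegral g a b c d := by
  unfold rectIntegral
  congr 1; congr 1; congr 1
  · exact intervalIntegral.integral_congr fun x hx => h _ (by
      rw [uIcc_of_le hab] at hx; simpa [rectBoundary, Complex.mem_reProdIm, hcd] using hx)
  · exact intervalIntegral.integral_congr fun x hx => h _ (by
      rw [uIcc_of_le hab] at hx; simpa [rectBoundary, Complex.mem_reProdIm, hcd] using hx)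
  · congr 1; exact intervalIntegral.integral_congr fun x hx => h _ (by
      rw [uIcc_of_le hcd] at hx; simpa [rectBoundary, Complex.mem_reProdIm, hab] using hx)
  · congr 1; exact intervalIntegral.integral_congr fun x hx => h _ (by
      rw [uIcc_of_le hcd] at hx; simpa [rectBoundary, Complex.mem_reProdIm, hab] using hx)

theorem rectIntegral_add' {f g : ℂ → ℂ} {a b c d : ℝ} (hab : a ≤ b) (hcd : c ≤ d)
    (hf : ContinuousOn f (rectBoundary a b c d)) (hg : ContinuousOn g (rectBoundary a b c d)) :
    rectIntegral (fun z => f z + g z) a b c d = rectIntegral f a b c d + rectIntegral g a b c d := by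
  refine rectIntegral_add hf hg ?_ ?_ ?_ ?_ <;> intro x hx
  · rw [uIcc_of_le hab] at hx; simpa [rectBoundary, Complex.mem_reProdIm, hcd] using hx
  · rw [uIcc_of_le hab] at hx; simpa [rectBoundary, Complex.mem_reProdIm, hcd] using hx
  · rw [uIcc_of_le hcd] at hx; simpa [rectBoundary, Complex.mem_reProdIm, hab] using hx
  · rw [uIcc_of_le hcd] at hx; simpa [rectBoundary, Complex.mem_reProdIm, hab] using hx

-- Inside the rectangle, f(z)/(z - z₀) splits into `dslope f z₀`, which is holomorphic and
-- contributes nothing, and f(z₀)/(z - z₀).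
open Classical in
theorem rectIntegral_mul_inv_sub {f : ℂ → ℂ} {a b c d : ℝ} {U : Set ℂ} (hab : a ≤ b) (hcd : c ≤ d)
    (hU : IsOpen U) (hf : DifferentiableOn ℂ f U) (hsub : Icc a b ×ℂ Icc c d ⊆ U) {z₀ : ℂ}
    (hz : z₀ ∉ rectBoundary a b c d) :
    rectIntegral (fun z => f z * (z - z₀)⁻¹) a b c d
      = if z₀ ∈ Icc a b ×ℂ Icc c d then 2 * Real.pi * I * f z₀ else 0 := by
  have hne : ∀ z ∈ rectBoundary a b c d, z - z₀ ≠ 0 := fun z hz' h0 => by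
    rw [sub_eq_zero] at h0; exact hz (h0 ▸ hz')
  have hsub' : rectBoundary a b c d ⊆ U := fun z h => hsub h.1
  split_ifs with hin
  · have hin' : z₀ ∈ Ioo a b ×ℂ Ioo c d := by
      by_contra h; exact hz ⟨hin, h⟩
    have hd : DifferentiableOn ℂ (dslope f z₀) U :=
      (Complex.differentiableOn_dslope (hU.mem_nhds (hsub hin))).2 hf
    rw [rectIntegral_congr (g := fun z => dslope f z₀ z + f z₀ * (z - z₀)⁻¹) hab hcd,
      rectIntegral_add' hab hcd (hd.continuousOn.mono hsub'), rectIntegral_const_mul,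
      rectIntegral_inv_sub hin'.1.1 hin'.1.2 hin'.2.1 hin'.2.2, rectIntegral_eq_zero]
    · ring
    · rw [uIcc_of_le hab, uIcc_of_le hcd]; exact hd.mono hsub
    · exact continuousOn_const.mul ((continuousOn_id.sub continuousOn_const).inv₀ hne)
    · intro z hz'
      have := hne z hz'
      rw [dslope_of_ne _ (sub_ne_zero.1 this), slope_def_field]
      field_simp
      ring
  · apply rectIntegral_eq_zero
    rw [uIcc_of_le hab, uIcc_of_le hcd]
    refine (hf.mono hsub).mul ((differentiableOn_id.sub_const _).inv fun z hz' h0 => ?_)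
    rw [sub_eq_zero] at h0
    exact hin (h0 ▸ hz')

open Classical in
theorem rectIntegral_mul_sum_inv_sub {f : ℂ → ℂ} {a b c d : ℝ} {U : Set ℂ} (hab : a ≤ b)
    (hcd : c ≤ d) (hU : IsOpen U) (hf : DifferentiableOn ℂ f U) (hsub : Icc a b ×ℂ Icc c d ⊆ U)
    (s : Finset ℂ) (r : ℂ → ℂ) (hs : ∀ ζ ∈ s, ζ ∉ rectBoundary a b c d) :
    rectIntegral (fun z => f z * ∑ ζ ∈ s, r ζ * (z - ζ)⁻¹) a b c d
      = ∑ ζ ∈ s, if ζ ∈ Icc a b ×ℂ Icc c d then 2 * Real.pi * I * (r ζ * f ζ) else 0 := by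
  induction s using Finset.induction_on with
  | empty => simp [rectIntegral]
  | insert ζ s hζ ih =>
    have hsub' : rectBoundary a b c d ⊆ U := fun z h => hsub h.1
    have hcont : ∀ ζ ∉ rectBoundary a b c d,
        ContinuousOn (fun z : ℂ => (z - ζ)⁻¹) (rectBoundary a b c d) := fun ζ h =>
      (continuousOn_id.sub continuousOn_const).inv₀ fun z hz h0 =>
        h ((sub_eq_zero.1 h0 : z = ζ) ▸ hz)
    have hfc := hf.continuousOn.mono hsub'
    have hζb := hs ζ (Finset.mem_insert_self _ _)
    rw [Finset.sum_insert hζ, ← ih fun ξ hξ => hs ξ (Finset.mem_insert_of_mem hξ)]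
    have h1 := rectIntegral_mul_inv_sub hab hcd hU hf hsub hζb
    rw [rectIntegral_congr
      (g := fun z => r ζ * (f z * (z - ζ)⁻¹) + f z * ∑ ζ ∈ s, r ζ * (z - ζ)⁻¹) hab hcd,
      rectIntegral_add' hab hcd, rectIntegral_const_mul, h1]
    · congr 1
      split_ifs
      · ring
      · simp
    · exact continuousOn_const.mul (hfc.mul (hcont ζ hζb))
    · exact hfc.mul (continuousOn_finsetSum _ fun ξ hξ => continuousOn_const.mul
        (hcont ξ (hs ξ (Finset.mem_insert_of_mem hξ))))
    · intro z _
      rw [Finset.sum_insert hζ]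
      ring

/-! ### A Liouville theorem for functions without jump -/

/-- Partial fractions of R / ∏ (x - vᵢ): a polynomial of degree below the number of nodes is its own
Lagrange interpolant. It serves both the contour kernel here and the Stieltjes transforms later. -/
theorem sum_nodalWeight_mul_inv_mul_eval {F ι : Type*} [Field F] [DecidableEq ι] {s : Finset ι}
    {v : ι → F} (hv : InjOn v s) {R : F[X]} (hR : R.degree < s.card) {x : F}
    (hx : ∀ i ∈ s, x ≠ v i) :
    ∑ i ∈ s, Lagrange.nodalWeight s v i * (x - v i)⁻¹ * R.eval (v i)
      = R.eval x / ∏ i ∈ s, (x - v i) := by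
  have h := Lagrange.eval_interpolate_not_at_node (s := s) (v := v) (x := x)
    (fun i => R.eval (v i)) hx
  rw [← Lagrange.eq_interpolate hv hR, Lagrange.eval_nodal] at h
  have hne : ∏ i ∈ s, (x - v i) ≠ 0 :=
    Finset.prod_ne_zero_iff.2 fun i hi => sub_ne_zero.2 (hx i hi)
  rw [h]
  field_simp

theorem continuous_along {f : ℂ → ℂ} (hf : ContinuousOn f {z | z.im ≠ 0}) {ε : ℝ} (hε : ε ≠ 0) :
    Continuous fun x : ℝ => f (x + ε * I) :=
  hf.comp_continuous (by fun_prop) fun x => by simpa using hε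

theorem continuous_along' {f : ℂ → ℂ} (hf : ContinuousOn f {z | z.im ≠ 0}) {ε : ℝ} (hε : ε ≠ 0) :
    Continuous fun x : ℝ => f (x - ε * I) :=
  hf.comp_continuous (by fun_prop) fun x => by simpa using hε

/-- The difference of the boundary values of `f` on the real line vanishes in the vague sense. -/
def NoJump (f : ℂ → ℂ) : Prop :=
  ∀ φ : ℝ → ℝ, Continuous φ → HasCompactSupport φ →
    Tendsto (fun ε : ℝ => ∫ x : ℝ, (φ x : ℂ) * (f (x + ε * I) - f (x - ε * I))) (𝓝[>] 0) (𝓝 0)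

theorem NoJump.complex {f : ℂ → ℂ} (hf : ContinuousOn f {z | z.im ≠ 0}) (h : NoJump f)
    {φ : ℝ → ℂ} (hφ : Continuous φ) (hc : HasCompactSupport φ) :
    Tendsto (fun ε : ℝ => ∫ x : ℝ, φ x * (f (x + ε * I) - f (x - ε * I))) (𝓝[>] 0) (𝓝 0) := by
  have hcr : HasCompactSupport fun x => (φ x).re := hc.comp_left Complex.zero_re
  have hci : HasCompactSupport fun x => (φ x).im := hc.comp_left Complex.zero_im
  have h1 := h _ (Complex.continuous_re.comp hφ) hcr
  have h2 := h _ (Complex.continuous_im.comp hφ) hci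
  have h3 := h1.add (h2.const_mul I)
  rw [mul_zero, add_zero] at h3
  refine h3.congr' ?_
  filter_upwards [self_mem_nhdsWithin] with ε hε
  have hε : ε ≠ 0 := ne_of_gt hε
  have hu : Continuous fun x : ℝ => f (x + ε * I) - f (x - ε * I) :=
    (continuous_along hf hε).sub (continuous_along' hf hε)
  have hint : ∀ ψ : ℝ → ℝ, Continuous ψ → HasCompactSupport ψ →
      Integrable fun x : ℝ => (ψ x : ℂ) * (f (x + ε * I) - f (x - ε * I)) := fun ψ h1 h2 =>
    ((Complex.continuous_ofReal.comp h1).mul hu).integrable_of_hasCompactSupport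
      ((h2.comp_left (g := fun x : ℝ => (x : ℂ)) Complex.ofReal_zero).mul_right)
  rw [← integral_const_mul, ← integral_add (hint _ (Complex.continuous_re.comp hφ) hcr)
    ((hint _ (Complex.continuous_im.comp hφ) hci).const_mul I)]
  congr 1
  funext x
  conv_rhs => rw [← Complex.re_add_im (φ x)]
  simp only [Function.comp]
  ring

/-- Here z runs over the boundary of the square of half-side L, and z' is z pushed away from the
real line. The factor z² - L² is at most 9 L |Im z| there and so absorbs the singularity 1/|Im z|
near ±L; the sum is 1 / ∏ (z - a), of order L^(-m-1), and compensates the growth L^(m-1) of f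
together with the remaining factor L². -/
theorem norm_mul_kernel_le {f : ℂ → ℂ} {C R L : ℝ} {m : ℕ} (hC : 0 ≤ C)
    (hbound : ∀ z : ℂ, R ≤ ‖z‖ → z.im ≠ 0 → ‖f z‖ ≤ C * ‖z‖ ^ m / ‖z‖ * (1 + 1 / |z.im|))
    {s : Finset ℂ} (hs : s.card = m + 1) (hL : 1 ≤ L) (hRL : R ≤ L) (hsL : ∀ a ∈ s, 2 * ‖a‖ ≤ L)
    {z z' : ℂ} (hre : |z.re| ≤ L) (him : |z.im| ≤ L) (hb : |z.re| = L ∨ |z.im| = L)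
    (hre' : z'.re = z.re) (him1 : |z.im| ≤ |z'.im|) (him2 : |z'.im| ≤ 2 * L) :
    ‖f z' * (z ^ 2 - L ^ 2) * ∑ a ∈ s, Lagrange.nodalWeight s id a * (z - a)⁻¹‖
      ≤ 18 * C * 3 ^ m * 2 ^ (m + 1) := by
  have hL0 : 0 < L := by linarith
  by_cases h0 : z.im = 0
  · have h1 : z ^ 2 - (L : ℂ) ^ 2 = 0 := by
      have h2 : |z.re| = L := by
        rcases hb with h | h
        · exact h
        · rw [h0, abs_zero] at h; linarith
      have h3 : z = (z.re : ℂ) := by apply Complex.ext <;> simp [h0]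
      rw [h3, ← h2]
      norm_cast
      simp
    rw [h1]
    simp
    positivity
  have hzim : 0 < |z.im| := abs_pos.2 h0
  have hz : L ≤ ‖z‖ := by
    rcases hb with h | h
    · rw [← h]; exact Complex.abs_re_le_norm z
    · rw [← h]; exact Complex.abs_im_le_norm z
  have hz' : L ≤ ‖z'‖ := by
    rcases hb with h | h
    · rw [← h, ← hre']; exact Complex.abs_re_le_norm z'
    · exact (h ▸ him1 : L ≤ |z'.im|).trans (Complex.abs_im_le_norm z')
  have hz'2 : ‖z'‖ ≤ 3 * L := by
    have := Complex.norm_le_abs_re_add_abs_im z'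
    rw [hre'] at this
    linarith
  have hf : ‖f z'‖ ≤ C * (3 * L) ^ m / L * (1 + 1 / |z.im|) := by
    refine (hbound z' (hRL.trans hz') (abs_pos.1 (hzim.trans_le him1))).trans ?_
    gcongr
  have hN : ‖z ^ 2 - (L : ℂ) ^ 2‖ ≤ 9 * L * |z.im| := by
    have e : z ^ 2 - (L : ℂ) ^ 2 = (z - L) * (z + L) := by ring
    have hLn : ‖(L : ℂ)‖ = L := by simp [abs_of_pos hL0]
    have hzn : ‖z‖ ≤ 2 * L := by
      have := Complex.norm_le_abs_re_add_abs_im z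
      linarith
    have n1 : ‖z - L‖ ≤ 3 * L := by
      have := norm_sub_le z (L : ℂ); rw [hLn] at this; linarith
    have n2 : ‖z + L‖ ≤ 3 * L := by
      have := norm_add_le z (L : ℂ); rw [hLn] at this; linarith
    rw [e, norm_mul]
    rcases hb with h | h
    · rcases (abs_eq hL0.le).1 h with h | h
      · have : z - L = z.im * I := by apply Complex.ext <;> simp [h]
        rw [this]
        simp only [norm_mul, Complex.norm_real, Complex.norm_I, Real.norm_eq_abs, mul_one]
        nlinarith
      · have : z + L = z.im * I := by apply Complex.ext <;> simp [h]
        rw [this]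
        simp only [norm_mul, Complex.norm_real, Complex.norm_I, Real.norm_eq_abs, mul_one]
        nlinarith
    · rw [h]
      nlinarith [norm_nonneg (z - L), norm_nonneg (z + L)]
  have hza : ∀ a ∈ s, L / 2 ≤ ‖z - a‖ := fun a ha => by
    have := norm_sub_norm_le z a
    have := hsL a ha
    linarith
  have hsum : ‖∑ a ∈ s, Lagrange.nodalWeight s id a * (z - a)⁻¹‖ ≤ ((L / 2) ^ (m + 1))⁻¹ := by
    have h1 := sum_nodalWeight_mul_inv_mul_eval (s := s) (v := id) (R := 1) (x := z)
      (injOn_id _)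
      (by rw [degree_one, hs]; exact_mod_cast Nat.succ_pos m) (fun a ha h => by
        have := hza a ha; rw [h, id_eq, sub_self, norm_zero] at this; linarith)
    simp only [eval_one, mul_one, id_eq] at h1
    rw [h1, norm_div, norm_one, one_div, norm_prod]
    apply inv_anti₀ (by positivity)
    rw [← hs, ← Finset.prod_const]
    exact Finset.prod_le_prod (fun _ _ => by positivity) hza
  rw [norm_mul, norm_mul]
  calc ‖f z'‖ * ‖z ^ 2 - (L : ℂ) ^ 2‖ * ‖∑ a ∈ s, Lagrange.nodalWeight s id a * (z - a)⁻¹‖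
      ≤ (C * (3 * L) ^ m / L * (1 + 1 / |z.im|)) * (9 * L * |z.im|) * ((L / 2) ^ (m + 1))⁻¹ := by
        gcongr
    _ = C * (3 * L) ^ m * 9 * (|z.im| + 1) * ((L / 2) ^ (m + 1))⁻¹ := by
        field_simp
    _ ≤ C * (3 * L) ^ m * 9 * (L + L) * ((L / 2) ^ (m + 1))⁻¹ := by
        gcongr
    _ = 18 * C * 3 ^ m * 2 ^ (m + 1) := by
        rw [mul_pow, div_pow]
        field_simp
        ring

/-- The residue theorem is applied to the upper and the lower half of the square, with f shifted by
±iε so that it is holomorphic up to the real side. The two real sides combine into an integral that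
tends to 0 by `NoJump`; the other six sides have total length 8L and a bounded integrand. -/
theorem norm_sum_nodalWeight_le {f : ℂ → ℂ} {C R L : ℝ} {m : ℕ} (hC : 0 ≤ C)
    (hf : DifferentiableOn ℂ f {z | z.im ≠ 0}) (hj : NoJump f)
    (hbound : ∀ z : ℂ, R ≤ ‖z‖ → z.im ≠ 0 → ‖f z‖ ≤ C * ‖z‖ ^ m / ‖z‖ * (1 + 1 / |z.im|))
    {s : Finset ℂ} (hs : s.card = m + 1) (hsim : ∀ a ∈ s, a.im ≠ 0)
    (hL : 1 ≤ L) (hRL : R ≤ L) (hsL : ∀ a ∈ s, 2 * ‖a‖ ≤ L) :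
    ‖∑ a ∈ s, 2 * Real.pi * I * (Lagrange.nodalWeight s id a * (f a * (a ^ 2 - L ^ 2)))‖
      ≤ 8 * (18 * C * 3 ^ m * 2 ^ (m + 1)) * L := by
  classical
  have hL0 : 0 < L := by linarith
  set K : ℝ := 18 * C * 3 ^ m * 2 ^ (m + 1) with hK
  set S : ℂ → ℂ := fun z => ∑ a ∈ s, Lagrange.nodalWeight s id a * (z - a)⁻¹ with hS
  set σ : ℂ → ℝ := fun a => if 0 < a.im then 1 else -1 with hσ
  -- Clamping x to [-L, L] amounts to extension by zero, since x² - L² vanishes at ±L; this makes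
  -- the test function continuous.
  set φ : ℝ → ℂ := fun x =>
    (((max (-L) (min L x) : ℝ) : ℂ) ^ 2 - (L : ℂ) ^ 2) * S (max (-L) (min L x) : ℝ) with hφ
  have hScont : Continuous fun x : ℝ => S x := by
    refine continuous_finsetSum _ fun a ha => continuous_const.mul (Continuous.inv₀ (by fun_prop) ?_)
    intro x h0
    apply hsim a ha
    rw [← sub_eq_zero.1 h0, Complex.ofReal_im]
  have hclamp : Continuous fun x : ℝ => max (-L) (min L x) := by fun_prop
  have hφc : Continuous φ :=
    (by fun_prop : Continuous fun x : ℝ => ((max (-L) (min L x) : ℝ) : ℂ) ^ 2 - (L : ℂ) ^ 2).mul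
      (hScont.comp hclamp)
  have hφ0 : ∀ x, x ∉ Ioc (-L) L → φ x = 0 := by
    intro x hx
    rw [hφ]
    simp only
    rcases le_or_gt x (-L) with h | h
    · rw [min_eq_right (by linarith), max_eq_left h]; simp
    · have : L < x := by
        by_contra h'; exact hx ⟨h, not_lt.1 h'⟩
      rw [min_eq_left this.le, max_eq_right (by linarith)]; simp
  have hφs : HasCompactSupport φ := HasCompactSupport.intro isCompact_Icc fun x hx =>
    hφ0 x fun h => hx (Ioc_subset_Icc_self h)
  have hφin : ∀ x ∈ uIcc (-L) L, φ x = ((x : ℂ) ^ 2 - (L : ℂ) ^ 2) * S x := by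
    intro x hx
    rw [uIcc_of_le (by linarith)] at hx
    rw [hφ]
    simp only
    rw [min_eq_right hx.2, max_eq_right hx.1]
  have hT := hj.complex hf.continuousOn hφc hφs
  have hlim : Tendsto (fun ε : ℝ => ∑ a ∈ s, 2 * Real.pi * I * (Lagrange.nodalWeight s id a *
      (f (a + σ a * ε * I) * (a ^ 2 - L ^ 2)))) (𝓝[>] 0)
      (𝓝 (∑ a ∈ s, 2 * Real.pi * I * (Lagrange.nodalWeight s id a * (f a * (a ^ 2 - L ^ 2))))) := by
    refine tendsto_finsetSum _ fun a ha => ((Tendsto.mul_const _ ?_).const_mul _).const_mul _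
    have hca : ContinuousAt f a := by
      refine (hf.differentiableAt (IsOpen.mem_nhds ?_ (hsim a ha))).continuousAt
      exact (isOpen_ne (x := (0 : ℝ))).preimage Complex.continuous_im
    have h1 : Tendsto (fun ε : ℝ => a + σ a * ε * I) (𝓝[>] 0) (𝓝 a) := by
      have : Continuous fun ε : ℝ => a + σ a * (ε : ℂ) * I := by fun_prop
      have := this.tendsto 0
      simp only [Complex.ofReal_zero, mul_zero, zero_mul, add_zero] at this
      exact this.mono_left nhdsWithin_le_nhds
    exact hca.tendsto.comp h1
  have hlim2 := (hlim.sub hT).norm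
  rw [sub_zero] at hlim2
  refine le_of_tendsto hlim2 ?_
  filter_upwards [Ioo_mem_nhdsGT (zero_lt_one (α := ℝ))] with ε hε
  have hbd : ∀ a ∈ s, |a.re| < L ∧ |a.im| < L := fun a ha => by
    have := hsL a ha
    have h1 := Complex.abs_re_le_norm a
    have h2 := Complex.abs_im_le_norm a
    constructor <;> linarith [abs_pos.2 (hsim a ha)]
  have hU := rectIntegral_mul_sum_inv_sub (f := fun z => f (z + ε * I) * (z ^ 2 - L ^ 2))
    (a := -L) (b := L) (c := 0) (d := L) (U := {z | -ε < z.im}) (by linarith) hL0.le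
    (isOpen_lt continuous_const Complex.continuous_im)
    (((hf.comp (by fun_prop) fun z hz => by
      simp only [mem_ofPred_eq] at hz ⊢; simp; linarith)).mul (by fun_prop))
    (fun z hz => by have := hz.2.1; simp only [mem_ofPred_eq] at this ⊢; linarith [hε.1]) s
    (Lagrange.nodalWeight s id) (fun a ha h => h.2 (by
      obtain ⟨h1, h2⟩ := hbd a ha
      rw [abs_lt] at h1 h2
      have := h.1.2.1
      exact ⟨⟨h1.1, h1.2⟩, lt_of_le_of_ne this (hsim a ha).symm, h2.2⟩))
  have hD := rectIntegral_mul_sum_inv_sub (f := fun z => f (z - ε * I) * (z ^ 2 - L ^ 2))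
    (a := -L) (b := L) (c := -L) (d := 0) (U := {z | z.im < ε}) (by linarith) (by linarith)
    (isOpen_lt Complex.continuous_im continuous_const)
    (((hf.comp (by fun_prop) fun z hz => by
      simp only [mem_ofPred_eq] at hz ⊢; simp; linarith)).mul (by fun_prop))
    (fun z hz => by have := hz.2.2; simp only [mem_ofPred_eq] at this ⊢; linarith [hε.1]) s
    (Lagrange.nodalWeight s id) (fun a ha h => h.2 (by
      obtain ⟨h1, h2⟩ := hbd a ha
      rw [abs_lt] at h1 h2
      have := h.1.2.2
      exact ⟨⟨h1.1, h1.2⟩, h2.1, lt_of_le_of_ne this (hsim a ha)⟩))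
  have htot : ∑ a ∈ s, 2 * Real.pi * I * (Lagrange.nodalWeight s id a *
      (f (a + σ a * ε * I) * (a ^ 2 - L ^ 2))) =
      rectIntegral (fun z => f (z + ε * I) * (z ^ 2 - L ^ 2) * S z) (-L) L 0 L +
      rectIntegral (fun z => f (z - ε * I) * (z ^ 2 - L ^ 2) * S z) (-L) L (-L) 0 := by
    rw [hU, hD, ← Finset.sum_add_distrib]
    refine Finset.sum_congr rfl fun a ha => ?_
    obtain ⟨h1, h2⟩ := hbd a ha
    rw [abs_lt] at h1 h2
    rcases lt_or_gt_of_ne (hsim a ha) with h | h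
    · rw [if_neg, if_pos, zero_add, hσ]
      · simp only [if_neg (not_lt.2 h.le)]
        push_cast
        congr 4
        ring
      · exact ⟨⟨h1.1.le, h1.2.le⟩, h2.1.le, h.le⟩
      · exact fun h' => absurd h'.2.1 (not_le.2 h)
    · rw [if_pos, if_neg, add_zero, hσ]
      · simp only [if_pos h]
        push_cast
        congr 4
        ring
      · exact fun h' => absurd h'.2.2 (not_le.2 h)
      · exact ⟨⟨h1.1.le, h1.2.le⟩, h.le, h2.2.le⟩
  have hmid : ∫ x : ℝ, φ x * (f (x + ε * I) - f (x - ε * I)) =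
      (∫ x in (-L)..L, f (x + (0 : ℝ) * I + ε * I) * ((x + (0 : ℝ) * I) ^ 2 - L ^ 2) * S (x + (0 : ℝ) * I)) -
      (∫ x in (-L)..L, f (x + (0 : ℝ) * I - ε * I) * ((x + (0 : ℝ) * I) ^ 2 - L ^ 2) * S (x + (0 : ℝ) * I)) := by
    have hc1 := continuous_along hf.continuousOn hε.1.ne'
    have hc2 := continuous_along' hf.continuousOn hε.1.ne'
    simp only [Complex.ofReal_zero, zero_mul, add_zero]
    rw [← intervalIntegral.integral_sub]
    · rw [← intervalIntegral.integral_eq_integral_of_support_subset (a := -L) (b := L)]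
      · refine intervalIntegral.integral_congr fun x hx => ?_
        simp only [hφin x hx]
        ring
      · intro x hx
        by_contra h
        exact hx (by simp only [hφ0 x h, zero_mul])
    · exact ((hc1.mul (by fun_prop)).mul hScont).intervalIntegrable _ _
    · exact ((hc2.mul (by fun_prop)).mul hScont).intervalIntegrable _ _
  have hker : ∀ z z' : ℂ, |z.re| ≤ L → |z.im| ≤ L → (|z.re| = L ∨ |z.im| = L) →
      z'.re = z.re → |z.im| ≤ |z'.im| → |z'.im| ≤ 2 * L →
      ‖f z' * (z ^ 2 - L ^ 2) * S z‖ ≤ K := fun z z' h1 h2 h3 h4 h5 h6 =>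
    norm_mul_kernel_le hC hbound hs hL hRL hsL h1 h2 h3 h4 h5 h6
  rw [htot, hmid]
  have hε1 := hε.1
  have hε2 := hε.2
  have hh : ∀ c δ : ℝ, |c| = L → |c| ≤ |c + δ| → |δ| ≤ 1 →
      ‖∫ x in (-L)..L, f (x + c * I + δ * I) * ((x + c * I) ^ 2 - L ^ 2) * S (x + c * I)‖
        ≤ 2 * K * L := by
    intro c δ h1 h2 h3
    refine (intervalIntegral.norm_integral_le_of_norm_le_const (C := K) fun x hx => ?_).trans_eq
      (by rw [abs_of_pos (by linarith)]; ring)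
    rw [uIoc_of_le (by linarith)] at hx
    have := abs_add_le c δ
    refine hker _ _ ?_ ?_ ?_ ?_ ?_ ?_ <;> simp only [Complex.add_re, Complex.ofReal_re,
      Complex.re_ofReal_mul, Complex.I_re, mul_zero, add_zero, Complex.add_im, Complex.ofReal_im,
      Complex.im_ofReal_mul, Complex.I_im, mul_one, zero_add]
    · exact abs_le.2 ⟨hx.1.le, hx.2⟩
    · exact h1.le
    · exact Or.inr h1
    · exact h2
    · linarith
  have hv : ∀ a c d δ : ℝ, |a| = L → c ≤ d → d - c = L → -L ≤ c → d ≤ L →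
      (∀ y ∈ Icc c d, |y| ≤ |y + δ|) → |δ| ≤ 1 →
      ‖∫ y in c..d, f (a + y * I + δ * I) * ((a + y * I) ^ 2 - L ^ 2) * S (a + y * I)‖
        ≤ K * L := by
    intro a c d δ h1 h2 h3 h4 h5 h6 h7
    refine (intervalIntegral.norm_integral_le_of_norm_le_const (C := K) fun y hy => ?_).trans_eq
      (by rw [abs_of_nonneg (by linarith), h3])
    rw [uIoc_of_le (by linarith)] at hy
    have hyL : |y| ≤ L := abs_le.2 ⟨by linarith [hy.1], by linarith [hy.2]⟩
    have := abs_add_le y δ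
    refine hker _ _ ?_ ?_ ?_ ?_ ?_ ?_ <;> simp only [Complex.add_re, Complex.ofReal_re,
      Complex.re_ofReal_mul, Complex.I_re, mul_zero, add_zero, Complex.add_im, Complex.ofReal_im,
      Complex.im_ofReal_mul, Complex.I_im, mul_one, zero_add]
    · exact h1.le
    · exact hyL
    · exact Or.inl h1
    · exact h6 y ⟨hy.1.le, hy.2⟩
    · linarith
  have habs : |ε| ≤ 1 := by rw [abs_of_pos hε1]; exact hε2.le
  have habs' : |-ε| ≤ 1 := by rw [abs_neg]; exact habs
  have hup : ∀ y ∈ Icc 0 L, |y| ≤ |y + ε| := fun y hy => by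
    rw [abs_of_nonneg hy.1, abs_of_nonneg (by linarith [hy.1])]; linarith
  have hdn : ∀ y ∈ Icc (-L) 0, |y| ≤ |y + -ε| := fun y hy => by
    rw [abs_of_nonpos hy.2, abs_of_nonpos (by linarith [hy.2])]; linarith
  have hLL : |L| = L := abs_of_pos hL0
  have hLL' : |-L| = L := by rw [abs_neg, hLL]
  have b1 := hh L ε hLL (hup L ⟨hL0.le, le_rfl⟩) habs
  have b2 := hh (-L) (-ε) hLL' (hdn (-L) ⟨le_rfl, by linarith⟩) habs'
  have b3 := hv L 0 L ε hLL hL0.le (by ring) (by linarith) le_rfl hup habs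
  have b4 := hv (-L) 0 L ε hLL' hL0.le (by ring) (by linarith) le_rfl hup habs
  have b5 := hv L (-L) 0 (-ε) hLL (by linarith) (by ring) le_rfl hL0.le hdn habs'
  have b6 := hv (-L) (-L) 0 (-ε) hLL' (by linarith) (by ring) le_rfl hL0.le hdn habs'
  simp only [Complex.ofReal_neg ε, neg_mul, ← sub_eq_add_neg] at b2 b5 b6
  have hfin : ∀ m₁ m₂ t b r l r' l' : ℂ, ‖t‖ ≤ 2 * K * L → ‖b‖ ≤ 2 * K * L → ‖r‖ ≤ K * L →
      ‖l‖ ≤ K * L → ‖r'‖ ≤ K * L → ‖l'‖ ≤ K * L →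
      ‖(m₁ - t + I * r - I * l) + (b - m₂ + I * r' - I * l') - (m₁ - m₂)‖ ≤ 8 * K * L := by
    intro m₁ m₂ t b r l r' l' h1 h2 h3 h4 h5 h6
    have e : (m₁ - t + I * r - I * l) + (b - m₂ + I * r' - I * l') - (m₁ - m₂)
        = (b - t) + I * ((r - l) + (r' - l')) := by ring
    rw [e]
    have n1 := norm_add_le (b - t) (I * ((r - l) + (r' - l')))
    rw [norm_mul, Complex.norm_I, one_mul] at n1
    linarith [norm_sub_le b t, norm_add_le (r - l) (r' - l'), norm_sub_le r l, norm_sub_le r' l']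
  exact hfin _ _ _ _ _ _ _ _ b1 b2 b3 b4 b5 b6

/-- The residue sum is 2πi (T - L² S) with T and S independent of L, while it is only O(L). Dividing
by L² and letting L → ∞ gives S = 0. -/
theorem sum_nodalWeight_mul_eq_zero {f : ℂ → ℂ} {C R : ℝ} {m : ℕ}
    (hf : DifferentiableOn ℂ f {z | z.im ≠ 0}) (hj : NoJump f)
    (hbound : ∀ z : ℂ, R ≤ ‖z‖ → z.im ≠ 0 → ‖f z‖ ≤ C * ‖z‖ ^ m / ‖z‖ * (1 + 1 / |z.im|))
    {s : Finset ℂ} (hs : s.card = m + 1) (hsim : ∀ a ∈ s, a.im ≠ 0) :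
    ∑ a ∈ s, Lagrange.nodalWeight s id a * f a = 0 := by
  set S := ∑ a ∈ s, Lagrange.nodalWeight s id a * f a with hS
  set T := ∑ a ∈ s, Lagrange.nodalWeight s id a * (f a * a ^ 2) with hT
  set K := 8 * (18 * max C 0 * 3 ^ m * 2 ^ (m + 1)) with hK
  obtain ⟨B, hB⟩ : ∃ B, ∀ a ∈ s, 2 * ‖a‖ ≤ B := by
    obtain ⟨B, hB⟩ := (s.image fun a : ℂ => 2 * ‖a‖).bddAbove
    exact ⟨B, fun a ha => hB (by simpa using ⟨a, ha, rfl⟩)⟩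
  have key : ∀ᶠ L : ℝ in atTop, ‖2 * Real.pi * I * (T * ((L ^ 2)⁻¹ : ℝ) - S)‖ ≤ K * L⁻¹ := by
    filter_upwards [eventually_ge_atTop 1, eventually_ge_atTop R, eventually_ge_atTop B]
      with L h1 h2 h3
    have hL0 : 0 < L := by linarith
    have h := norm_sum_nodalWeight_le (C := max C 0) (le_max_right _ _) hf hj (fun z h h' =>
      (hbound z h h').trans (by gcongr; exact le_max_left _ _)) hs hsim h1 h2
      fun a ha => (hB a ha).trans h3
    have e : ∑ a ∈ s, 2 * Real.pi * I * (Lagrange.nodalWeight s id a * (f a * (a ^ 2 - L ^ 2)))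
        = (2 * Real.pi * I * (T * ((L ^ 2)⁻¹ : ℝ) - S)) * (L ^ 2 : ℝ) := by
      have hLc : (L : ℂ) ≠ 0 := by exact_mod_cast hL0.ne'
      have : (2 * Real.pi * I * (T * ((L ^ 2)⁻¹ : ℝ) - S)) * (L ^ 2 : ℝ)
        = 2 * Real.pi * I * (T - S * L ^ 2) := by
        push_cast
        field_simp
      rw [this, hT, hS, Finset.sum_mul, ← Finset.sum_sub_distrib, Finset.mul_sum]
      exact Finset.sum_congr rfl fun a _ => by ring
    rw [e, norm_mul, Complex.norm_real, Real.norm_of_nonneg (by positivity)] at h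
    rw [← le_div_iff₀ (by positivity)] at h
    refine h.trans_eq ?_
    rw [hK]
    field_simp
  have h0 : Tendsto (fun L : ℝ => K * L⁻¹) atTop (𝓝 0) := by
    simpa using tendsto_inv_atTop_zero.const_mul K
  have h1 : Tendsto (fun L : ℝ => 2 * Real.pi * I * (T * ((L ^ 2)⁻¹ : ℝ) - S)) atTop
      (𝓝 (2 * Real.pi * I * (T * (0 : ℝ) - S))) := by
    have : Tendsto (fun L : ℝ => (L ^ 2)⁻¹) atTop (𝓝 0) :=
      tendsto_inv_atTop_zero.comp (tendsto_pow_atTop two_ne_zero)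
    exact ((((Complex.continuous_ofReal.tendsto 0).comp this).const_mul T).sub_const S).const_mul _
  have h2 := tendsto_nhds_unique h1 (squeeze_zero_norm' key h0)
  simpa [Real.pi_ne_zero] using h2

/-- A function that is holomorphic off the real line, does not jump across it and grows at most
like `|z| ^ (m - 1)`, up to a simple singularity towards the real line, is a polynomial of degree
less than `m`. -/
theorem exists_polynomial_of_noJump {f : ℂ → ℂ} {C R : ℝ} {m : ℕ}
    (hf : DifferentiableOn ℂ f {z | z.im ≠ 0}) (hj : NoJump f)
    (hbound : ∀ z : ℂ, R ≤ ‖z‖ → z.im ≠ 0 → ‖f z‖ ≤ C * ‖z‖ ^ m / ‖z‖ * (1 + 1 / |z.im|)) :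
    ∃ P : ℂ[X], P.degree < m ∧ ∀ z : ℂ, z.im ≠ 0 → f z = P.eval z := by
  classical
  set T : Finset ℂ := (Finset.range m).image fun k : ℕ => ((k + 1 : ℝ) : ℂ) * I with hT
  have hTcard : T.card = m := by
    rw [hT, Finset.card_image_of_injective, Finset.card_range]
    intro a b hab
    have := mul_right_cancel₀ Complex.I_ne_zero hab
    simpa using this
  have hTim : ∀ a ∈ T, a.im ≠ 0 := by
    intro a ha
    obtain ⟨k, -, rfl⟩ := Finset.mem_image.1 ha
    simp only [Complex.im_ofReal_mul, Complex.I_im, mul_one]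
    positivity
  refine ⟨Lagrange.interpolate T id f, ?_, fun z hz => ?_⟩
  · rw [← hTcard]; exact Lagrange.degree_interpolate_lt _ (injOn_id _)
  by_cases hzT : z ∈ T
  · exact (Lagrange.eval_interpolate_at_node f (injOn_id _) hzT).symm
  have hne : ∀ a ∈ T, z ≠ a := fun a ha h => hzT (h ▸ ha)
  -- The divided difference of f at the nodes together with z vanishes, which says that f(z) is the
  -- value of the interpolant.
  have h := sum_nodalWeight_mul_eq_zero hf hj hbound (s := insert z T)
    (by rw [Finset.card_insert_of_notMem hzT, hTcard]) (by
      intro a ha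
      rcases Finset.mem_insert.1 ha with rfl | ha
      exacts [hz, hTim a ha])
  have hprod : ∏ a ∈ T, (z - a) ≠ 0 :=
    Finset.prod_ne_zero_iff.2 fun a ha => sub_ne_zero.2 (hne a ha)
  rw [Finset.sum_insert hzT] at h
  have e1 : Lagrange.nodalWeight (insert z T) id z = (∏ a ∈ T, (z - a))⁻¹ := by
    rw [Lagrange.nodalWeight, Finset.erase_insert hzT, Finset.prod_inv_distrib]
    rfl
  have e2 : ∀ a ∈ T, Lagrange.nodalWeight (insert z T) id a * f a
      = -(Lagrange.nodalWeight T id a * (z - a)⁻¹ * f a) := by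
    intro a ha
    have hza := hne a ha
    rw [Lagrange.nodalWeight, Finset.erase_insert_of_ne hza, Finset.prod_insert
      (fun h => hzT (Finset.mem_of_mem_erase h)), Lagrange.nodalWeight]
    simp only [id]
    rw [← neg_sub z a, inv_neg]
    ring
  rw [e1, Finset.sum_congr rfl e2, Finset.sum_neg_distrib] at h
  rw [Lagrange.eval_interpolate_not_at_node (v := id) f hne, Lagrange.eval_nodal]
  simp only [id]
  have h' := eq_of_sub_eq_zero ((sub_eq_add_neg _ _).trans h)
  rw [← h']
  field_simp

/-! ### Integrability -/

theorem FiniteBimoments.integrable {α β : ℝ → ℝ} (hα : IsWeight α) (hβ : IsWeight β)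
    (h : FiniteBimoments α β) (j k : ℕ) :
    Integrable fun s : ℝ × ℝ => s.1 ^ j * s.2 ^ k / (s.1 + s.2) * (α s.1 * β s.2) := by
  refine (integrableOn_iff_integrable_of_support_subset ?_).1 (h j k)
  intro s hs
  refine ⟨?_, ?_⟩
  · by_contra h0
    exact hs (by simp [hα.eq_zero _ (not_lt.1 h0)])
  · by_contra h0
    exact hs (by simp [hβ.eq_zero _ (not_lt.1 h0)])

theorem FiniteBimoments.symm {α β : ℝ → ℝ} (hα : IsWeight α) (hβ : IsWeight β)
    (h : FiniteBimoments α β) : FiniteBimoments β α := fun j k => by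
  have := (h.integrable hα hβ k j).swap
  refine (this.congr (ae_of_all _ fun s => ?_)).integrableOn
  simp only [Function.comp, Prod.fst_swap, Prod.snd_swap, add_comm s.2 s.1, mul_comm (α s.2)]
  ring

/-- Since x^k = (x^(k+1) + x^k y) / (x + y), the function x^k α(x) β(y) is integrable on the plane.
By Fubini almost every slice is integrable, and β(y) ≠ 0 for enough y to pick one. -/
theorem FiniteBimoments.integrable_moment {α β : ℝ → ℝ} (hα : IsWeight α) (hβ : IsWeight β)
    (h : FiniteBimoments α β) (k : ℕ) : Integrable fun x => x ^ k * α x := by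
  have h1 : Integrable fun s : ℝ × ℝ => s.1 ^ k * α s.1 * β s.2 := by
    refine ((h.integrable hα hβ (k + 1) 0).add (h.integrable hα hβ k 1)).congr
      (ae_of_all _ fun s => ?_)
    by_cases h1 : s.1 ≤ 0
    · simp [hα.eq_zero _ h1]
    by_cases h2 : s.2 ≤ 0
    · simp [hβ.eq_zero _ h2]
    have : s.1 + s.2 ≠ 0 := by linarith
    simp only [Pi.add_apply]
    field_simp
    ring
  have h2 := (Measure.volume_eq_prod ℝ ℝ ▸ h1).prod_left_ae
  by_contra hc
  apply hβ.ne_zero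
  filter_upwards [h2] with y hy
  by_contra h0
  apply hc
  refine (hy.mul_const (β y)⁻¹).congr (ae_of_all _ fun x => ?_)
  have : β y ≠ 0 := h0
  simp only
  field_simp

section

variable {α β : ℝ → ℝ}

theorem integrable_eval_mul (hα : IsWeight α) (hβ : IsWeight β) (h : FiniteBimoments α β)
    (P : ℝ[X]) : Integrable fun x => P.eval x * α x := by
  simp_rw [eval_eq_sum_range, Finset.sum_mul]
  refine integrable_finsetSum _ fun i _ => ?_
  simpa [mul_assoc] using (h.integrable_moment hα hβ i).const_mul (P.coeff i)

theorem integrable_eval_mul_complex (hα : IsWeight α) (hβ : IsWeight β) (h : FiniteBimoments α β)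
    (P : ℂ[X]) : Integrable fun x : ℝ => P.eval (x : ℂ) * α x := by
  simp_rw [eval_eq_sum_range, Finset.sum_mul]
  refine integrable_finsetSum _ fun i _ => ?_
  simpa [mul_assoc] using (h.integrable_moment hα hβ i).ofReal.const_mul (P.coeff i)

theorem integrable_pairing (hα : IsWeight α) (hβ : IsWeight β) (h : FiniteBimoments α β)
    (p q : ℝ[X]) : Integrable fun s : ℝ × ℝ =>
    p.eval s.1 * q.eval s.2 / (s.1 + s.2) * (α s.1 * β s.2) := by
  simp_rw [eval_eq_sum_range, Finset.sum_mul_sum, Finset.sum_div, Finset.sum_mul]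
  refine integrable_finsetSum _ fun i _ => integrable_finsetSum _ fun j _ => ?_
  refine ((h.integrable hα hβ i j).const_mul (p.coeff i * q.coeff j)).congr
    (ae_of_all _ fun s => ?_)
  simp only
  ring

end

/-! ### The Cauchy pairing and Stieltjes transforms -/

/-- The Cauchy pairing `⟨p, q⟩ = ∬ p(x) q(y) α(x) β(y) / (x + y) dx dy`. -/
noncomputable def pairing (α β : ℝ → ℝ) (p q : ℝ[X]) : ℝ :=
  ∫ s : ℝ × ℝ, p.eval s.1 * q.eval s.2 / (s.1 + s.2) * (α s.1 * β s.2)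

/-- The Stieltjes transform `y ↦ ∫ P(x) a(x) / (x + y) dx`. -/
noncomputable def stieltjes (a : ℝ → ℝ) (P : ℝ[X]) (y : ℝ) : ℝ := ∫ x, P.eval x * a x / (x + y)

section

variable {α β : ℝ → ℝ}

theorem pairing_eq_iterated (hα : IsWeight α) (hβ : IsWeight β) (h : FiniteBimoments α β)
    (p q : ℝ[X]) :
    ∫ x in Ioi (0 : ℝ), ∫ y in Ioi (0 : ℝ), p.eval x * q.eval y / (x + y) * (α x * β y)
      = pairing α β p q := by
  have h1 : ∀ x, ∫ y in Ioi (0 : ℝ), p.eval x * q.eval y / (x + y) * (α x * β y)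
      = ∫ y, p.eval x * q.eval y / (x + y) * (α x * β y) := fun x =>
    setIntegral_eq_integral_of_forall_compl_eq_zero fun y hy => by
      simp [hβ.eq_zero _ (not_lt.1 hy)]
  simp_rw [h1]
  rw [setIntegral_eq_integral_of_forall_compl_eq_zero fun x hx => by
      simp [hα.eq_zero _ (not_lt.1 hx)], pairing, Measure.volume_eq_prod, integral_prod]
  exact integrable_pairing hα hβ h p q

theorem pairing_add_left (hα : IsWeight α) (hβ : IsWeight β) (h : FiniteBimoments α β)
    (p p' q : ℝ[X]) :
    pairing α β (p + p') q = pairing α β p q + pairing α β p' q := by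
  rw [pairing, pairing, pairing,
    ← integral_add (integrable_pairing hα hβ h p q) (integrable_pairing hα hβ h p' q)]
  congr 1; funext s; rw [eval_add]; ring

theorem pairing_add_right (hα : IsWeight α) (hβ : IsWeight β) (h : FiniteBimoments α β)
    (p q q' : ℝ[X]) :
    pairing α β p (q + q') = pairing α β p q + pairing α β p q' := by
  rw [pairing, pairing, pairing,
    ← integral_add (integrable_pairing hα hβ h p q) (integrable_pairing hα hβ h p q')]
  congr 1; funext s; rw [eval_add]; ring

theorem pairing_C_mul_left (c : ℝ) (p q : ℝ[X]) :
    pairing α β (C c * p) q = c * pairing α β p q := by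
  rw [pairing, pairing, ← integral_const_mul]
  congr 1; funext s; rw [eval_mul, eval_C]; ring

theorem pairing_C_mul_right (c : ℝ) (p q : ℝ[X]) :
    pairing α β p (C c * q) = c * pairing α β p q := by
  rw [pairing, pairing, ← integral_const_mul]
  congr 1; funext s; rw [eval_mul, eval_C]; ring

theorem pairing_symm (p q : ℝ[X]) : pairing α β p q = pairing β α q p := by
  rw [pairing, pairing, Measure.volume_eq_prod, ← integral_prod_swap]
  congr 1; funext s; simp only [Prod.fst_swap, Prod.snd_swap, add_comm s.2]; ring

/-- The Cauchy pairing as a bilinear map. -/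
noncomputable def pairingₗ (hα : IsWeight α) (hβ : IsWeight β) (h : FiniteBimoments α β) :
    ℝ[X] →ₗ[ℝ] ℝ[X] →ₗ[ℝ] ℝ :=
  LinearMap.mk₂ ℝ (pairing α β) (pairing_add_left hα hβ h)
    (fun c p q => by rw [smul_eq_C_mul, pairing_C_mul_left, smul_eq_mul])
    (pairing_add_right hα hβ h)
    (fun c p q => by rw [smul_eq_C_mul, pairing_C_mul_right, smul_eq_mul])

theorem pairing_eq_stieltjes (hα : IsWeight α) (hβ : IsWeight β) (h : FiniteBimoments α β)
    (p q : ℝ[X]) :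
    pairing α β p q = ∫ y, stieltjes α p y * q.eval y * β y := by
  rw [pairing, Measure.volume_eq_prod,
    integral_prod_symm _ (integrable_pairing hα hβ h p q)]
  congr 1; funext y
  rw [stieltjes, mul_assoc, ← integral_mul_const]
  congr 1; funext x; ring

theorem integrable_stieltjes_mul (hα : IsWeight α) (hβ : IsWeight β) (h : FiniteBimoments α β)
    (p q : ℝ[X]) :
    Integrable fun y => stieltjes α p y * q.eval y * β y := by
  have := (Measure.volume_eq_prod ℝ ℝ ▸ integrable_pairing hα hβ h p q :
    Integrable _ ((volume : Measure ℝ).prod volume)).integral_prod_right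
  refine this.congr (ae_of_all _ fun y => ?_)
  simp only
  rw [stieltjes, mul_assoc, ← integral_mul_const]
  congr 1; funext x; ring

theorem norm_div_add_le (hα : IsWeight α)
    {P : ℝ[X]} {x y δ : ℝ} (hδ : 0 < δ) (hy : δ ≤ y) :
    ‖P.eval x * α x / (x + y)‖ ≤ δ⁻¹ * ‖P.eval x * α x‖ := by
  by_cases hx : x ≤ 0
  · simp [hα.eq_zero _ hx]
  · rw [norm_div, div_eq_inv_mul]
    gcongr
    rw [Real.norm_eq_abs]
    exact (by linarith : δ ≤ x + y).trans (le_abs_self _)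

theorem integrable_div_add (hα : IsWeight α) (hβ : IsWeight β) (h : FiniteBimoments α β)
    (P : ℝ[X]) {y : ℝ} (hy : 0 < y) :
    Integrable fun x => P.eval x * α x / (x + y) := by
  have hm := (integrable_eval_mul hα hβ h P)
  refine (hm.norm.const_mul y⁻¹).mono' ?_ (ae_of_all _ fun x => norm_div_add_le hα hy le_rfl)
  exact (hm.aestronglyMeasurable.aemeasurable.div (by fun_prop)).aestronglyMeasurable

theorem continuousOn_stieltjes (hα : IsWeight α) (hβ : IsWeight β) (h : FiniteBimoments α β)
    (P : ℝ[X]) : ContinuousOn (stieltjes α P) (Ioi 0) := by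
  intro y hy
  have hy : 0 < y := hy
  refine ContinuousAt.continuousWithinAt ?_
  have hev : ∀ᶠ u in 𝓝 y, y / 2 < u := lt_mem_nhds (by linarith)
  refine continuousAt_of_dominated (bound := fun x => (y / 2)⁻¹ * ‖P.eval x * α x‖)
    ?_ ?_ ((integrable_eval_mul hα hβ h P).norm.const_mul _) ?_
  · filter_upwards [hev] with u hu
    exact (integrable_div_add hα hβ h P (by linarith : 0 < u)).aestronglyMeasurable
  · filter_upwards [hev] with u hu
    exact ae_of_all _ fun x => norm_div_add_le hα (by linarith) hu.le
  · refine ae_of_all _ fun x => ?_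
    by_cases hx : x ≤ 0
    · simp [hα.eq_zero _ hx, continuousAt_const]
    · exact continuousAt_const.div (by fun_prop) (by linarith)

/-- Partial fractions: values of the Stieltjes transform at the points of `T` as one integral. -/
theorem sum_stieltjes_eq_integral (hα : IsWeight α) (hβ : IsWeight β) (h : FiniteBimoments α β)
    (P : ℝ[X]) {T : Finset ℝ} (hT : ∀ t ∈ T, 0 < t) {R : ℝ[X]}
    (hR : R.degree < T.card) :
    Integrable (fun x => P.eval x * R.eval x / (∏ t ∈ T, (x + t)) * α x) ∧
    ∑ t ∈ T, (R.eval (-t) / ∏ u ∈ T.erase t, (u - t)) * stieltjes α P t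
      = ∫ x, P.eval x * R.eval x / (∏ t ∈ T, (x + t)) * α x := by
  have e : (fun x => P.eval x * R.eval x / (∏ t ∈ T, (x + t)) * α x) =
      fun x => ∑ t ∈ T, (R.eval (-t) / ∏ u ∈ T.erase t, (u - t)) * (P.eval x * α x / (x + t)) := by
    funext x
    by_cases hx : x ≤ 0
    · simp [hα.eq_zero _ hx]
    have h1 := sum_nodalWeight_mul_inv_mul_eval (s := T) (v := fun t => -t) (R := R) (x := x)
      neg_injective.injOn hR (fun t ht h0 => by have := hT t ht; linarith)
    simp only [sub_neg_eq_add] at h1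
    rw [mul_div_assoc, ← h1, Finset.mul_sum, Finset.sum_mul]
    refine Finset.sum_congr rfl fun t ht => ?_
    have h2 : Lagrange.nodalWeight T (fun t => -t) t = (∏ u ∈ T.erase t, (u - t))⁻¹ := by
      rw [Lagrange.nodalWeight, ← Finset.prod_inv_distrib]
      refine Finset.prod_congr rfl fun u _ => ?_
      congr 1
      ring
    rw [h2]
    ring
  have hi : ∀ t ∈ T, Integrable fun x =>
      (R.eval (-t) / ∏ u ∈ T.erase t, (u - t)) * (P.eval x * α x / (x + t)) := fun t ht =>
    (integrable_div_add hα hβ h P (hT t ht)).const_mul _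
  rw [e]
  refine ⟨integrable_finsetSum _ hi, ?_⟩
  rw [integral_finsetSum _ hi]
  exact Finset.sum_congr rfl fun t _ => (integral_const_mul _ _).symm

end

/-- If the integral were zero, u a would vanish almost everywhere; the zeros of u on the half-line
form a null set, so a itself would be null. -/
theorem IsWeight.integral_mul_pos {a : ℝ → ℝ} (ha : IsWeight a) {u : ℝ → ℝ}
    (hu : ∀ x, 0 < x → 0 ≤ u x) (hfin : {x | 0 < x ∧ u x = 0}.Finite)
    (hi : Integrable fun x => u x * a x) : 0 < ∫ x, u x * a x := by
  have hnn : ∀ x, 0 ≤ u x * a x := fun x => by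
    by_cases hx : x ≤ 0
    · simp [ha.eq_zero _ hx]
    · exact mul_nonneg (hu x (not_le.1 hx)) (ha.nonneg x)
  refine lt_of_le_of_ne (integral_nonneg hnn) fun h0 => ha.ne_zero ?_
  have h1 := (integral_eq_zero_iff_of_nonneg hnn hi).1 h0.symm
  have h2 : ∀ᵐ x : ℝ, x ∉ {x | 0 < x ∧ u x = 0} := measure_eq_zero_iff_ae_notMem.1 (hfin.measure_zero _)
  filter_upwards [h1, h2] with x hx1 hx2
  by_cases hx : x ≤ 0
  · exact ha.eq_zero _ hx
  · rcases mul_eq_zero.1 hx1 with h | h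
    · exact absurd ⟨not_le.1 hx, h⟩ hx2
    · exact h

section

variable {α β : ℝ → ℝ}

/-- With `R = P` the partial fraction identity has a square over a positive product on its right
side. This positivity plays the role of total positivity of the Cauchy kernel in all that follows.
-/
theorem integral_sq_div_pos (hα : IsWeight α) (hβ : IsWeight β) (h : FiniteBimoments α β)
    {P : ℝ[X]} (hP : P ≠ 0) {T : Finset ℝ} (hT : ∀ t ∈ T, 0 < t)
    (hPT : P.degree < T.card) : 0 < ∫ x, P.eval x * P.eval x / (∏ t ∈ T, (x + t)) * α x := by
  have hpos : ∀ x, 0 < x → 0 < ∏ t ∈ T, (x + t) := fun x hx =>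
    Finset.prod_pos fun t ht => add_pos hx (hT t ht)
  refine hα.integral_mul_pos (fun x hx => div_nonneg (mul_self_nonneg _) (hpos x hx).le) ?_
    (sum_stieltjes_eq_integral hα hβ h P hT hPT).1
  refine (P.roots.toFinset.finite_toSet).subset ?_
  rintro x ⟨hx, h0⟩
  rw [div_eq_zero_iff, mul_self_eq_zero, or_iff_left (hpos x hx).ne'] at h0
  simpa [hP] using h0

/-- With more than deg P zeros as nodes, the sum in `sum_stieltjes_eq_integral` would vanish
although the integral is positive. -/
theorem card_zeros_stieltjes_le (hα : IsWeight α) (hβ : IsWeight β) (h : FiniteBimoments α β)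
    {P : ℝ[X]} (hP : P ≠ 0) {T : Finset ℝ}
    (hT : ∀ t ∈ T, 0 < t ∧ stieltjes α P t = 0) : T.card ≤ P.natDegree := by
  by_contra! hlt
  have hd : P.degree < T.card := (natDegree_lt_iff_degree_lt hP).1 hlt
  have h1 := integral_sq_div_pos hα hβ h hP (fun t ht => (hT t ht).1) hd
  rw [← (sum_stieltjes_eq_integral hα hβ h P (fun t ht => (hT t ht).1) hd).2,
    Finset.sum_eq_zero fun t ht => by rw [(hT t ht).2, mul_zero]] at h1
  exact lt_irrefl _ h1

theorem finite_zeros_stieltjes (hα : IsWeight α) (hβ : IsWeight β) (h : FiniteBimoments α β)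
    {P : ℝ[X]} (hP : P ≠ 0) :
    {t | 0 < t ∧ stieltjes α P t = 0}.Finite := by
  by_contra hinf
  obtain ⟨T, hT, hc⟩ := Set.Infinite.exists_subset_card_eq hinf (P.natDegree + 1)
  have := card_zeros_stieltjes_le hα hβ h hP (T := T) fun t ht => hT ht
  omega

end

/-! ### Sign changes -/

theorem sign_const_of_ne_zero {f : ℝ → ℝ} {J : Set ℝ} (hJ : J.OrdConnected)
    (hf : ContinuousOn f J) (h0 : ∀ y ∈ J, f y ≠ 0) :
    ∃ σ : ℝ, (σ = 1 ∨ σ = -1) ∧ ∀ y ∈ J, 0 ≤ σ * f y := by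
  by_cases hp : ∀ y ∈ J, 0 ≤ f y
  · exact ⟨1, Or.inl rfl, fun y hy => by simpa using hp y hy⟩
  push Not at hp
  obtain ⟨a, ha, hfa⟩ := hp
  refine ⟨-1, Or.inr rfl, fun b hb => ?_⟩
  by_contra! hfb
  have h1 : (0 : ℝ) ∈ Icc (f a) (f b) := ⟨hfa.le, by linarith⟩
  obtain ⟨c, hc, hc0⟩ := hJ.isPreconnected.intermediate_value ha hb hf h1
  exact h0 c hc hc0

/-- `S` collects the zeros at which f changes sign. The induction removes the largest zero m: to its
right the product over the smaller zeros is positive, so m has to join `S` precisely when the sign τ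
there differs from σ. -/
theorem exists_sign_polynomial (Z : Finset ℝ) : ∀ {f : ℝ → ℝ} {J : Set ℝ}, J.OrdConnected →
    ContinuousOn f J → (∀ y, y ∈ Z ↔ y ∈ J ∧ f y = 0) →
    ∃ S ⊆ Z, ∃ σ : ℝ, (σ = 1 ∨ σ = -1) ∧ ∀ y ∈ J, 0 ≤ σ * f y * ∏ s ∈ S, (y - s) := by
  induction Z using Finset.induction_on_max with
  | empty =>
    intro f J hJ hf hZ
    obtain ⟨σ, hσ, h⟩ := sign_const_of_ne_zero hJ hf fun y hy h0 => by simpa using (hZ y).2 ⟨hy, h0⟩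
    exact ⟨∅, le_rfl, σ, hσ, fun y hy => by simpa using h y hy⟩
  | insert m Z hm ih =>
    intro f J hJ hf hZ
    have hmZ : m ∉ Z := fun h' => lt_irrefl _ (hm m h')
    have hfm : f m = 0 := ((hZ m).1 (Finset.mem_insert_self _ _)).2
    obtain ⟨S, hS, σ, hσ, h1⟩ := ih (hJ.inter ordConnected_Iio) (hf.mono (inter_subset_left (t := Iio m)))
      (fun y => by
        constructor
        · intro hy
          have := (hZ y).1 (Finset.mem_insert_of_mem hy)
          exact ⟨⟨this.1, hm y hy⟩, this.2⟩
        · rintro ⟨⟨hyJ, hym⟩, hy0⟩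
          exact (Finset.mem_insert.1 ((hZ y).2 ⟨hyJ, hy0⟩)).resolve_left (ne_of_lt hym))
    obtain ⟨τ, hτ, h2⟩ := sign_const_of_ne_zero (hJ.inter ordConnected_Ioi)
      (hf.mono (inter_subset_left (t := Ioi m))) (fun y hy h0 => by
        rcases Finset.mem_insert.1 ((hZ y).2 ⟨hy.1, h0⟩) with h' | h'
        · exact absurd h' (ne_of_gt hy.2)
        · exact absurd (hm y h') (not_lt.2 (le_of_lt hy.2)))
    have hpos : ∀ y, m < y → 0 < ∏ s ∈ S, (y - s) := fun y hy =>
      Finset.prod_pos fun s hs => by have := hm s (hS hs); linarith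
    have hmS : m ∉ S := fun h' => hmZ (hS h')
    by_cases hst : τ = σ
    · refine ⟨S, hS.trans (Finset.subset_insert _ _), σ, hσ, fun y hy => ?_⟩
      rcases lt_trichotomy y m with hlt | rfl | hgt
      · exact h1 y ⟨hy, hlt⟩
      · simp [hfm]
      · exact mul_nonneg (hst ▸ h2 y ⟨hy, hgt⟩) (hpos y hgt).le
    · have hst' : τ = -σ := by
        rcases hτ with rfl | rfl <;> rcases hσ with rfl | rfl <;> simp_all
      refine ⟨insert m S, Finset.insert_subset_insert _ hS, τ, hτ, fun y hy => ?_⟩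
      rw [Finset.prod_insert hmS]
      rcases lt_trichotomy y m with hlt | rfl | hgt
      · have := h1 y ⟨hy, hlt⟩
        rw [hst']
        have e : -σ * f y * ((y - m) * ∏ s ∈ S, (y - s)) = (m - y) * (σ * f y * ∏ s ∈ S, (y - s)) := by
          ring
        rw [e]
        exact mul_nonneg (by linarith) this
      · simp [hfm]
      · exact mul_nonneg (h2 y ⟨hy, hgt⟩) (mul_nonneg (by linarith) (hpos y hgt).le)

/-! ### Existence of the biorthogonal polynomials -/

section

variable {α β : ℝ → ℝ}

/-- The polynomial with simple zeros at the sign changes of the Stieltjes transform makes the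
integrand of `pairing_eq_stieltjes` one-signed. Its degree is at most deg P, so no nonzero P is
orthogonal to all polynomials of degree up to its own. -/
theorem exists_nodal_pairing_pos (hα : IsWeight α) (hβ : IsWeight β) (h : FiniteBimoments α β)
    {P : ℝ[X]} (hP : P ≠ 0) :
    ∃ S Z : Finset ℝ, S ⊆ Z ∧ (∀ y, y ∈ Z ↔ 0 < y ∧ stieltjes α P y = 0) ∧
      Z.card ≤ P.natDegree ∧ ∃ σ : ℝ, (σ = 1 ∨ σ = -1) ∧
        (∀ y, 0 < y → 0 ≤ σ * stieltjes α P y * ∏ s ∈ S, (y - s)) ∧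
        0 < σ * pairing α β P (Lagrange.nodal S id) := by
  have hfin := finite_zeros_stieltjes hα hβ h hP
  obtain ⟨S, hS, σ, hσ, hpos⟩ := exists_sign_polynomial hfin.toFinset ordConnected_Ioi
    (continuousOn_stieltjes hα hβ h P) (fun y => by simp)
  refine ⟨S, hfin.toFinset, hS, by simp, card_zeros_stieltjes_le hα hβ h hP (by simp), σ, hσ, hpos, ?_⟩
  have hσ0 : σ ≠ 0 := by rcases hσ with rfl | rfl <;> norm_num
  have e : σ * pairing α β P (Lagrange.nodal S id)
      = ∫ y, (σ * stieltjes α P y * ∏ s ∈ S, (y - s)) * β y := by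
    rw [pairing_eq_stieltjes hα hβ h, ← integral_const_mul]
    congr 1; funext y
    rw [Lagrange.eval_nodal]
    simp only [id]
    ring
  rw [e]
  refine hβ.integral_mul_pos hpos ?_ ?_
  · refine (hfin.union S.finite_toSet).subset ?_
    rintro y ⟨hy, h0⟩
    rcases mul_eq_zero.1 h0 with h0 | h0
    · exact Or.inl ⟨hy, (mul_eq_zero.1 h0).resolve_left hσ0⟩
    · obtain ⟨s, hs, hs0⟩ := Finset.prod_eq_zero_iff.1 h0
      exact Or.inr (by rw [sub_eq_zero.1 hs0]; exact hs)
  · refine ((integrable_stieltjes_mul hα hβ h P (Lagrange.nodal S id)).const_mul σ).congr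
      (ae_of_all _ fun y => ?_)
    simp only [Lagrange.eval_nodal, id]
    ring

/-- Nondegeneracy makes the map from degree < n into the dual injective, hence surjective by
dimension; P is X^n minus the element representing the functional ⟨X^n, ·⟩. -/
theorem exists_monic_orthogonal (hα : IsWeight α) (hβ : IsWeight β) (h : FiniteBimoments α β)
    (n : ℕ) : ∃ P : ℝ[X], P.Monic ∧ P.natDegree = n ∧
    ∀ q : ℝ[X], q.degree < n → pairing α β P q = 0 := by
  set B := pairingₗ hα hβ h with hB
  set f : degreeLT ℝ n →ₗ[ℝ] Module.Dual ℝ (degreeLT ℝ n) :=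
    B.domRestrict₁₂ (degreeLT ℝ n) (degreeLT ℝ n) with hf
  have : FiniteDimensional ℝ (degreeLT ℝ n) := (degreeLTEquiv ℝ n).symm.finiteDimensional
  have hinj : Function.Injective f := by
    rw [← LinearMap.ker_eq_bot, LinearMap.ker_eq_bot']
    rintro ⟨P, hP⟩ h0
    by_contra hne
    have hP0 : P ≠ 0 := fun h' => hne (by simp [h'])
    obtain ⟨S, Z, hSZ, -, hZ, σ, -, -, hpos⟩ := exists_nodal_pairing_pos hα hβ h hP0
    have hmem : Lagrange.nodal S (id : ℝ → ℝ) ∈ degreeLT ℝ n := by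
      rw [mem_degreeLT, Lagrange.degree_nodal] at *
      rw [degree_eq_natDegree hP0] at hP
      refine lt_of_le_of_lt ?_ hP
      exact_mod_cast (Finset.card_le_card hSZ).trans hZ
    have h1 : f ⟨P, hP⟩ ⟨_, hmem⟩ = 0 := by rw [h0]; rfl
    have h2 : pairing α β P (Lagrange.nodal S id) = 0 := h1
    rw [h2, mul_zero] at hpos
    exact lt_irrefl _ hpos
  have hsurj : Function.Surjective f :=
    (LinearMap.injective_iff_surjective_of_finrank_eq_finrank
      (Subspace.dual_finrank_eq (K := ℝ) (V := degreeLT ℝ n)).symm).1 hinj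
  obtain ⟨⟨r, hr⟩, hrf⟩ := hsurj ((B (X ^ n)).domRestrict (degreeLT ℝ n))
  rw [mem_degreeLT] at hr
  refine ⟨X ^ n - r, monic_X_pow_sub hr, ?_, fun q hq => ?_⟩
  · refine natDegree_eq_of_degree_eq_some ?_
    rw [degree_sub_eq_left_of_degree_lt (by rwa [degree_X_pow]), degree_X_pow]
  · have h1 := LinearMap.congr_fun hrf ⟨q, mem_degreeLT.2 hq⟩
    have h2 : B r q = B (X ^ n) q := h1
    change B (X ^ n - r) q = 0
    rw [map_sub, LinearMap.sub_apply, h2, sub_self]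

/-- Orthogonality forces n sign changes, so every positive zero of the transform is one, and Q may
be replaced by the nodal polynomial because they differ in degree < n. It remains to see that the
sign σ is 1, which is read off at a large y. -/
theorem pairing_monic_pos (hα : IsWeight α) (hβ : IsWeight β) (h : FiniteBimoments α β)
    {n : ℕ} {P : ℝ[X]} (hPm : P.Monic) (hPn : P.natDegree = n)
    (hP : ∀ q : ℝ[X], q.degree < n → pairing α β P q = 0) {Q : ℝ[X]} (hQm : Q.Monic)
    (hQn : Q.natDegree = n) : 0 < pairing α β P Q := by
  classical
  obtain ⟨S, Z, hSZ, hZ, hZn, σ, hσ, hsgn, hpos⟩ := exists_nodal_pairing_pos hα hβ h hPm.ne_zero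
  have hSn : S.card = n := by
    refine le_antisymm (((Finset.card_le_card hSZ).trans hZn).trans_eq hPn) ?_
    by_contra! hlt
    rw [hP _ (by rw [Lagrange.degree_nodal]; exact_mod_cast hlt), mul_zero] at hpos
    exact lt_irrefl _ hpos
  have hSZ' : S = Z := Finset.eq_of_subset_of_card_le hSZ (by omega)
  have hQ : pairing α β P Q = pairing α β P (Lagrange.nodal S id) := by
    have h1 : pairing α β P (Q - Lagrange.nodal S id) = 0 := by
      refine hP _ ?_
      have := degree_sub_lt_left (p := Q) (q := Lagrange.nodal S (id : ℝ → ℝ))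
        (by rw [Lagrange.degree_nodal, degree_eq_natDegree hQm.ne_zero, hQn, hSn])
        hQm.ne_zero (by rw [hQm.leadingCoeff, (Lagrange.nodal_monic).leadingCoeff])
      rwa [degree_eq_natDegree hQm.ne_zero, hQn] at this
    have h2 := pairing_add_right hα hβ h P (Q - Lagrange.nodal S id) (Lagrange.nodal S id)
    rw [sub_add_cancel, h1, zero_add] at h2
    exact h2
  have hlarge : ∀ᶠ y : ℝ in atTop, 0 < (-1) ^ n * P.eval (-y) := by
    have hdeg : (P.comp (-X)).natDegree = n := by simp [natDegree_comp, hPn]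
    have hlc : (P.comp (-X)).leadingCoeff = (-1) ^ n := by
      rw [leadingCoeff_comp (by simp), hPm.leadingCoeff, hPn]; simp
    have hne : P.comp (-X) ≠ 0 := fun h0 => by
      rw [h0, leadingCoeff_zero] at hlc
      exact pow_ne_zero n (by norm_num : (-1 : ℝ) ≠ 0) hlc.symm
    have hlim := div_tendsto_atTop_leadingCoeff_div_of_degree_eq (P := P.comp (-X))
      (Q := (X : ℝ[X]) ^ n) (by rw [degree_eq_natDegree hne, hdeg, degree_X_pow])
    rw [hlc, leadingCoeff_X_pow, div_one] at hlim
    have hlim' := hlim.const_mul ((-1 : ℝ) ^ n)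
    rw [← mul_pow, neg_one_mul, neg_neg, one_pow] at hlim'
    filter_upwards [hlim'.eventually (lt_mem_nhds zero_lt_one), eventually_gt_atTop 0] with y h1 h2
    simp only [eval_comp, eval_neg, eval_X, eval_pow, ← mul_div_assoc] at h1
    exact (div_pos_iff_of_pos_right (pow_pos h2 n)).1 h1
  obtain ⟨B, hB⟩ := Z.bddAbove
  obtain ⟨y, hy1, hy2, hy3⟩ := (hlarge.and ((eventually_gt_atTop 0).and (eventually_gt_atTop B))).exists
  have hyZ : y ∉ Z := fun h' => absurd (hB h') (not_le.2 hy3)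
  have hT : ∀ t ∈ insert y Z, 0 < t := fun t ht => by
    rcases Finset.mem_insert.1 ht with rfl | ht
    exacts [hy2, ((hZ t).1 ht).1]
  have hd : P.degree < (insert y Z).card := by
    rw [Finset.card_insert_of_notMem hyZ, ← hSZ', hSn, degree_eq_natDegree hPm.ne_zero, hPn]
    exact_mod_cast n.lt_succ_self
  -- The nodes are the zeros of the transform and the point y. Only the term at y survives, and it
  -- ties the sign of the transform at y to that of (-1)^n P(-y), which is positive.
  have h1 := integral_sq_div_pos hα hβ h hPm.ne_zero hT hd
  rw [← (sum_stieltjes_eq_integral hα hβ h P hT hd).2, Finset.sum_insert hyZ,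
    Finset.sum_eq_zero (s := Z) (fun t ht => by rw [((hZ t).1 ht).2, mul_zero]), add_zero,
    Finset.erase_insert hyZ] at h1
  have hprod : 0 < ∏ u ∈ Z, (y - u) := Finset.prod_pos fun u hu => by
    have := hB hu; linarith
  have e : ∏ u ∈ Z, (u - y) = (-1) ^ n * ∏ u ∈ Z, (y - u) := by
    rw [← hSn, hSZ', ← Finset.prod_const, ← Finset.prod_mul_distrib]
    exact Finset.prod_congr rfl fun u _ => by ring
  have hst : 0 < stieltjes α P y := by
    have h2 : P.eval (-y) / ∏ u ∈ Z, (u - y) = ((-1) ^ n * P.eval (-y)) / ∏ u ∈ Z, (y - u) := by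
      rw [e]
      rcases neg_one_pow_eq_or ℝ n with h' | h' <;> rw [h'] <;> field_simp
    rw [h2] at h1
    exact (pos_iff_pos_of_mul_pos h1).1 (div_pos hy1 hprod)
  have hs := hsgn y hy2
  rw [hSZ'] at hs
  have hσ1 : σ = 1 := by
    rcases hσ with h' | h'
    · exact h'
    · rw [h'] at hs
      have : 0 < stieltjes α P y * ∏ u ∈ Z, (y - u) := mul_pos hst hprod
      linarith
  rw [hQ]
  rwa [hσ1, one_mul] at hpos

/-- Both monic families are divided by the square root of their pairing, which is positive; this
also makes the leading coefficients equal. -/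
theorem exists_isCauchyBOP (hα : IsWeight α) (hβ : IsWeight β) (h : FiniteBimoments α β) :
    ∃ p q : ℕ → ℝ[X], IsCauchyBOP α β p q := by
  choose P hPm hPn hP using exists_monic_orthogonal hα hβ h
  choose Q hQm hQn hQ using exists_monic_orthogonal hβ hα (h.symm hα hβ)
  have hpos : ∀ n, 0 < pairing α β (P n) (Q n) := fun n =>
    pairing_monic_pos hα hβ h (hPm n) (hPn n) (hP n) (hQm n) (hQn n)
  set c : ℕ → ℝ := fun n => (√(pairing α β (P n) (Q n)))⁻¹ with hc
  have hc0 : ∀ n, 0 < c n := fun n => inv_pos.2 (Real.sqrt_pos.2 (hpos n))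
  refine ⟨fun n => C (c n) * P n, fun n => C (c n) * Q n, ?_, ?_, ?_, ?_, ?_⟩
  · intro j; rw [natDegree_C_mul (hc0 j).ne', hPn]
  · intro j; rw [natDegree_C_mul (hc0 j).ne', hQn]
  · intro j; simp [(hPm j).leadingCoeff, (hQm j).leadingCoeff]
  · intro j; simpa [(hPm j).leadingCoeff] using hc0 j
  · intro j k
    rw [pairing_eq_iterated hα hβ h, pairing_C_mul_left, pairing_C_mul_right]
    have hdP : (P j).degree = j := by rw [degree_eq_natDegree (hPm j).ne_zero, hPn]
    have hdQ : (Q k).degree = k := by rw [degree_eq_natDegree (hQm k).ne_zero, hQn]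
    rcases lt_trichotomy j k with hlt | rfl | hgt
    · rw [if_neg hlt.ne, pairing_symm, hQ k _ (by rw [hdP]; exact_mod_cast hlt)]; simp
    · rw [if_pos rfl, hc]
      have := Real.mul_self_sqrt (hpos j).le
      have h0 := (Real.sqrt_pos.2 (hpos j)).ne'
      simp only
      field_simp
      rw [pow_two, this]
    · rw [if_neg hgt.ne', hP j _ (by rw [hdQ]; exact_mod_cast hgt)]; simp

end

/-! ### Cauchy transforms off the support -/

/-- The Cauchy transform `z ↦ ∫ h(s) / (z - s) ds` of a complex density. -/
noncomputable def cauchy (h : ℝ → ℂ) (z : ℂ) : ℂ := ∫ s : ℝ, h s / (z - s)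

theorem exists_dist_le_of_notMem {S : Set ℝ} (hS : IsClosed S) {z : ℂ}
    (hz : z ∉ (fun x : ℝ => (x : ℂ)) '' S) :
    ∃ δ > 0, ∀ u ∈ Metric.ball z δ, ∀ s ∈ S, δ ≤ ‖u - s‖ := by
  have hcl : IsClosed ((fun x : ℝ => (x : ℂ)) '' S) :=
    Complex.isometry_ofReal.isClosedEmbedding.isClosedMap S hS
  obtain ⟨r, hr, hball⟩ := Metric.isOpen_iff.1 hcl.isOpen_compl z hz
  refine ⟨r / 2, by linarith, fun u hu s hs => ?_⟩
  by_contra! hlt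
  refine hball (a := (s : ℂ)) ?_ ⟨s, hs, rfl⟩
  rw [Metric.mem_ball, dist_eq_norm] at hu ⊢
  have : (s : ℂ) - z = (u - z) - (u - s) := by ring
  rw [this]
  linarith [norm_sub_le (u - z) (u - s)]

theorem aestronglyMeasurable_div_sub {h : ℝ → ℂ} (hi : AEStronglyMeasurable h volume) (z : ℂ) :
    AEStronglyMeasurable (fun s : ℝ => h s / (z - s)) volume :=
  (hi.aemeasurable.div (by fun_prop)).aestronglyMeasurable

theorem integrable_div_sub_of_le {h : ℝ → ℂ} (hi : Integrable h) {z : ℂ} {δ : ℝ} (hδ : 0 < δ)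
    (hz : ∀ᵐ s : ℝ, h s ≠ 0 → δ ≤ ‖z - s‖) : Integrable fun s : ℝ => h s / (z - s) := by
  refine (hi.norm.const_mul δ⁻¹).mono' (aestronglyMeasurable_div_sub hi.1 z) ?_
  filter_upwards [hz] with s hs
  by_cases h0 : h s = 0
  · simp [h0]
  · rw [norm_div, div_eq_inv_mul]
    gcongr
    exact hs h0

theorem integrable_div_sub {h : ℝ → ℂ} (hi : Integrable h) {z : ℂ} (hz : z.im ≠ 0) :
    Integrable fun s : ℝ => h s / (z - s) := by
  refine integrable_div_sub_of_le hi (abs_pos.2 hz) (ae_of_all _ fun s _ => ?_)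
  simpa using Complex.abs_im_le_norm (z - s)

theorem differentiableOn_cauchy {h : ℝ → ℂ} (hi : Integrable h) {S : Set ℝ} (hS : IsClosed S)
    (h0 : ∀ᵐ s : ℝ, s ∉ S → h s = 0) :
    DifferentiableOn ℂ (cauchy h) ((fun x : ℝ => (x : ℂ)) '' S)ᶜ := by
  intro z hz
  obtain ⟨δ, hδ, hd⟩ := exists_dist_le_of_notMem hS hz
  refine DifferentiableAt.differentiableWithinAt ?_
  refine (hasDerivAt_integral_of_dominated_loc_of_deriv_le
    (F := fun (u : ℂ) (s : ℝ) => h s / (u - s)) (F' := fun u s => -(h s / (u - s) ^ 2))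
    (bound := fun s => δ⁻¹ ^ 2 * ‖h s‖) (Metric.ball_mem_nhds z hδ)
    (Eventually.of_forall fun u => aestronglyMeasurable_div_sub hi.1 u) ?_ ?_ ?_
    (hi.norm.const_mul _) ?_).2.differentiableAt
  · refine integrable_div_sub_of_le hi hδ ?_
    filter_upwards [h0] with s hs hne
    exact hd z (Metric.mem_ball_self hδ) s (by by_contra h'; exact hne (hs h'))
  · exact ((hi.1.aemeasurable.div (by fun_prop)).neg).aestronglyMeasurable
  · filter_upwards [h0] with s hs u hu
    by_cases hsS : s ∈ S
    · have := hd u hu s hsS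
      rw [norm_neg, norm_div, norm_pow, div_eq_inv_mul, ← inv_pow]
      gcongr
    · simp [hs hsS]
  · filter_upwards [h0] with s hs u hu
    by_cases hsS : s ∈ S
    · have hne : u - s ≠ 0 := fun h' => by
        have := hd u hu s hsS
        rw [h', norm_zero] at this
        linarith
      have := (hasDerivAt_const u (h s)).div ((hasDerivAt_id u).sub_const (s : ℂ)) hne
      simp only [zero_mul, id, mul_one, zero_sub, neg_div] at this
      exact this
    · simpa [hs hsS] using hasDerivAt_const u (0 : ℂ)

/-! ### Boundary values -/

/-- After the substitution x = s + εt the dependence on ε sits in the bounded factor φ, so that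
dominated convergence applies with a fixed integrable weight. -/
theorem integral_poisson_eq (φ : ℝ → ℝ) (s : ℝ) {ε : ℝ} (hε : 0 < ε) :
    ∫ x, φ x * (ε / ((x - s) ^ 2 + ε ^ 2)) = ∫ t, φ (s + ε * t) * (1 + t ^ 2)⁻¹ := by
  rw [← integral_add_left_eq_self _ s]
  have h1 := Measure.integral_comp_mul_left
    (fun u => φ (s + u) * (ε / ((s + u - s) ^ 2 + ε ^ 2))) ε
  rw [abs_of_pos (inv_pos.2 hε), smul_eq_mul] at h1
  have h2 : (∫ u, φ (s + u) * (ε / ((s + u - s) ^ 2 + ε ^ 2)))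
      = ε * ∫ t, φ (s + ε * t) * (ε / ((s + ε * t - s) ^ 2 + ε ^ 2)) := by
    rw [h1, ← mul_assoc, mul_inv_cancel₀ hε.ne', one_mul]
  rw [h2, ← integral_const_mul]
  congr 1
  funext t
  have h3 : (1 : ℝ) + t ^ 2 ≠ 0 := by positivity
  have h4 : (s + ε * t - s) ^ 2 + ε ^ 2 = ε ^ 2 * (1 + t ^ 2) := by ring
  rw [h4]
  field_simp

theorem tendsto_poisson {φ : ℝ → ℝ} (hφ : Continuous φ) {M : ℝ} (hM : ∀ x, |φ x| ≤ M) (s : ℝ) :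
    Tendsto (fun ε : ℝ => ∫ t, φ (s + ε * t) * (1 + t ^ 2)⁻¹) (𝓝[>] 0) (𝓝 (Real.pi * φ s)) := by
  have e : Real.pi * φ s = ∫ t : ℝ, φ (s + 0 * t) * (1 + t ^ 2)⁻¹ := by
    simp only [zero_mul, add_zero]
    rw [integral_const_mul, integral_univ_inv_one_add_sq, mul_comm]
  rw [e]
  refine tendsto_integral_filter_of_dominated_convergence (fun t => M * (1 + t ^ 2)⁻¹)
    (Eventually.of_forall fun ε => ?_) (Eventually.of_forall fun ε => ae_of_all _ fun t => ?_)
    (integrable_inv_one_add_sq.const_mul M) (ae_of_all _ fun t => ?_)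
  · exact (by fun_prop : Measurable fun t : ℝ => φ (s + ε * t) * (1 + t ^ 2)⁻¹).aestronglyMeasurable
  · rw [norm_mul, Real.norm_eq_abs, Real.norm_of_nonneg (by positivity : 0 ≤ (1 + t ^ 2)⁻¹)]
    gcongr
    exact hM _
  · have : Continuous fun ε : ℝ => φ (s + ε * t) * (1 + t ^ 2)⁻¹ := by fun_prop
    exact (this.tendsto 0).mono_left nhdsWithin_le_nhds

theorem norm_poisson_le {φ : ℝ → ℝ} {M : ℝ} (hM : ∀ x, |φ x| ≤ M) (s ε : ℝ) :
    |∫ t, φ (s + ε * t) * (1 + t ^ 2)⁻¹| ≤ M * Real.pi := by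
  rw [← integral_univ_inv_one_add_sq, ← integral_const_mul, ← Real.norm_eq_abs]
  refine norm_integral_le_of_norm_le (integrable_inv_one_add_sq.const_mul M)
    (ae_of_all _ fun t => ?_)
  rw [norm_mul, Real.norm_eq_abs, Real.norm_of_nonneg (by positivity : 0 ≤ (1 + t ^ 2)⁻¹)]
  gcongr
  exact hM _

theorem continuous_poisson {φ : ℝ → ℝ} (hφ : Continuous φ) {M : ℝ} (hM : ∀ x, |φ x| ≤ M) (ε : ℝ) :
    Continuous fun s => ∫ t, φ (s + ε * t) * (1 + t ^ 2)⁻¹ := by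
  refine continuous_of_dominated (bound := fun t => M * (1 + t ^ 2)⁻¹) (fun s => ?_)
    (fun s => ae_of_all _ fun t => ?_) (integrable_inv_one_add_sq.const_mul M)
    (ae_of_all _ fun t => by fun_prop)
  · exact (by fun_prop : Measurable fun t : ℝ => φ (s + ε * t) * (1 + t ^ 2)⁻¹).aestronglyMeasurable
  · rw [norm_mul, Real.norm_eq_abs, Real.norm_of_nonneg (by positivity : 0 ≤ (1 + t ^ 2)⁻¹)]
    gcongr
    exact hM _

theorem cauchy_sub_cauchy {h : ℝ → ℂ} (hi : Integrable h) (x : ℝ) {ε : ℝ} (hε : 0 < ε) :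
    cauchy h (x + ε * I) - cauchy h (x - ε * I)
      = ∫ s : ℝ, -2 * I * h s * ((ε / ((x - s) ^ 2 + ε ^ 2) : ℝ) : ℂ) := by
  rw [cauchy, cauchy, ← integral_sub (integrable_div_sub hi (by simpa using hε.ne'))
    (integrable_div_sub hi (by simpa using hε.ne'))]
  congr 1
  funext s
  have h1 : (x : ℂ) + ε * I - s ≠ 0 := fun h0 => by
    have := congrArg Complex.im h0; simp at this; exact hε.ne' this
  have h2 : (x : ℂ) - ε * I - s ≠ 0 := fun h0 => by
    have := congrArg Complex.im h0; simp at this; exact hε.ne' this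
  have h3 : ((x : ℂ) - s) ^ 2 + ε ^ 2 = (x + ε * I - s) * (x - ε * I - s) := by
    linear_combination ((ε : ℂ) ^ 2) * Complex.I_sq
  push_cast
  rw [h3]
  field_simp
  ring

/-- The jump of a Cauchy transform across the real line, in the vague sense. -/
theorem tendsto_cauchy_jump {h : ℝ → ℂ} (hi : Integrable h) {φ : ℝ → ℝ} (hφ : Continuous φ)
    (hc : HasCompactSupport φ) :
    Tendsto (fun ε : ℝ => ∫ x : ℝ, (φ x : ℂ) * (cauchy h (x + ε * I) - cauchy h (x - ε * I)))
      (𝓝[>] 0) (𝓝 (-2 * Real.pi * I * ∫ x : ℝ, (φ x : ℂ) * h x)) := by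
  obtain ⟨M, hM⟩ := hc.exists_bound_of_continuous hφ
  simp only [Real.norm_eq_abs] at hM
  have e : ∀ ε : ℝ, 0 < ε →
      ∫ x : ℝ, (φ x : ℂ) * (cauchy h (x + ε * I) - cauchy h (x - ε * I))
        = ∫ s : ℝ, -2 * I * h s * ((∫ t, φ (s + ε * t) * (1 + t ^ 2)⁻¹ : ℝ) : ℂ) := by
    intro ε hε
    -- Fubini is available because for fixed ε the Poisson kernel is bounded by 1/ε.
    have hint : Integrable (Function.uncurry fun (x s : ℝ) =>
        (φ x : ℂ) * (-2 * I * h s * ((ε / ((x - s) ^ 2 + ε ^ 2) : ℝ) : ℂ)))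
        ((volume : Measure ℝ).prod volume) := by
      have h1 : Integrable (fun p : ℝ × ℝ => (φ p.1 : ℂ) * (-2 * I * h p.2))
          ((volume : Measure ℝ).prod volume) :=
        (hφ.integrable_of_hasCompactSupport hc).ofReal.mul_prod (hi.const_mul (-2 * I))
      refine (h1.mul_bdd (c := ε⁻¹)
        (g := fun p : ℝ × ℝ => ((ε / ((p.1 - p.2) ^ 2 + ε ^ 2) : ℝ) : ℂ)) ?_
        (ae_of_all _ fun p => ?_)).congr (ae_of_all _ fun p => ?_)
      · exact (by fun_prop : Measurable fun p : ℝ × ℝ =>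
          ((ε / ((p.1 - p.2) ^ 2 + ε ^ 2) : ℝ) : ℂ)).aestronglyMeasurable
      · rw [Complex.norm_real, Real.norm_of_nonneg (by positivity), div_le_iff₀ (by positivity)]
        field_simp
        nlinarith [sq_nonneg (p.1 - p.2)]
      · simp only [Function.uncurry]; ring
    have e1 : ∀ x : ℝ, (φ x : ℂ) * (cauchy h (x + ε * I) - cauchy h (x - ε * I))
        = ∫ s : ℝ, (φ x : ℂ) * (-2 * I * h s * ((ε / ((x - s) ^ 2 + ε ^ 2) : ℝ) : ℂ)) := fun x => by
      rw [cauchy_sub_cauchy hi x hε, integral_const_mul]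
    simp_rw [e1]
    rw [integral_integral_swap hint]
    congr 1
    funext s
    rw [← integral_poisson_eq φ s hε, ← integral_complex_ofReal, ← integral_const_mul]
    congr 1
    funext x
    push_cast
    ring
  have hlim : Tendsto (fun ε : ℝ => ∫ s : ℝ, -2 * I * h s *
      ((∫ t, φ (s + ε * t) * (1 + t ^ 2)⁻¹ : ℝ) : ℂ)) (𝓝[>] 0)
      (𝓝 (∫ s : ℝ, -2 * I * h s * ((Real.pi * φ s : ℝ) : ℂ))) := by
    refine tendsto_integral_filter_of_dominated_convergence
      (fun s => ‖-2 * I * h s‖ * (M * Real.pi))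
      (Eventually.of_forall fun ε => ?_) (Eventually.of_forall fun ε => ae_of_all _ fun s => ?_)
      ((hi.const_mul (-2 * I)).norm.mul_const _) (ae_of_all _ fun s => ?_)
    · exact ((hi.1.const_mul (-2 * I)).mul
        (Complex.continuous_ofReal.comp (continuous_poisson hφ hM ε)).aestronglyMeasurable)
    · rw [norm_mul, Complex.norm_real, Real.norm_eq_abs]
      gcongr
      exact norm_poisson_le hM s ε
    · exact ((Complex.continuous_ofReal.tendsto _).comp (tendsto_poisson hφ hM s)).const_mul _
  have e2 : ∫ s : ℝ, -2 * I * h s * ((Real.pi * φ s : ℝ) : ℂ)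
      = -2 * Real.pi * I * ∫ x : ℝ, (φ x : ℂ) * h x := by
    rw [← integral_const_mul]
    congr 1
    funext s
    push_cast
    ring
  rw [e2] at hlim
  refine hlim.congr' ?_
  filter_upwards [self_mem_nhdsWithin] with ε hε
  exact (e ε hε).symm

/-! ### Behaviour at infinity -/

/-- From |z| ≤ |z - s| + |s| and |Im z| ≤ |z - s| follows |z|/|z - s| ≤ 1 + |s|/|Im z|; a finite
first moment thus buys one power of decay. -/
theorem norm_cauchy_le {h : ℝ → ℂ} (hi : Integrable h) (hi' : Integrable fun s : ℝ => (s : ℂ) * h s)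
    {z : ℂ} (hz : z.im ≠ 0) :
    ‖cauchy h z‖ ≤ ((∫ s, ‖h s‖) + ∫ s : ℝ, ‖(s : ℂ) * h s‖) / ‖z‖ * (1 + 1 / |z.im|) := by
  have hz0 : z ≠ 0 := fun h0 => hz (by simp [h0])
  have hzn : 0 < ‖z‖ := norm_pos_iff.2 hz0
  have hzi : 0 < |z.im| := abs_pos.2 hz
  have h1 : ‖cauchy h z‖ ≤ ∫ s : ℝ, ‖z‖⁻¹ * (‖h s‖ + |z.im|⁻¹ * ‖(s : ℂ) * h s‖) := by
    refine norm_integral_le_of_norm_le ((hi.norm.add (hi'.norm.const_mul _)).const_mul _)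
      (ae_of_all _ fun s => ?_)
    have h2 : |z.im| ≤ ‖z - s‖ := by simpa using Complex.abs_im_le_norm (z - s)
    have hp : 0 < ‖z - s‖ := hzi.trans_le h2
    have h3 : ‖z‖ ≤ ‖z - s‖ + ‖(s : ℂ)‖ := by simpa using norm_add_le (z - s) (s : ℂ)
    have h4 : ‖(s : ℂ)‖ / ‖z - s‖ ≤ |z.im|⁻¹ * ‖(s : ℂ)‖ := by
      rw [div_eq_inv_mul]; gcongr
    have h5 : ‖z‖ / ‖z - s‖ ≤ 1 + |z.im|⁻¹ * ‖(s : ℂ)‖ := by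
      calc ‖z‖ / ‖z - s‖ ≤ (‖z - s‖ + ‖(s : ℂ)‖) / ‖z - s‖ := by gcongr
        _ = 1 + ‖(s : ℂ)‖ / ‖z - s‖ := by rw [add_div, div_self hp.ne']
        _ ≤ _ := by gcongr
    rw [norm_div, norm_mul]
    calc ‖h s‖ / ‖z - s‖ = ‖z‖⁻¹ * (‖h s‖ * (‖z‖ / ‖z - s‖)) := by field_simp
      _ ≤ ‖z‖⁻¹ * (‖h s‖ * (1 + |z.im|⁻¹ * ‖(s : ℂ)‖)) := by gcongr
      _ = _ := by ring
  refine h1.trans ?_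
  rw [integral_const_mul, integral_add hi.norm (hi'.norm.const_mul _), integral_const_mul]
  have i1 : 0 ≤ ∫ s, ‖h s‖ := integral_nonneg fun _ => norm_nonneg _
  have i2 : 0 ≤ ∫ s : ℝ, ‖(s : ℂ) * h s‖ := integral_nonneg fun _ => norm_nonneg _
  have e : ((∫ s, ‖h s‖) + ∫ s : ℝ, ‖(s : ℂ) * h s‖) / ‖z‖ * (1 + 1 / |z.im|)
      = ‖z‖⁻¹ * ((∫ s, ‖h s‖) + |z.im|⁻¹ * (∫ s : ℝ, ‖(s : ℂ) * h s‖)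
        + ((∫ s : ℝ, ‖(s : ℂ) * h s‖) + |z.im|⁻¹ * ∫ s, ‖h s‖)) := by
    field_simp
    ring
  rw [e]
  refine mul_le_mul_of_nonneg_left ?_ (inv_nonneg.2 hzn.le)
  have : 0 ≤ (∫ s : ℝ, ‖(s : ℂ) * h s‖) + |z.im|⁻¹ * ∫ s, ‖h s‖ := by positivity
  linarith

theorem mul_cauchy {h : ℝ → ℂ} (hi : Integrable h) (hi' : Integrable fun s : ℝ => (s : ℂ) * h s)
    {z : ℂ} (hz : z.im ≠ 0) :
    z * cauchy h z = (∫ s, h s) + cauchy (fun s => (s : ℂ) * h s) z := by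
  rw [cauchy, cauchy, ← integral_const_mul, ← integral_add hi (integrable_div_sub hi' hz)]
  congr 1
  funext s
  have : z - s ≠ 0 := fun h0 => hz (by have := congrArg Complex.im h0; simpa using this)
  field_simp
  ring

/-- Iterates z C[h] = ∫ h + C[s h]; the vanishing moments remove the constants. It is used in both
directions: to get decay from vanishing moments, and vanishing moments from decay. -/
theorem pow_succ_mul_cauchy {h : ℝ → ℂ} (hi : ∀ k : ℕ, Integrable fun s : ℝ => (s : ℂ) ^ k * h s)
    {z : ℂ} (hz : z.im ≠ 0) (n : ℕ) (hm : ∀ k < n, ∫ s : ℝ, (s : ℂ) ^ k * h s = 0) :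
    z ^ (n + 1) * cauchy h z
      = (∫ s : ℝ, (s : ℂ) ^ n * h s) + cauchy (fun s => (s : ℂ) ^ (n + 1) * h s) z := by
  have hs : ∀ k : ℕ, z * cauchy (fun s => (s : ℂ) ^ k * h s) z
      = (∫ s : ℝ, (s : ℂ) ^ k * h s) + cauchy (fun s => (s : ℂ) ^ (k + 1) * h s) z := by
    intro k
    have e : ∀ s : ℝ, (s : ℂ) * ((s : ℂ) ^ k * h s) = (s : ℂ) ^ (k + 1) * h s := fun s => by ring
    have := mul_cauchy (hi k) (by simpa only [e] using hi (k + 1)) hz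
    simpa only [e] using this
  induction n with
  | zero => simpa using hs 0
  | succ n ih =>
    have h1 := ih fun k hk => hm k (hk.trans n.lt_succ_self)
    rw [hm n n.lt_succ_self, zero_add] at h1
    rw [pow_succ', mul_assoc, h1, hs]

/-! ### Supports -/

theorem isClosed_supp (a : ℝ → ℝ) : IsClosed (supp a) := Measure.isClosed_support

theorem ae_eq_zero_of_notMem_supp {a : ℝ → ℝ} (hm : Measurable a) (hn : ∀ x, 0 ≤ a x) :
    ∀ᵐ s : ℝ, s ∉ supp a → a s = 0 := by
  have h1 : ∀ᵐ s ∂(volume.withDensity fun x => ENNReal.ofReal (a x)), s ∈ supp a :=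
    Measure.support_mem_ae
  rw [ae_withDensity_iff (by fun_prop)] at h1
  filter_upwards [h1] with s hs hns
  by_contra h0
  exact hns (hs (ENNReal.ofReal_pos.2 (lt_of_le_of_ne (hn s) (Ne.symm h0))).ne')

theorem IsWeight.measurable_star {a : ℝ → ℝ} (ha : IsWeight a) : Measurable (star a) :=
  ha.measurable.comp measurable_neg

theorem isOpen_dom (α β : ℝ → ℝ) : IsOpen (dom α β) :=
  (Complex.isometry_ofReal.isClosedEmbedding.isClosedMap _
    ((isClosed_supp α).union (isClosed_supp (star β)))).isOpen_compl

theorem mem_dom_of_im_ne_zero {α β : ℝ → ℝ} {z : ℂ} (hz : z.im ≠ 0) : z ∈ dom α β := by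
  rintro ⟨x, -, rfl⟩
  simp at hz

theorem dom_subset_left (α β : ℝ → ℝ) :
    dom α β ⊆ ((fun x : ℝ => (x : ℂ)) '' supp α)ᶜ :=
  compl_subset_compl.2 (image_mono subset_union_left)

theorem dom_subset_right (α β : ℝ → ℝ) :
    dom α β ⊆ ((fun x : ℝ => (x : ℂ)) '' supp (star β))ᶜ :=
  compl_subset_compl.2 (image_mono subset_union_right)

/-! ### Rows built by Cauchy transforms -/

/-- The density `P α`. -/
noncomputable def dens₁ (α : ℝ → ℝ) (P : ℂ[X]) (s : ℝ) : ℂ := P.eval (s : ℂ) * α s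

/-- The density `(c + C[P α]) β⋆`, where `C` is the Cauchy transform. -/
noncomputable def dens₂ (α β : ℝ → ℝ) (P : ℂ[X]) (c : ℂ) (s : ℝ) : ℂ :=
  (c + cauchy (dens₁ α P) s) * star β s

/-- The row `(P, c + C[P α], d + C[(c + C[P α]) β⋆])`, where `C` is the Cauchy transform. -/
noncomputable def row (α β : ℝ → ℝ) (P : ℂ[X]) (c d : ℂ) (z : ℂ) : Fin 3 → ℂ :=
  ![P.eval z, c + cauchy (dens₁ α P) z, d + cauchy (dens₂ α β P c) z]

/-- The pairing of a complex polynomial with `y ^ k`. -/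
noncomputable def pairPow (α β : ℝ → ℝ) (P : ℂ[X]) (k : ℕ) : ℂ :=
  ∫ s : ℝ × ℝ, P.eval (s.1 : ℂ) * s.2 ^ k / (s.1 + s.2) * (α s.1 * β s.2)

section

variable {α β : ℝ → ℝ}

theorem integrable_pairPow (hα : IsWeight α) (hβ : IsWeight β) (h : FiniteBimoments α β)
    (P : ℂ[X]) (k : ℕ) : Integrable fun s : ℝ × ℝ =>
    P.eval (s.1 : ℂ) * s.2 ^ k / (s.1 + s.2) * (α s.1 * β s.2) := by
  simp_rw [eval_eq_sum_range, Finset.sum_mul, Finset.sum_div, Finset.sum_mul]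
  refine integrable_finsetSum _ fun i _ => ?_
  refine ((h.integrable hα hβ i k).ofReal.const_mul (P.coeff i)).congr (ae_of_all _ fun s => ?_)
  simp only [Complex.coe_algebraMap]
  push_cast
  ring

theorem integrable_pow_mul_dens₁ (hα : IsWeight α) (hβ : IsWeight β) (h : FiniteBimoments α β)
    (P : ℂ[X]) (k : ℕ) :
    Integrable fun s : ℝ => (s : ℂ) ^ k * dens₁ α P s := by
  refine (integrable_eval_mul_complex hα hβ h (X ^ k * P)).congr (ae_of_all _ fun s => ?_)
  simp only [dens₁, eval_mul, eval_pow, eval_X]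
  ring

theorem integrable_dens₁ (hα : IsWeight α) (hβ : IsWeight β) (h : FiniteBimoments α β)
    (P : ℂ[X]) : Integrable (dens₁ α P) :=
  integrable_eval_mul_complex hα hβ h P

theorem integrable_pow_star (hα : IsWeight α) (hβ : IsWeight β) (h : FiniteBimoments α β)
    (k : ℕ) : Integrable fun s : ℝ => (s : ℂ) ^ k * (star β s : ℂ) := by
  refine (((h.symm hα hβ).integrable_moment hβ hα k).ofReal.const_mul ((-1 : ℂ) ^ k)).comp_neg.congr
    (ae_of_all _ fun s => ?_)
  simp only [star, Complex.coe_algebraMap]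
  push_cast
  rw [← mul_assoc, ← mul_pow]
  congr 2
  ring

/-- With y = -s the kernel 1/(x + y) becomes -1/(s - x), so a slice of the pairing is a value of the
Cauchy transform on the negative axis. -/
theorem integral_pairPow_slice (P : ℂ[X]) (k : ℕ) (s : ℝ) :
    (∫ x : ℝ, P.eval (x : ℂ) * ((-s : ℝ) : ℂ) ^ k / (x + (-s : ℝ)) * (α x * β (-s)))
      = (-1) ^ (k + 1) * ((s : ℂ) ^ k * (cauchy (dens₁ α P) s * star β s)) := by
  rw [cauchy, mul_comm (integral _ _), ← mul_assoc, ← mul_assoc, ← integral_const_mul]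
  congr 1
  funext x
  rw [dens₁, star]
  have : ((-s : ℝ) : ℂ) ^ k = (-1) ^ k * (s : ℂ) ^ k := by
    rw [← mul_pow]; push_cast; ring
  rw [this, Complex.ofReal_neg, ← sub_eq_add_neg, ← neg_sub (s : ℂ) x, div_neg, pow_succ]
  ring

/-- C[Pα] may be unbounded near 0, where both supports can end, so integrability is taken from
Fubini applied to the bimoments and not from a pointwise bound. -/
theorem integrable_pow_mul_dens₂ (hα : IsWeight α) (hβ : IsWeight β) (h : FiniteBimoments α β)
    (P : ℂ[X]) (c : ℂ) (k : ℕ) :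
    Integrable fun s : ℝ => (s : ℂ) ^ k * dens₂ α β P c s := by
  have h1 := (Measure.volume_eq_prod ℝ ℝ ▸ integrable_pairPow hα hβ h P k :
    Integrable _ ((volume : Measure ℝ).prod volume)).integral_prod_right.comp_neg
  have h2 := h1.const_mul ((-1 : ℂ) ^ (k + 1))
  simp_rw [integral_pairPow_slice, ← mul_assoc, ← mul_pow, neg_one_mul, neg_neg, one_pow, one_mul] at h2
  refine (h2.add ((integrable_pow_star hα hβ h k).const_mul c)).congr (ae_of_all _ fun s => ?_)
  simp only [Pi.add_apply, dens₂]
  ring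

theorem integrable_dens₂ (hα : IsWeight α) (hβ : IsWeight β) (h : FiniteBimoments α β)
    (P : ℂ[X]) (c : ℂ) : Integrable (dens₂ α β P c) := by
  simpa using integrable_pow_mul_dens₂ hα hβ h P c 0

/-- The link between analysis and algebra: decay of the third entry of a row is a statement about
these moments, and hence about orthogonality of P to powers of y. -/
theorem integral_pow_mul_dens₂ (hα : IsWeight α) (hβ : IsWeight β) (h : FiniteBimoments α β)
    (P : ℂ[X]) (c : ℂ) (k : ℕ) :
    ∫ s : ℝ, (s : ℂ) ^ k * dens₂ α β P c s
      = (-1) ^ k * (c * (∫ y : ℝ, (y : ℂ) ^ k * β y) - pairPow α β P k) := by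
  have hprod := (Measure.volume_eq_prod ℝ ℝ ▸ integrable_pairPow hα hβ h P k :
    Integrable _ ((volume : Measure ℝ).prod volume))
  have h1 : pairPow α β P k
      = ∫ s : ℝ, (-1) ^ (k + 1) * ((s : ℂ) ^ k * (cauchy (dens₁ α P) s * star β s)) := by
    rw [pairPow, Measure.volume_eq_prod, integral_prod_symm _ hprod, ← integral_neg_eq_self]
    simp_rw [integral_pairPow_slice]
  have h2 : ∫ y : ℝ, (y : ℂ) ^ k * β y = ∫ s : ℝ, (-1) ^ k * ((s : ℂ) ^ k * star β s) := by
    rw [← integral_neg_eq_self]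
    congr 1; funext s
    rw [star, ← mul_assoc, ← mul_pow]
    push_cast
    congr 2
    ring
  have h3 : (fun s : ℝ => (s : ℂ) ^ k * dens₂ α β P c s) = fun s : ℝ =>
      c * ((s : ℂ) ^ k * star β s) + ((s : ℂ) ^ k * (cauchy (dens₁ α P) s * star β s)) := by
    funext s; rw [dens₂]; ring
  have i1 := (integrable_pow_star hα hβ h k).const_mul c
  have i2 : Integrable fun s : ℝ => (s : ℂ) ^ k * (cauchy (dens₁ α P) s * star β s) := by
    refine ((integrable_pow_mul_dens₂ hα hβ h P 0 k)).congr (ae_of_all _ fun s => ?_)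
    simp only [dens₂, zero_add]
  rw [h3, integral_add i1 i2, h1, h2, integral_const_mul, integral_const_mul, integral_const_mul,
    pow_succ]
  have : ((-1 : ℂ) ^ k) * (-1) ^ k = 1 := by rw [← mul_pow]; simp
  linear_combination (-(c * ∫ s : ℝ, (s : ℂ) ^ k * star β s)
    - ∫ s : ℝ, (s : ℂ) ^ k * (cauchy (dens₁ α P) s * star β s)) * this

theorem ae_dens₁_eq_zero (hα : IsWeight α)
    (P : ℂ[X]) : ∀ᵐ s : ℝ, s ∉ supp α → dens₁ α P s = 0 := by
  filter_upwards [ae_eq_zero_of_notMem_supp hα.measurable hα.nonneg] with s hs hns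
  simp [dens₁, hs hns]

theorem ae_dens₂_eq_zero (hβ : IsWeight β)
    (P : ℂ[X]) (c : ℂ) :
    ∀ᵐ s : ℝ, s ∉ supp (star β) → dens₂ α β P c s = 0 := by
  filter_upwards [ae_eq_zero_of_notMem_supp hβ.measurable_star fun x => hβ.nonneg _] with s hs hns
  simp [dens₂, hs hns]

theorem differentiableOn_row (hα : IsWeight α) (hβ : IsWeight β) (h : FiniteBimoments α β)
    (P : ℂ[X]) (c d : ℂ) (j : Fin 3) :
    DifferentiableOn ℂ (fun z => row α β P c d z j) (dom α β) := by
  have h1 := (differentiableOn_cauchy (integrable_dens₁ hα hβ h P) (isClosed_supp α)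
    (ae_dens₁_eq_zero hα P)).mono (dom_subset_left α β)
  have h2 := (differentiableOn_cauchy (integrable_dens₂ hα hβ h P c) (isClosed_supp (star β))
    (ae_dens₂_eq_zero hβ P c)).mono (dom_subset_right α β)
  fin_cases j
  · exact P.differentiable.differentiableOn
  · exact h1.const_add c
  · exact h2.const_add d

end

theorem tendsto_integral_mul_shift {ψ : ℝ → ℂ} (hψ : Integrable ψ) (hc : HasCompactSupport ψ)
    {F : ℂ → ℂ} (hF : Continuous F) {σ : ℂ} :
    Tendsto (fun ε : ℝ => ∫ x : ℝ, ψ x * F (x + ε * σ)) (𝓝[>] 0) (𝓝 (∫ x : ℝ, ψ x * F x)) := by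
  have hFc : Continuous fun p : ℝ × ℝ => F (p.1 + p.2 * σ) := by fun_prop
  obtain ⟨M, hM⟩ := (hc.isCompact.prod (isCompact_Icc (a := (0 : ℝ)) (b := 1))).exists_bound_of_continuousOn
    hFc.continuousOn
  refine tendsto_integral_filter_of_dominated_convergence (fun x => ‖ψ x‖ * M)
    (Eventually.of_forall fun ε => ?_) ?_ (hψ.norm.mul_const M) (ae_of_all _ fun x => ?_)
  · exact hψ.1.mul (by fun_prop : Continuous fun x : ℝ => F (x + ε * σ)).aestronglyMeasurable
  · filter_upwards [Ioo_mem_nhdsGT (zero_lt_one (α := ℝ))] with ε hε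
    refine ae_of_all _ fun x => ?_
    by_cases hx : ψ x = 0
    · simp [hx]
    · rw [norm_mul]
      gcongr
      exact hM (x, ε) ⟨subset_tsupport _ hx, hε.1.le, hε.2.le⟩
  · have h1 : Continuous fun ε : ℝ => ψ x * F (x + ε * σ) := by fun_prop
    have h2 := h1.tendsto 0
    simp only [Complex.ofReal_zero, zero_mul, add_zero] at h2
    exact h2.mono_left nhdsWithin_le_nhds

section

variable {α β : ℝ → ℝ}

/-- Supplies the dominating function for the boundary values of C[Pα] against β⋆. -/
theorem integrable_norm_slice (hα : IsWeight α) (hβ : IsWeight β) (h : FiniteBimoments α β)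
    (P : ℂ[X]) :
    Integrable fun x : ℝ => (∫ s : ℝ, ‖dens₁ α P s‖ / |x - s|) * star β x := by
  have h1 := (Measure.volume_eq_prod ℝ ℝ ▸ (integrable_pairPow hα hβ h P 0).norm :
    Integrable _ ((volume : Measure ℝ).prod volume)).integral_prod_right.comp_neg
  refine h1.congr (ae_of_all _ fun x => ?_)
  simp only
  rw [← integral_mul_const]
  congr 1
  funext s
  have e : ‖(s : ℂ) + ((-x : ℝ) : ℂ)‖ = |x - s| := by
    rw [← Complex.ofReal_add, Complex.norm_real, Real.norm_eq_abs, abs_sub_comm, sub_eq_add_neg]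
  simp only [norm_mul, norm_div, e, pow_zero, mul_one, dens₁, star, Complex.norm_real,
    Real.norm_of_nonneg (hβ.nonneg (-x))]
  ring

theorem norm_cauchy_dens₁_le (hα : IsWeight α) (hβ : IsWeight β) (h : FiniteBimoments α β)
    (P : ℂ[X]) {x : ℝ} (hx : x < 0) (ε : ℝ) :
    ‖cauchy (dens₁ α P) (x - ε * I)‖ ≤ ∫ s : ℝ, ‖dens₁ α P s‖ / |x - s| := by
  have hi := integrable_dens₁ hα hβ h P
  have hle : ∀ s : ℝ, dens₁ α P s ≠ 0 → -x ≤ |x - s| := fun s hs => by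
    have : 0 < s := by
      by_contra h0
      exact hs (by simp [dens₁, hα.eq_zero _ (not_lt.1 h0)])
    rw [abs_sub_comm]
    exact (by linarith : -x ≤ s - x).trans (le_abs_self _)
  refine norm_integral_le_of_norm_le ?_ (ae_of_all _ fun s => ?_)
  · refine (integrable_div_sub_of_le (z := x) hi (neg_pos.2 hx) (ae_of_all _ fun s hs => ?_)).norm.congr
      (ae_of_all _ fun s => ?_)
    · rw [← Complex.ofReal_sub, Complex.norm_real]; exact hle s hs
    · simp only [norm_div, ← Complex.ofReal_sub, Complex.norm_real, Real.norm_eq_abs]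
  · by_cases hs : dens₁ α P s = 0
    · simp [hs]
    · rw [norm_div]
      have h1 := Complex.abs_re_le_norm ((x : ℂ) - ε * I - s)
      simp at h1
      have := hle s hs
      gcongr
      linarith

/-- On the negative axis C[Pα] is continuous, which gives pointwise convergence. Leaving the real
line only increases |x - s|, so the slices of `integrable_norm_slice` dominate for all ε, also near
0. -/
theorem tendsto_integral_star_mul_cauchy (hα : IsWeight α) (hβ : IsWeight β) (h : FiniteBimoments α β)
    (P : ℂ[X]) (c : ℂ) {φ : ℝ → ℝ} (hφ : Continuous φ)
    (hc : HasCompactSupport φ) :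
    Tendsto (fun ε : ℝ => ∫ x : ℝ, (φ x : ℂ) *
        ((c + cauchy (dens₁ α P) (x - ε * I)) * star β x)) (𝓝[>] 0)
      (𝓝 (∫ x : ℝ, (φ x : ℂ) * dens₂ α β P c x)) := by
  obtain ⟨M, hM⟩ := hc.exists_bound_of_continuous hφ
  have hM0 : 0 ≤ M := (norm_nonneg _).trans (hM 0)
  have hβs : Integrable fun x => star β x := by
    have := integrable_pow_star hα hβ h 0
    simp only [pow_zero, one_mul] at this
    simpa using this.re
  have hd := differentiableOn_cauchy (integrable_dens₁ hα hβ h P) (isClosed_Ici (a := (0 : ℝ)))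
    (ae_of_all _ fun s hs => by simp [dens₁, hα.eq_zero _ (not_le.1 hs).le])
  have hopen : IsOpen ((fun x : ℝ => (x : ℂ)) '' Ici 0)ᶜ :=
    (Complex.isometry_ofReal.isClosedEmbedding.isClosedMap _ isClosed_Ici).isOpen_compl
  refine tendsto_integral_filter_of_dominated_convergence
    (fun x => M * ((‖c‖ * star β x) + (∫ s : ℝ, ‖dens₁ α P s‖ / |x - s|) * star β x)) ?_ ?_
    (((hβs.const_mul _).add (integrable_norm_slice hα hβ h P)).const_mul M) (ae_of_all _ fun x => ?_)
  · filter_upwards [self_mem_nhdsWithin] with ε hε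
    have hcont : Continuous fun x : ℝ => cauchy (dens₁ α P) (x - ε * I) :=
      continuous_along' (hd.continuousOn.mono (by
        rintro z hz ⟨x, -, rfl⟩
        simp at hz)) (ne_of_gt hε)
    refine (Complex.continuous_ofReal.comp hφ).aestronglyMeasurable.mul
      ((continuous_const.add hcont).aestronglyMeasurable.mul ?_)
    exact (Complex.measurable_ofReal.comp hβ.measurable_star).aestronglyMeasurable
  · refine Eventually.of_forall fun ε => ae_of_all _ fun x => ?_
    by_cases hx : x < 0
    · have hb : 0 ≤ star β x := hβ.nonneg _
      rw [norm_mul, norm_mul, Complex.norm_real, Complex.norm_real, Real.norm_of_nonneg hb, ← add_mul]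
      have := norm_cauchy_dens₁_le hα hβ h P hx ε
      gcongr
      · exact hM x
      · exact (norm_add_le _ _).trans (by gcongr)
    · have : star β x = 0 := hβ.eq_zero _ (by linarith)
      simp [this]
  · by_cases hx : x < 0
    · refine Tendsto.const_mul _ (Tendsto.mul_const _ (Tendsto.const_add _ ?_))
      have hca : ContinuousAt (cauchy (dens₁ α P)) x := by
        refine (hd.differentiableAt (hopen.mem_nhds ?_)).continuousAt
        rintro ⟨y, hy, hyx⟩
        have : y = x := Complex.ofReal_injective hyx
        exact absurd hx (not_lt.2 (this ▸ hy))
      have h1 : Continuous fun ε : ℝ => (x : ℂ) - ε * I := by fun_prop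
      have h2 := h1.tendsto 0
      simp only [Complex.ofReal_zero, zero_mul, sub_zero] at h2
      exact hca.tendsto.comp (h2.mono_left nhdsWithin_le_nhds)
    · have : star β x = 0 := hβ.eq_zero _ (by linarith)
      simp [this, dens₂]

end

/-! ### The jump relation for rows -/

theorem vecMul_jump (α β : ℝ → ℝ) (v : Fin 3 → ℂ) (x : ℝ) :
    Matrix.vecMul v (jump α β x) = ![v 0, v 0 * (-2 * Real.pi * I * α x) + v 1,
      v 1 * (-2 * Real.pi * I * star β x) + v 2] := by
  funext j
  fin_cases j <;> simp [jump, Matrix.vecMul, dotProduct, Fin.sum_univ_three]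

/-- The row vector `g` satisfies `g₊ = g₋ V` on the real line in the vague sense. -/
def HasJump (α β : ℝ → ℝ) (g : ℂ → Fin 3 → ℂ) : Prop :=
  ∀ φ : ℝ → ℝ, Continuous φ → HasCompactSupport φ → ∀ j,
    Tendsto (fun ε : ℝ => ∫ x : ℝ, (φ x : ℂ) *
        (g (x + ε * I) - Matrix.vecMul (g (x - ε * I)) (jump α β x)) j) (𝓝[>] 0) (𝓝 0)

section

variable {α β : ℝ → ℝ}

/-- Linear combinations of jump relations split an integral of a sum, which requires integrability
of each part; α and β⋆ are merely integrable, but the factors next to them are continuous with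
compact support. -/
theorem integrable_jump (hα : IsWeight α) (hβ : IsWeight β) (h : FiniteBimoments α β)
    {g : ℂ → Fin 3 → ℂ}
    (hg : ∀ j, ContinuousOn (fun z => g z j) {z | z.im ≠ 0}) {φ : ℝ → ℝ} (hφ : Continuous φ)
    (hc : HasCompactSupport φ) (j : Fin 3) {ε : ℝ} (hε : 0 < ε) :
    Integrable fun x : ℝ => (φ x : ℂ) *
      (g (x + ε * I) - Matrix.vecMul (g (x - ε * I)) (jump α β x)) j := by
  have hφ' : Continuous fun x => (φ x : ℂ) := by fun_prop
  have hc' : HasCompactSupport fun x => (φ x : ℂ) :=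
    hc.comp_left (g := fun x : ℝ => (x : ℂ)) Complex.ofReal_zero
  have hp := fun j => continuous_along (hg j) hε.ne'
  have hm := fun j => continuous_along' (hg j) hε.ne'
  have i1 : ∀ j, Integrable fun x : ℝ => (φ x : ℂ) * (g (x + ε * I) j - g (x - ε * I) j) :=
    fun j => (hφ'.mul ((hp j).sub (hm j))).integrable_of_hasCompactSupport hc'.mul_right
  have i2 : ∀ (j) (a : ℝ → ℝ), Integrable a →
      Integrable fun x : ℝ => ((φ x : ℂ) * g (x - ε * I) j) * (2 * Real.pi * I * a x) := by
    intro j a ha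
    obtain ⟨M, hM⟩ := (hc'.mul_right (f' := fun x : ℝ => g (x - ε * I) j)).exists_bound_of_continuous
      (hφ'.mul (hm j))
    exact (ha.ofReal.const_mul (2 * Real.pi * I)).bdd_mul (hφ'.mul (hm j)).aestronglyMeasurable
      (ae_of_all _ hM)
  have ia : Integrable α := by simpa using h.integrable_moment hα hβ 0
  have ib : Integrable (star β) := by
    have := ((h.symm hα hβ).integrable_moment hβ hα 0).comp_neg
    simp only [pow_zero, one_mul] at this
    exact this
  simp_rw [vecMul_jump]
  fin_cases j
  · simpa using i1 0
  · refine ((i1 1).add (i2 0 α ia)).congr (ae_of_all _ fun x => ?_)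
    simp
    ring
  · refine ((i1 2).add (i2 1 (star β) ib)).congr (ae_of_all _ fun x => ?_)
    simp
    ring

theorem HasJump.lin (hα : IsWeight α) (hβ : IsWeight β) (h : FiniteBimoments α β)
    {g g' : ℂ → Fin 3 → ℂ}
    (hg : ∀ j, ContinuousOn (fun z => g z j) {z | z.im ≠ 0})
    (hg' : ∀ j, ContinuousOn (fun z => g' z j) {z | z.im ≠ 0})
    (hj : HasJump α β g) (hj' : HasJump α β g') (c c' : ℂ) :
    HasJump α β fun z => c • g z + c' • g' z := by
  intro φ hφ hc j
  have h1 := ((hj φ hφ hc j).const_mul c).add ((hj' φ hφ hc j).const_mul c')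
  rw [mul_zero, mul_zero, add_zero] at h1
  refine h1.congr' ?_
  filter_upwards [self_mem_nhdsWithin] with ε hε
  rw [← integral_const_mul, ← integral_const_mul,
    ← integral_add ((integrable_jump hα hβ h hg hφ hc j hε).const_mul c)
      ((integrable_jump hα hβ h hg' hφ hc j hε).const_mul c')]
  congr 1
  funext x
  rw [Matrix.add_vecMul, Matrix.smul_vecMul, Matrix.smul_vecMul]
  simp only [Pi.sub_apply, Pi.add_apply, Pi.smul_apply, smul_eq_mul]
  ring

/-- The polynomial entry does not jump. The jumps -2πi Pα and -2πi (c + C[Pα]) β⋆ of the two Cauchy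
transforms are cancelled by the off-diagonal terms of V applied to the preceding entry. -/
theorem hasJump_row (hα : IsWeight α) (hβ : IsWeight β) (h : FiniteBimoments α β)
    (P : ℂ[X]) (c d : ℂ) : HasJump α β (row α β P c d) := by
  intro φ hφ hc
  have hφ' : Continuous fun x => (φ x : ℂ) := by fun_prop
  have hc' : HasCompactSupport fun x => (φ x : ℂ) :=
    hc.comp_left (g := fun x : ℝ => (x : ℂ)) Complex.ofReal_zero
  have hg : ∀ j, ContinuousOn (fun z => row α β P c d z j) {z | z.im ≠ 0} := fun j =>
    (differentiableOn_row hα hβ h P c d j).continuousOn.mono fun z hz => mem_dom_of_im_ne_zero hz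
  have hp := fun (j) (ε : ℝ) (hε : ε ≠ 0) => continuous_along (hg j) hε
  have hm := fun (j) (ε : ℝ) (hε : ε ≠ 0) => continuous_along' (hg j) hε
  have ic : ∀ j, ∀ ε : ℝ, 0 < ε → Integrable fun x : ℝ =>
      (φ x : ℂ) * (row α β P c d (x + ε * I) j - row α β P c d (x - ε * I) j) := fun j ε hε =>
    (hφ'.mul ((hp j ε hε.ne').sub (hm j ε hε.ne'))).integrable_of_hasCompactSupport hc'.mul_right
  have ij := fun (j) (ε : ℝ) (hε : 0 < ε) =>
    integrable_jump hα hβ h (g := row α β P c d) hg hφ hc j hε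
  have ia : Integrable α := by simpa using h.integrable_moment hα hβ 0
  simp_rw [vecMul_jump] at ij ⊢
  intro j
  fin_cases j
  · have h1 := (tendsto_integral_mul_shift (hφ'.integrable_of_hasCompactSupport hc') hc'
      P.continuous (σ := I)).sub (tendsto_integral_mul_shift
        (hφ'.integrable_of_hasCompactSupport hc') hc' P.continuous (σ := -I))
    rw [sub_self] at h1
    refine h1.congr fun ε => ?_
    rw [← integral_sub]
    · congr 1
      funext x
      simp [row]
      ring_nf
    · exact (by fun_prop : Continuous fun x : ℝ => (φ x : ℂ) * P.eval (x + ε * I)).integrable_of_hasCompactSupport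
        hc'.mul_right
    · exact (by fun_prop : Continuous fun x : ℝ => (φ x : ℂ) * P.eval (x + ε * -I)).integrable_of_hasCompactSupport
        hc'.mul_right
  · have iψ : Integrable fun x : ℝ => (φ x : ℂ) * α x := by
      obtain ⟨M, hM⟩ := hc'.exists_bound_of_continuous hφ'
      exact ia.ofReal.bdd_mul hφ'.aestronglyMeasurable (ae_of_all _ hM)
    have h1 := (tendsto_cauchy_jump (integrable_dens₁ hα hβ h P) hφ hc).add
      ((tendsto_integral_mul_shift iψ (hc'.mul_right (f' := fun x : ℝ => (α x : ℂ))) P.continuous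
        (σ := -I)).const_mul (2 * Real.pi * I))
    have e : -2 * Real.pi * I * (∫ x : ℝ, (φ x : ℂ) * dens₁ α P x)
        + 2 * Real.pi * I * (∫ x : ℝ, (φ x : ℂ) * α x * P.eval (x : ℂ)) = 0 := by
      have : (fun x : ℝ => (φ x : ℂ) * dens₁ α P x) = fun x : ℝ => (φ x : ℂ) * α x * P.eval (x : ℂ) := by
        funext x; rw [dens₁]; ring
      rw [this]; ring
    rw [e] at h1
    refine h1.congr' ?_
    filter_upwards [self_mem_nhdsWithin] with ε hε
    have i1 := ic 1 ε hε
    have i2 := (ij 1 ε hε).sub i1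
    have e1 : (fun x : ℝ => (φ x : ℂ) * (cauchy (dens₁ α P) (x + ε * I) - cauchy (dens₁ α P) (x - ε * I)))
        = fun x : ℝ => (φ x : ℂ) * (row α β P c d (x + ε * I) 1 - row α β P c d (x - ε * I) 1) := by
      funext x; simp [row]
    rw [e1, ← integral_const_mul, ← integral_add i1 (i2.congr (ae_of_all _ fun x => ?_))]
    · congr 1
      funext x
      simp [row]
      ring_nf
    · simp [row]
      ring_nf
  · have h1 := (tendsto_cauchy_jump (integrable_dens₂ hα hβ h P c) hφ hc).add
      ((tendsto_integral_star_mul_cauchy hα hβ h P c hφ hc).const_mul (2 * Real.pi * I))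
    have e : -2 * Real.pi * I * (∫ x : ℝ, (φ x : ℂ) * dens₂ α β P c x)
        + 2 * Real.pi * I * (∫ x : ℝ, (φ x : ℂ) * dens₂ α β P c x) = 0 := by ring
    rw [e] at h1
    refine h1.congr' ?_
    filter_upwards [self_mem_nhdsWithin] with ε hε
    have i1 := ic 2 ε hε
    have i2 := (ij 2 ε hε).sub i1
    have e1 : (fun x : ℝ => (φ x : ℂ) * (cauchy (dens₂ α β P c) (x + ε * I) - cauchy (dens₂ α β P c) (x - ε * I)))
        = fun x : ℝ => (φ x : ℂ) * (row α β P c d (x + ε * I) 2 - row α β P c d (x - ε * I) 2) := by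
      funext x; simp [row]
    rw [e1, ← integral_const_mul, ← integral_add i1 (i2.congr (ae_of_all _ fun x => ?_))]
    · congr 1
      funext x
      simp [row]
      ring_nf
    · simp [row]
      ring_nf

end

/-! ### Rows of solutions -/

/-- The diagonal entries `z ^ n, 1, z ^ (-n)`. -/
noncomputable def scale (n : ℕ) (z : ℂ) : Fin 3 → ℂ := ![z ^ n, 1, (z ^ n)⁻¹]

/-- A row vector of the Riemann–Hilbert problem of index `n` with the behaviour
`(v + O(1/z)) diag(z ^ n, 1, z ^ (-n))` at infinity. -/
structure IsRow (α β : ℝ → ℝ) (n : ℕ) (v : Fin 3 → ℂ) (g : ℂ → Fin 3 → ℂ) : Prop where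
  differentiableOn : ∀ j, DifferentiableOn ℂ (fun z => g z j) (dom α β)
  hasJump : HasJump α β g
  asymptotic : ∃ C R : ℝ, 0 < R ∧ ∀ z : ℂ, R ≤ ‖z‖ → z.im ≠ 0 → ∀ j,
    ‖g z j - v j * scale n z j‖ ≤ C / ‖z‖ * (1 + 1 / |z.im|) * ‖scale n z j‖

theorem IsRow.continuousOn {α β : ℝ → ℝ} {n : ℕ} {v : Fin 3 → ℂ} {g : ℂ → Fin 3 → ℂ}
    (hg : IsRow α β n v g) (j : Fin 3) : ContinuousOn (fun z => g z j) {z | z.im ≠ 0} :=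
  (hg.differentiableOn j).continuousOn.mono fun _ hz => mem_dom_of_im_ne_zero hz

theorem IsRow.lin {α β : ℝ → ℝ} (hα : IsWeight α) (hβ : IsWeight β) (h : FiniteBimoments α β)
    {n : ℕ} {v v' : Fin 3 → ℂ} {g g' : ℂ → Fin 3 → ℂ} (hg : IsRow α β n v g)
    (hg' : IsRow α β n v' g') (c c' : ℂ) :
    IsRow α β n (c • v + c' • v') fun z => c • g z + c' • g' z := by
  refine ⟨fun j => ((hg.differentiableOn j).const_mul c).add ((hg'.differentiableOn j).const_mul c'),
    HasJump.lin hα hβ h hg.continuousOn hg'.continuousOn hg.hasJump hg'.hasJump c c', ?_⟩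
  obtain ⟨C, R, hR, hC⟩ := hg.asymptotic
  obtain ⟨C', R', -, hC'⟩ := hg'.asymptotic
  refine ⟨‖c‖ * C + ‖c'‖ * C', max R R', lt_max_of_lt_left hR, fun z hz hi j => ?_⟩
  have h1 := hC z ((le_max_left _ _).trans hz) hi j
  have h2 := hC' z ((le_max_right _ _).trans hz) hi j
  have e : (c • g z + c' • g' z) j - (c • v + c' • v') j * scale n z j
      = c * (g z j - v j * scale n z j) + c' * (g' z j - v' j * scale n z j) := by
    simp only [Pi.add_apply, Pi.smul_apply, smul_eq_mul]
    ring
  rw [e]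
  refine (norm_add_le _ _).trans ?_
  rw [norm_mul, norm_mul]
  calc _ ≤ ‖c‖ * (C / ‖z‖ * (1 + 1 / |z.im|) * ‖scale n z j‖)
      + ‖c'‖ * (C' / ‖z‖ * (1 + 1 / |z.im|) * ‖scale n z j‖) := by gcongr
    _ = _ := by ring

theorem IsRow.sum_fin_three {α β : ℝ → ℝ} (hα : IsWeight α) (hβ : IsWeight β)
    (h : FiniteBimoments α β) {n : ℕ} {v : Fin 3 → Fin 3 → ℂ} {g : Fin 3 → ℂ → Fin 3 → ℂ}
    (hg : ∀ i, IsRow α β n (v i) (g i)) (c : Fin 3 → ℂ) :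
    IsRow α β n (∑ i, c i • v i) fun z => ∑ i, c i • g i z := by
  have h1 := ((hg 0).lin hα hβ h (hg 1) (c 0) (c 1)).lin hα hβ h (hg 2) 1 (c 2)
  simpa [Fin.sum_univ_three] using h1

theorem isRow_of_isRHPSolution {α β : ℝ → ℝ} {n : ℕ} {G : ℂ → Matrix (Fin 3) (Fin 3) ℂ}
    (hG : IsRHPSolution α β n G) (i : Fin 3) : IsRow α β n (Pi.single i 1) fun z => G z i := by
  refine ⟨fun j => (hG.analytic i j).differentiableOn, fun φ hφ hc j => hG.jump_rel φ hφ hc i j, ?_⟩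
  obtain ⟨C, R, E, hR, hE⟩ := hG.asymptotic
  refine ⟨C, R, hR, fun z hz hi j => ?_⟩
  obtain ⟨h1, h2⟩ := hE z hz hi
  have e : G z i j - (Pi.single i 1 : Fin 3 → ℂ) j * scale n z j = E z i j * scale n z j := by
    have : G z i j = ((1 : Matrix (Fin 3) (Fin 3) ℂ) i j + E z i j) * scale n z j := by
      rw [h1, Matrix.mul_diagonal]; rfl
    rw [this, Matrix.one_apply, Pi.single_apply]
    simp only [eq_comm (a := i)]
    ring
  rw [e, norm_mul]
  gcongr
  exact h2 i j

theorem isRHPSolution_of_isRow {α β : ℝ → ℝ} {n : ℕ} {G : ℂ → Matrix (Fin 3) (Fin 3) ℂ}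
    (hG : ∀ i, IsRow α β n (Pi.single i 1) fun z => G z i) : IsRHPSolution α β n G := by
  refine ⟨fun i j => ((hG i).differentiableOn j).analyticOnNhd (isOpen_dom α β),
    fun φ hφ hc i j => (hG i).hasJump φ hφ hc j, ?_⟩
  choose C R hR hC using fun i => (hG i).asymptotic
  have hC0 : ∀ i, C i ≤ ∑ k, |C k| := fun i =>
    (le_abs_self _).trans (Finset.single_le_sum (f := fun k => |C k|) (fun _ _ => abs_nonneg _)
      (Finset.mem_univ i))
  have hR0 : ∀ i, R i ≤ ∑ k, R k := fun i =>
    Finset.single_le_sum (f := R) (fun k _ => (hR k).le) (Finset.mem_univ i)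
  refine ⟨∑ k, |C k|, ∑ k, R k, fun z => Matrix.of fun i j =>
    G z i j / scale n z j - (1 : Matrix (Fin 3) (Fin 3) ℂ) i j, (hR 0).trans_le (hR0 0),
    fun z hz hi => ?_⟩
  have hz0 : z ≠ 0 := fun h0 => hi (by simp [h0])
  have hs : ∀ j, scale n z j ≠ 0 := fun j => by
    fin_cases j <;> simp [scale, hz0]
  refine ⟨?_, fun i j => ?_⟩
  · ext i j
    rw [Matrix.mul_diagonal, Matrix.add_apply]
    change G z i j = ((1 : Matrix (Fin 3) (Fin 3) ℂ) i j + (G z i j / scale n z j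
      - (1 : Matrix (Fin 3) (Fin 3) ℂ) i j)) * scale n z j
    rw [add_sub_cancel]
    exact (div_mul_cancel₀ _ (hs j)).symm
  · have h1 := hC i z ((hR0 i).trans hz) hi j
    have e : G z i j / scale n z j - (1 : Matrix (Fin 3) (Fin 3) ℂ) i j
        = (G z i j - (Pi.single i 1 : Fin 3 → ℂ) j * scale n z j) / scale n z j := by
      rw [Matrix.one_apply, Pi.single_apply, sub_div, mul_div_cancel_right₀ _ (hs j)]
      simp only [eq_comm (a := i)]
    change ‖G z i j / scale n z j - (1 : Matrix (Fin 3) (Fin 3) ℂ) i j‖ ≤ _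
    rw [e, norm_div, div_le_iff₀ (norm_pos_iff.2 (hs j))]
    refine h1.trans ?_
    gcongr
    exact hC0 i

/-! ### Nondegeneracy for complex polynomials -/

theorem exists_re_im_polynomial {n : ℕ} {P : ℂ[X]} (hP : P.degree < n) :
    ∃ A B : ℝ[X], A.degree < n ∧ B.degree < n ∧
      P = A.map (algebraMap ℝ ℂ) + C I * B.map (algebraMap ℝ ℂ) := by
  have hdeg : ∀ a : ℕ → ℝ, (∑ j ∈ Finset.range n, C (a j) * X ^ j).degree < (n : WithBot ℕ) := fun a => by
    rw [← mem_degreeLT]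
    refine Submodule.sum_mem _ fun j hj => mem_degreeLT.2 ?_
    exact (degree_C_mul_X_pow_le j _).trans_lt (by exact_mod_cast Finset.mem_range.1 hj)
  refine ⟨∑ j ∈ Finset.range n, C (P.coeff j).re * X ^ j,
    ∑ j ∈ Finset.range n, C (P.coeff j).im * X ^ j, hdeg _, hdeg _, ?_⟩
  ext k
  simp only [coeff_add, coeff_map, coeff_C_mul, finsetSum_coeff, coeff_X_pow, mul_ite, mul_one,
    mul_zero, Finset.sum_ite_eq, Finset.mem_range]
  split_ifs with hk
  · rw [Complex.coe_algebraMap, mul_comm, Complex.re_add_im]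
  · rw [coeff_eq_zero_of_degree_lt (hP.trans_le (by exact_mod_cast not_lt.1 hk))]
    simp

section

variable {α β : ℝ → ℝ}

theorem pairPow_map (A : ℝ[X]) (k : ℕ) :
    pairPow α β (A.map (algebraMap ℝ ℂ)) k = pairing α β A (X ^ k) := by
  rw [pairPow, pairing, ← integral_complex_ofReal]
  congr 1
  funext s
  have : (A.map (algebraMap ℝ ℂ)).eval (s.1 : ℂ) = ((A.eval s.1 : ℝ) : ℂ) := by
    rw [eval_map_algebraMap]; exact Polynomial.aeval_ofReal A s.1
  rw [this, eval_pow, eval_X]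
  push_cast
  ring

theorem pairPow_add (hα : IsWeight α) (hβ : IsWeight β) (h : FiniteBimoments α β)
    (P Q : ℂ[X]) (k : ℕ) :
    pairPow α β (P + Q) k = pairPow α β P k + pairPow α β Q k := by
  rw [pairPow, pairPow, pairPow,
    ← integral_add (integrable_pairPow hα hβ h P k) (integrable_pairPow hα hβ h Q k)]
  congr 1; funext s; rw [eval_add]; ring

theorem pairPow_C_mul (c : ℂ) (P : ℂ[X]) (k : ℕ) :
    pairPow α β (C c * P) k = c * pairPow α β P k := by
  rw [pairPow, pairPow, ← integral_const_mul]
  congr 1; funext s; rw [eval_mul, eval_C]; ring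

/-- The nodal polynomial of `exists_nodal_pairing_pos` has degree < n, so it is a combination of the
powers against which A vanishes. -/
theorem eq_zero_of_pairing_pow_eq_zero (hα : IsWeight α) (hβ : IsWeight β) (h : FiniteBimoments α β)
    {n : ℕ} {A : ℝ[X]} (hA : A.degree < n)
    (h0 : ∀ k < n, pairing α β A (X ^ k) = 0) : A = 0 := by
  by_contra hne
  obtain ⟨S, Z, hSZ, -, hZ, σ, -, -, hpos⟩ := exists_nodal_pairing_pos hα hβ h hne
  have hAn : A.natDegree < n := (natDegree_lt_iff_degree_lt hne).2 hA
  have hSn : (Lagrange.nodal S (id : ℝ → ℝ)).natDegree < n := by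
    rw [Lagrange.natDegree_nodal]
    exact ((Finset.card_le_card hSZ).trans hZ).trans_lt hAn
  have : pairing α β A (Lagrange.nodal S id) = 0 := by
    change pairingₗ hα hβ h A (Lagrange.nodal S id) = 0
    rw [as_sum_range_C_mul_X_pow (Lagrange.nodal S id), map_sum]
    refine Finset.sum_eq_zero fun k hk => ?_
    rw [← smul_eq_C_mul, map_smul]
    have : pairingₗ hα hβ h A (X ^ k) = 0 := h0 k (by have := Finset.mem_range.1 hk; omega)
    rw [this, smul_zero]
  rw [this, mul_zero] at hpos
  exact lt_irrefl _ hpos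

theorem eq_zero_of_pairPow_eq_zero (hα : IsWeight α) (hβ : IsWeight β) (h : FiniteBimoments α β)
    {n : ℕ} {P : ℂ[X]} (hP : P.degree < n)
    (h0 : ∀ k < n, pairPow α β P k = 0) : P = 0 := by
  obtain ⟨A, B, hA, hB, rfl⟩ := exists_re_im_polynomial hP
  have h1 : ∀ k < n, pairing α β A (X ^ k) = 0 ∧ pairing α β B (X ^ k) = 0 := by
    intro k hk
    have h2 := h0 k hk
    rw [pairPow_add hα hβ h, pairPow_C_mul, pairPow_map, pairPow_map] at h2
    exact ⟨by simpa using congrArg Complex.re h2, by simpa using congrArg Complex.im h2⟩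
  rw [eq_zero_of_pairing_pow_eq_zero hα hβ h hA fun k hk => (h1 k hk).1,
    eq_zero_of_pairing_pow_eq_zero hα hβ h hB fun k hk => (h1 k hk).2]
  simp

end

/-! ### Uniqueness of rows -/

theorem eq_zero_of_noJump {f : ℂ → ℂ} {C R : ℝ} (hf : DifferentiableOn ℂ f {z | z.im ≠ 0})
    (hj : NoJump f)
    (hbound : ∀ z : ℂ, R ≤ ‖z‖ → z.im ≠ 0 → ‖f z‖ ≤ C / ‖z‖ * (1 + 1 / |z.im|))
    {z : ℂ} (hz : z.im ≠ 0) : f z = 0 := by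
  obtain ⟨P, hP, h⟩ := exists_polynomial_of_noJump (m := 0) hf hj (fun z h1 h2 => by
    simpa using hbound z h1 h2)
  have hP0 : P = 0 := by
    by_contra hne
    rw [degree_eq_natDegree hne] at hP
    exact absurd hP (not_lt.2 (by exact_mod_cast Nat.zero_le _))
  rw [h z hz, hP0, eval_zero]

/-- By induction on k, along z = iy the k-th moment equals z^(k+1) C[h] - C[s^(k+1) h], and both
terms are O(1/y). -/
theorem moments_eq_zero {h : ℝ → ℂ} (hi : ∀ k : ℕ, Integrable fun s : ℝ => (s : ℂ) ^ k * h s)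
    {n : ℕ} {C R : ℝ} (hb : ∀ z : ℂ, R ≤ ‖z‖ → z.im ≠ 0 →
      ‖cauchy h z‖ ≤ C / ‖z‖ * (1 + 1 / |z.im|) * ‖(z ^ n)⁻¹‖) :
    ∀ k < n, ∫ s : ℝ, (s : ℂ) ^ k * h s = 0 := by
  intro k
  induction k using Nat.strong_induction_on with
  | _ k ih =>
    intro hk
    have hm : ∀ i < k, ∫ s : ℝ, (s : ℂ) ^ i * h s = 0 := fun i hi' => ih i hi' (hi'.trans hk)
    set D := (∫ s : ℝ, ‖(s : ℂ) ^ (k + 1) * h s‖) + ∫ s : ℝ, ‖(s : ℂ) * ((s : ℂ) ^ (k + 1) * h s)‖ with hD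
    have key : ∀ᶠ y : ℝ in atTop, ‖∫ s : ℝ, (s : ℂ) ^ k * h s‖ ≤ (|C| * 2 + D * 2) * y⁻¹ := by
      filter_upwards [eventually_ge_atTop 1, eventually_ge_atTop R] with y hy1 hyR
      have hy0 : 0 < y := by linarith
      set z : ℂ := y * I with hz
      have him : z.im = y := by simp [hz]
      have hn : ‖z‖ = y := by simp [hz, abs_of_pos hy0]
      have hzi : z.im ≠ 0 := by rw [him]; exact hy0.ne'
      have e := pow_succ_mul_cauchy hi hzi k hm
      have b1 := norm_cauchy_le (hi (k + 1)) (by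
        refine (hi (k + 2)).congr (ae_of_all _ fun s => ?_)
        simp only
        ring) hzi
      have b2 := hb z (by rw [hn]; exact hyR) hzi
      rw [hn, him, abs_of_pos hy0] at b1 b2
      have h2 : 1 + 1 / y ≤ 2 := by
        have : 1 / y ≤ 1 := by rw [div_le_one hy0]; exact hy1
        linarith
      have h3 : ‖z ^ (k + 1) * cauchy h z‖ ≤ |C| * 2 * y⁻¹ := by
        rw [norm_mul, norm_pow, hn]
        rw [norm_inv, norm_pow, hn] at b2
        have h4 : y ^ (k + 1) ≤ y ^ n := pow_le_pow_right₀ hy1 hk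
        calc y ^ (k + 1) * ‖cauchy h z‖ ≤ y ^ n * (|C| / y * 2 * (y ^ n)⁻¹) := by
              refine mul_le_mul h4 (b2.trans ?_) (norm_nonneg _) (by positivity)
              gcongr
              exact le_abs_self C
          _ = |C| * 2 * y⁻¹ := by field_simp
      have h5 : ‖cauchy (fun s : ℝ => (s : ℂ) ^ (k + 1) * h s) z‖ ≤ D * 2 * y⁻¹ := by
        refine b1.trans ?_
        have hD0 : 0 ≤ D := add_nonneg (integral_nonneg fun _ => norm_nonneg _)
          (integral_nonneg fun _ => norm_nonneg _)
        calc D / y * (1 + 1 / y) ≤ D / y * 2 := by gcongr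
          _ = _ := by ring
      rw [eq_sub_of_add_eq e.symm]
      refine (norm_sub_le _ _).trans ?_
      linarith
    have h0 : Tendsto (fun y : ℝ => (|C| * 2 + D * 2) * y⁻¹) atTop (𝓝 0) := by
      simpa using tendsto_inv_atTop_zero.const_mul (|C| * 2 + D * 2)
    exact norm_le_zero_iff.1 (ge_of_tendsto h0 key)

section

variable {α β : ℝ → ℝ}

theorem exists_bound_cauchy {f : ℝ → ℂ} (hi : ∀ k : ℕ, Integrable fun s : ℝ => (s : ℂ) ^ k * f s) :
    ∃ C, 0 ≤ C ∧ ∀ z : ℂ, z.im ≠ 0 → ‖cauchy f z‖ ≤ C / ‖z‖ * (1 + 1 / |z.im|) :=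
  ⟨_, add_nonneg (integral_nonneg fun _ => norm_nonneg _) (integral_nonneg fun _ => norm_nonneg _),
    fun _ hz => norm_cauchy_le (by simpa using hi 0) (by simpa using hi 1) hz⟩

/-- The homogeneous Riemann–Hilbert problem has only the trivial solution. -/
theorem IsRow.eq_zero (hα : IsWeight α) (hβ : IsWeight β) (h : FiniteBimoments α β)
    {n : ℕ} {g : ℂ → Fin 3 → ℂ} (hg : IsRow α β n 0 g) {z : ℂ}
    (hz : z ∈ dom α β) : g z = 0 := by
  obtain ⟨C, R, hR, hC⟩ := hg.asymptotic
  simp only [Pi.zero_apply, zero_mul, sub_zero] at hC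
  have hsub : {z : ℂ | z.im ≠ 0} ⊆ dom α β := fun z hz => mem_dom_of_im_ne_zero hz
  have hgd := fun j => (hg.differentiableOn j).mono hsub
  have hj := hg.hasJump
  -- The first column of V is the first unit vector, so the first entry does not jump and is a
  -- polynomial of degree < n.
  have hj0 : NoJump fun z => g z 0 := fun φ hφ hc => by
    simpa [vecMul_jump] using hj φ hφ hc 0
  obtain ⟨P, hP, hgP⟩ := exists_polynomial_of_noJump (m := n) (C := C) (R := R) (hgd 0) hj0
    (fun z h1 h2 => (hC z h1 h2 0).trans_eq (by simp [scale]; ring))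
  -- The row generated by P satisfies the same jump relation. In the difference `d` each entry loses
  -- its jump once the preceding entry is known to vanish, so Liouville with m = 0 applies entry by
  -- entry.
  set r := row α β P 0 0 with hr
  have hrd := fun j => (differentiableOn_row hα hβ h P 0 0 j).mono hsub
  set d : ℂ → Fin 3 → ℂ := fun z => (1 : ℂ) • g z + (-1 : ℂ) • r z with hd
  have hdj : HasJump α β d := HasJump.lin hα hβ h (fun j => (hgd j).continuousOn)
    (fun j => (hrd j).continuousOn) hj (hasJump_row hα hβ h P 0 0) 1 (-1)
  have hdd : ∀ j, DifferentiableOn ℂ (fun z => d z j) {z | z.im ≠ 0} := fun j =>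
    ((hgd j).const_mul 1).add ((hrd j).const_mul (-1))
  have hdapp : ∀ z j, d z j = g z j - r z j := fun z j => by
    simp only [hd, Pi.add_apply, Pi.smul_apply, smul_eq_mul]; ring
  have hr1 : ∀ z, r z 1 = cauchy (dens₁ α P) z := fun z => zero_add _
  have hr2 : ∀ z, r z 2 = cauchy (dens₂ α β P 0) z := fun z => zero_add _
  have hd0 : ∀ z : ℂ, z.im ≠ 0 → d z 0 = 0 := fun z hz => by
    rw [hdapp, hgP z hz]; exact sub_self _
  obtain ⟨C₁, hC₁0, hC₁⟩ := exists_bound_cauchy (integrable_pow_mul_dens₁ hα hβ h P)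
  obtain ⟨C₂, hC₂0, hC₂⟩ := exists_bound_cauchy (integrable_pow_mul_dens₂ hα hβ h P 0)
  have hd1 : ∀ z : ℂ, z.im ≠ 0 → d z 1 = 0 := fun z hz => by
    refine eq_zero_of_noJump (C := C + C₁) (R := R) (hdd 1) (fun φ hφ hc => ?_) (fun z h1 h2 => ?_) hz
    · refine (hdj φ hφ hc 1).congr' ?_
      filter_upwards [self_mem_nhdsWithin] with ε hε
      congr 1
      funext x
      have := hd0 (x - ε * I) (by simpa using ne_of_gt hε)
      simp [vecMul_jump, this]
    · have b1 := hC z h1 h2 1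
      have b2 := hC₁ z h2
      rw [hdapp, hr1]
      refine (norm_sub_le _ _).trans ?_
      simp only [scale, Matrix.cons_val_one, Matrix.cons_val_zero, norm_one, mul_one] at b1
      calc _ ≤ C / ‖z‖ * (1 + 1 / |z.im|) + C₁ / ‖z‖ * (1 + 1 / |z.im|) := add_le_add b1 b2
        _ = _ := by ring
  have hd2 : ∀ z : ℂ, z.im ≠ 0 → d z 2 = 0 := fun z hz => by
    refine eq_zero_of_noJump (C := |C| + C₂) (R := max R 1) (hdd 2) (fun φ hφ hc => ?_)
      (fun z h1 h2 => ?_) hz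
    · refine (hdj φ hφ hc 2).congr' ?_
      filter_upwards [self_mem_nhdsWithin] with ε hε
      congr 1
      funext x
      have := hd1 (x - ε * I) (by simpa using ne_of_gt hε)
      simp [vecMul_jump, this]
    · have b1 := hC z ((le_max_left _ _).trans h1) h2 2
      have b2 := hC₂ z h2
      rw [hdapp, hr2]
      refine (norm_sub_le _ _).trans ?_
      have b3 : ‖scale n z 2‖ ≤ 1 := by
        simp only [scale, Matrix.cons_val, norm_inv, norm_pow]
        exact inv_le_one_of_one_le₀ (one_le_pow₀ ((le_max_right _ _).trans h1))
      calc _ ≤ |C| / ‖z‖ * (1 + 1 / |z.im|) * 1 + C₂ / ‖z‖ * (1 + 1 / |z.im|) := by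
            refine add_le_add (b1.trans ?_) b2
            gcongr
            exact le_abs_self C
        _ = _ := by ring
  -- The third entry of g is now a Cauchy transform that decays faster than z^(-n), so its first n
  -- moments vanish and P is orthogonal to y^k for k < n.
  have hmom := moments_eq_zero (n := n) (C := C) (R := R) (integrable_pow_mul_dens₂ hα hβ h P 0)
    (fun z h1 h2 => by
      have b1 := hC z h1 h2 2
      have e := hdapp z 2
      rw [hd2 z h2, hr2] at e
      rw [← sub_eq_zero.1 e.symm]
      exact b1)
  have hP0 : P = 0 := by
    refine eq_zero_of_pairPow_eq_zero hα hβ h hP fun k hk => ?_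
    have := hmom k hk
    rw [integral_pow_mul_dens₂ hα hβ h, zero_mul, zero_sub] at this
    simpa using this
  have hdens₁ : dens₁ α P = 0 := by funext s; simp [dens₁, hP0]
  have hcz : ∀ z, cauchy (0 : ℝ → ℂ) z = 0 := fun z => by simp [cauchy]
  have hr0 : ∀ z, r z = 0 := fun z => by
    have hdens₂ : dens₂ α β P 0 = 0 := by
      funext s; simp [dens₂, hdens₁, hcz]
    funext j
    rw [hr, row, hdens₁, hdens₂, hcz, hP0]
    fin_cases j <;> simp
  have hoff : ∀ (z : ℂ), z.im ≠ 0 → ∀ j, g z j = 0 := fun z hz j => by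
    have : d z j = g z j := by rw [hdapp, hr0]; simp
    rw [← this]
    fin_cases j
    exacts [hd0 z hz, hd1 z hz, hd2 z hz]
  funext j
  by_cases hzi : z.im = 0
  -- Real points of the domain are reached by continuity from above.
  · have hca : ContinuousAt (fun z => g z j) z :=
      ((hg.differentiableOn j).differentiableAt ((isOpen_dom α β).mem_nhds hz)).continuousAt
    have h1 : Continuous fun ε : ℝ => z + ε * I := by fun_prop
    have h2 := h1.tendsto 0
    simp only [Complex.ofReal_zero, zero_mul, add_zero] at h2
    have h3 := hca.tendsto.comp (h2.mono_left (nhdsWithin_le_nhds (s := Ioi (0 : ℝ))))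
    refine tendsto_nhds_unique h3 (tendsto_const_nhds.congr' ?_)
    filter_upwards [self_mem_nhdsWithin] with ε hε
    exact (hoff (z + ε * I) (by simpa [hzi] using ne_of_gt hε) j).symm
  · exact hoff z hzi j

end

/-! ### Points separated from a density -/

/-- `z` has positive distance from almost all points where `a` does not vanish. -/
def Sep (a : ℝ → ℝ) (z : ℂ) : Prop := ∃ δ > 0, ∀ᵐ x : ℝ, a x ≠ 0 → δ ≤ ‖z - x‖

theorem sep_of_notMem_supp {a : ℝ → ℝ} (hm : Measurable a) (hn : ∀ x, 0 ≤ a x) {z : ℂ}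
    (hz : z ∉ (fun x : ℝ => (x : ℂ)) '' supp a) : Sep a z := by
  obtain ⟨δ, hδ, hd⟩ := exists_dist_le_of_notMem (isClosed_supp a) hz
  refine ⟨δ, hδ, ?_⟩
  filter_upwards [ae_eq_zero_of_notMem_supp hm hn] with x hx hne
  exact hd z (Metric.mem_ball_self hδ) x (by by_contra h'; exact hne (hx h'))

theorem Sep.star {a : ℝ → ℝ} {z : ℂ} (h : Sep a z) : Sep (star a) (-z) := by
  obtain ⟨δ, hδ, hd⟩ := h
  refine ⟨δ, hδ, ?_⟩
  have := (Measure.measurePreserving_neg (volume : Measure ℝ)).quasiMeasurePreserving.ae hd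
  filter_upwards [this] with x hx hne
  have h1 := hx hne
  rwa [Complex.ofReal_neg, sub_neg_eq_add, ← norm_neg, neg_add, ← sub_eq_add_neg] at h1

theorem star_star (a : ℝ → ℝ) : star (star a) = a := by
  funext x; simp [star]

theorem IsWeight.sep_of_neg {a : ℝ → ℝ} (ha : IsWeight a) {s : ℝ} (hs : s < 0) : Sep a s := by
  refine ⟨-s, neg_pos.2 hs, ae_of_all _ fun x hx => ?_⟩
  have : 0 < x := by by_contra h0; exact hx (ha.eq_zero _ (not_lt.1 h0))
  rw [← Complex.ofReal_sub, Complex.norm_real, Real.norm_eq_abs, abs_sub_comm]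
  exact (by linarith : -s ≤ x - s).trans (le_abs_self _)

theorem sep_of_mem_dom {α β : ℝ → ℝ} (hα : IsWeight α) {z : ℂ} (hz : z ∈ dom α β) : Sep α z :=
  sep_of_notMem_supp hα.measurable hα.nonneg (dom_subset_left α β hz)

theorem sep_star_of_mem_dom {α β : ℝ → ℝ} (hβ : IsWeight β) {z : ℂ} (hz : z ∈ dom α β) :
    Sep (star β) z :=
  sep_of_notMem_supp hβ.measurable_star (fun _ => hβ.nonneg _) (dom_subset_right α β hz)

theorem Sep.integrable_div {a : ℝ → ℝ} {z : ℂ} (hz : Sep a z) {f : ℝ → ℂ} (hf : Integrable f)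
    (h0 : ∀ x, a x = 0 → f x = 0) : Integrable fun s : ℝ => f s / (z - s) := by
  obtain ⟨δ, hδ, hd⟩ := hz
  refine integrable_div_sub_of_le hf hδ ?_
  filter_upwards [hd] with x hx hne
  exact hx fun h' => hne (h0 x h')

/-! ### Algebra of Cauchy transforms -/

theorem cauchy_add {f g : ℝ → ℂ} {z : ℂ} (hf : Integrable fun s : ℝ => f s / (z - s))
    (hg : Integrable fun s : ℝ => g s / (z - s)) :
    cauchy (fun s => f s + g s) z = cauchy f z + cauchy g z := by
  rw [cauchy, cauchy, cauchy, ← integral_add hf hg]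
  congr 1; funext s; rw [add_div]

theorem integrable_add_div {f g : ℝ → ℂ} {z : ℂ} (hf : Integrable fun s : ℝ => f s / (z - s))
    (hg : Integrable fun s : ℝ => g s / (z - s)) :
    Integrable fun s : ℝ => (f s + g s) / (z - s) :=
  (hf.add hg).congr (ae_of_all _ fun _ => (add_div _ _ _).symm)

theorem cauchy_const_mul (c : ℂ) (f : ℝ → ℂ) (z : ℂ) :
    cauchy (fun s => c * f s) z = c * cauchy f z := by
  rw [cauchy, cauchy, ← integral_const_mul]
  congr 1; funext s; rw [mul_div_assoc]

theorem cauchy_sum {ι : Type*} (t : Finset ι) (c : ι → ℂ) {f : ι → ℝ → ℂ} {z : ℂ}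
    (hf : ∀ i ∈ t, Integrable fun s : ℝ => f i s / (z - s)) :
    cauchy (fun s => ∑ i ∈ t, c i * f i s) z = ∑ i ∈ t, c i * cauchy (f i) z := by
  have : cauchy (fun s => ∑ i ∈ t, c i * f i s) z
      = ∫ s : ℝ, ∑ i ∈ t, c i * (f i s / (z - s)) := by
    rw [cauchy]
    congr 1; funext s
    rw [Finset.sum_div]
    exact Finset.sum_congr rfl fun i _ => mul_div_assoc _ _ _
  rw [this, integral_finsetSum _ fun i hi => (hf i hi).const_mul (c i)]
  exact Finset.sum_congr rfl fun i _ => integral_const_mul _ _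

theorem cauchy_ofReal_mul {f : ℝ → ℂ} {z : ℂ} (hf : Integrable f)
    (hf' : Integrable fun s : ℝ => f s / (z - s)) :
    cauchy (fun s => (s : ℂ) * f s) z = z * cauchy f z - ∫ s, f s := by
  rw [cauchy, cauchy, ← integral_const_mul, ← integral_sub (hf'.const_mul z) hf]
  refine integral_congr_ae ?_
  -- z may be real here; the identity fails at most at s = z, a null set.
  have : ∀ᵐ s : ℝ, s ∉ ({z.re} : Set ℝ) := measure_eq_zero_iff_ae_notMem.1 (measure_singleton _)
  filter_upwards [this] with s hs
  have hne : z - s ≠ 0 := fun h0 => hs (by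
    rw [sub_eq_zero] at h0; simp [h0])
  field_simp
  ring

theorem weyl_star_neg (a : ℝ → ℝ) (z : ℂ) : weyl (star a) (-z) = -weyl a z := by
  rw [weyl, weyl, ← integral_neg_eq_self, ← integral_neg]
  congr 1; funext s
  rw [star, neg_neg, Complex.ofReal_neg, sub_neg_eq_add, ← div_neg]
  congr 1; ring

theorem weyl_eq_cauchy (a : ℝ → ℝ) (z : ℂ) : weyl a z = cauchy (fun s => (a s : ℂ)) z := rfl

theorem weyl_eq_cauchy_dens₁ (a : ℝ → ℝ) (z : ℂ) : weyl a z = cauchy (dens₁ a 1) z := by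
  rw [weyl, cauchy]
  congr 1; funext s; simp [dens₁]

theorem trans₁_eq_cauchy {a : ℝ → ℝ} (ha : IsWeight a) (P : ℝ[X]) (z : ℂ) :
    trans₁ a P z = cauchy (dens₁ a (P.map (algebraMap ℝ ℂ))) z := by
  rw [trans₁, setIntegral_eq_integral_of_forall_compl_eq_zero fun x hx => by
    simp [ha.eq_zero _ (not_lt.1 hx)], cauchy]
  congr 1; funext s
  rw [dens₁, eval_map_algebraMap]
  congr 1
  rw [Complex.ofReal_mul]
  congr 1
  exact (Polynomial.aeval_ofReal P s).symm

theorem trans₂_eq_cauchy {a b : ℝ → ℝ} (ha : IsWeight a) (hb : IsWeight b) (P : ℝ[X]) (z : ℂ) :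
    trans₂ a b P z = cauchy (dens₂ a b (P.map (algebraMap ℝ ℂ)) 0) z := by
  rw [trans₂, setIntegral_eq_integral_of_forall_compl_eq_zero fun x hx => by
    simp [hb.eq_zero _ (not_lt.1 hx)], cauchy, ← integral_neg_eq_self]
  congr 1; funext s
  rw [dens₂, zero_add, trans₁_eq_cauchy ha, star]
  push_cast
  rw [neg_neg, sub_eq_add_neg]

theorem weylStar_eq_trans₂ (a b : ℝ → ℝ) (z : ℂ) :
    weylStar b a z = trans₂ a b 1 z := by
  rw [weylStar, trans₂, ← integral_neg]
  congr 1; funext y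
  rw [trans₁, div_eq_mul_inv, mul_assoc, ← integral_mul_const, ← integral_neg]
  congr 1; funext x
  push_cast
  rw [eval_one, Complex.ofReal_one, ← neg_add', div_neg, mul_comm (z + (y : ℂ)), div_eq_mul_inv, mul_inv]
  ring

section

variable {α β : ℝ → ℝ}

theorem integrable_dens₁_div (hα : IsWeight α) (hβ : IsWeight β) (h : FiniteBimoments α β)
    (P : ℂ[X]) {z : ℂ} (hz : Sep α z) :
    Integrable fun s : ℝ => dens₁ α P s / (z - s) :=
  hz.integrable_div (integrable_dens₁ hα hβ h P) fun x hx => by simp [dens₁, hx]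

theorem integrable_dens₂_div (hα : IsWeight α) (hβ : IsWeight β) (h : FiniteBimoments α β)
    (P : ℂ[X]) (c : ℂ) {z : ℂ} (hz : Sep (star β) z) :
    Integrable fun s : ℝ => dens₂ α β P c s / (z - s) :=
  hz.integrable_div (integrable_dens₂ hα hβ h P c) fun x hx => by simp [dens₂, hx]

theorem integrable_star (hα : IsWeight α) (hβ : IsWeight β) (h : FiniteBimoments α β) :
    Integrable fun s : ℝ => (star β s : ℂ) := by
  simpa using integrable_pow_star hα hβ h 0

theorem cauchy_dens₁_sum (hα : IsWeight α) (hβ : IsWeight β) (h : FiniteBimoments α β)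
    {ι : Type*} (t : Finset ι) (a : ι → ℂ) (P : ι → ℂ[X]) {z : ℂ}
    (hz : Sep α z) :
    cauchy (dens₁ α (∑ i ∈ t, C (a i) * P i)) z = ∑ i ∈ t, a i * cauchy (dens₁ α (P i)) z := by
  rw [← cauchy_sum t a fun i _ => integrable_dens₁_div hα hβ h (P i) hz]
  congr 1; funext s
  simp only [dens₁, eval_finsetSum, eval_mul, eval_C, Finset.sum_mul, mul_assoc]

/-- β⋆ vanishes on [0, ∞), so c + C[Pα] need be known only on the negative axis, where it is not
affected by the support of α. -/
theorem dens₂_eq_of_neg (hβ : IsWeight β)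
    {P : ℂ[X]} {c : ℂ} {F : ℝ → ℂ}
    (hF : ∀ s : ℝ, s < 0 → c + cauchy (dens₁ α P) s = F s) (s : ℝ) :
    dens₂ α β P c s = F s * star β s := by
  by_cases hs : s < 0
  · rw [dens₂, hF s hs]
  · have : star β s = 0 := hβ.eq_zero _ (by linarith)
    simp [dens₂, this]

theorem dens₂_sum (hα : IsWeight α) (hβ : IsWeight β) (h : FiniteBimoments α β)
    {ι : Type*} (t : Finset ι) (a : ι → ℂ) (P : ι → ℂ[X]) (s : ℝ) :
    dens₂ α β (∑ i ∈ t, C (a i) * P i) 0 s = ∑ i ∈ t, a i * dens₂ α β (P i) 0 s := by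
  rw [dens₂_eq_of_neg hβ (F := fun s => ∑ i ∈ t, a i * cauchy (dens₁ α (P i)) s)
    (fun s hs => by rw [zero_add, cauchy_dens₁_sum hα hβ h t a P (hα.sep_of_neg hs)]), Finset.sum_mul]
  exact Finset.sum_congr rfl fun i _ => by rw [dens₂, zero_add, mul_assoc]

theorem cauchy_dens₂_sum (hα : IsWeight α) (hβ : IsWeight β) (h : FiniteBimoments α β)
    {ι : Type*} (t : Finset ι) (a : ι → ℂ) (P : ι → ℂ[X]) {z : ℂ}
    (hz : Sep (star β) z) :
    cauchy (dens₂ α β (∑ i ∈ t, C (a i) * P i) 0) z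
      = ∑ i ∈ t, a i * cauchy (dens₂ α β (P i) 0) z := by
  rw [← cauchy_sum t a fun i _ => integrable_dens₂_div hα hβ h (P i) 0 hz]
  congr 1; funext s
  exact dens₂_sum hα hβ h t a P s

/-- Writing s + w = (z + w) - (z - s), the second part cancels the denominator and leaves a
constant. -/
theorem cauchy_dens₁_X_add_mul (hα : IsWeight α) (hβ : IsWeight β) (h : FiniteBimoments α β)
    (Q : ℂ[X]) (w e : ℂ) {z : ℂ} (hz : Sep α z) :
    cauchy (dens₁ α ((X + C w) * Q + C e)) z
      = (z + w) * cauchy (dens₁ α Q) z - (∫ s, dens₁ α Q s) + e * weyl α z := by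
  have hQ := integrable_dens₁_div hα hβ h Q hz
  have hXQ : Integrable fun s : ℝ => ((s : ℂ) * dens₁ α Q s) / (z - s) :=
    (integrable_dens₁_div hα hβ h (X * Q) hz).congr (ae_of_all _ fun s => by
      simp only [dens₁, eval_mul, eval_X]; ring)
  have h1 := integrable_dens₁_div hα hβ h 1 hz
  have e1 : dens₁ α ((X + C w) * Q + C e)
      = fun s : ℝ => ((s : ℂ) * dens₁ α Q s + w * dens₁ α Q s) + e * dens₁ α 1 s := by
    funext s
    simp only [dens₁, eval_add, eval_mul, eval_X, eval_C, eval_one]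
    ring
  have i1 : Integrable fun s : ℝ => (w * dens₁ α Q s) / (z - s) := by
    simpa only [mul_div_assoc] using hQ.const_mul w
  have i2 : Integrable fun s : ℝ => (e * dens₁ α 1 s) / (z - s) := by
    simpa only [mul_div_assoc] using h1.const_mul e
  rw [e1, cauchy_add (f := fun s : ℝ => (s : ℂ) * dens₁ α Q s + w * dens₁ α Q s)
    (integrable_add_div hXQ i1) i2, cauchy_add hXQ i1, cauchy_const_mul,
    cauchy_const_mul, cauchy_ofReal_mul (integrable_dens₁ hα hβ h Q) hQ, weyl_eq_cauchy_dens₁]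
  ring

theorem dens₂_X_add_mul (hα : IsWeight α) (hβ : IsWeight β) (h : FiniteBimoments α β)
    (Q : ℂ[X]) (w e₀ e₁ : ℂ) (s : ℝ) :
    dens₂ α β ((X + C w) * Q + C e₀) (e₁ + ∫ s, dens₁ α Q s) s
      = ((s : ℂ) * dens₂ α β Q 0 s + w * dens₂ α β Q 0 s) + (e₁ * star β s
        + e₀ * dens₂ α β 1 0 s) := by
  rw [dens₂_eq_of_neg hβ (F := fun s =>
    (s + w) * cauchy (dens₁ α Q) s + e₁ + e₀ * cauchy (dens₁ α 1) s) (fun s hs => by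
      rw [cauchy_dens₁_X_add_mul hα hβ h Q w e₀ (hα.sep_of_neg hs), weyl_eq_cauchy_dens₁]
      ring)]
  simp only [dens₂]
  ring

/-- The additive constant e₁ + ∫ Qα is chosen to cancel the one produced by
`cauchy_dens₁_X_add_mul`, so the second entry becomes (z + w) C[Qα] + e₁ + e₀ W_α, the shape found
in the kernel. -/
theorem cauchy_dens₂_X_add_mul (hα : IsWeight α) (hβ : IsWeight β) (h : FiniteBimoments α β)
    (Q : ℂ[X]) (w e₀ e₁ : ℂ) {z : ℂ} (hz : Sep (star β) z) :
    cauchy (dens₂ α β ((X + C w) * Q + C e₀) (e₁ + ∫ s, dens₁ α Q s)) z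
      = (z + w) * cauchy (dens₂ α β Q 0) z - (∫ s, dens₂ α β Q 0 s)
        + e₁ * weyl (star β) z + e₀ * cauchy (dens₂ α β 1 0) z := by
  have hi := integrable_dens₂ hα hβ h Q 0
  have hQ := integrable_dens₂_div hα hβ h Q 0 hz
  have hXQ : Integrable fun s : ℝ => ((s : ℂ) * dens₂ α β Q 0 s) / (z - s) :=
    hz.integrable_div (by simpa using integrable_pow_mul_dens₂ hα hβ h Q 0 1) fun x hx => by
      simp [dens₂, hx]
  have i1 : Integrable fun s : ℝ => (w * dens₂ α β Q 0 s) / (z - s) := by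
    simpa only [mul_div_assoc] using hQ.const_mul w
  have i2 : Integrable fun s : ℝ => (e₁ * star β s) / (z - s) :=
    hz.integrable_div ((integrable_star hα hβ h).const_mul e₁) fun x hx => by simp [hx]
  have i3 : Integrable fun s : ℝ => (e₀ * dens₂ α β 1 0 s) / (z - s) := by
    simpa only [mul_div_assoc] using (integrable_dens₂_div hα hβ h 1 0 hz).const_mul e₀
  rw [show dens₂ α β ((X + C w) * Q + C e₀) (e₁ + ∫ s, dens₁ α Q s) = _ from
    funext (dens₂_X_add_mul hα hβ h Q w e₀ e₁),
    cauchy_add (f := fun s : ℝ => (s : ℂ) * dens₂ α β Q 0 s + w * dens₂ α β Q 0 s)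
      (integrable_add_div hXQ i1) (integrable_add_div i2 i3),
    cauchy_add hXQ i1, cauchy_add i2 i3, cauchy_const_mul, cauchy_const_mul, cauchy_const_mul,
    cauchy_ofReal_mul hi hQ, weyl_eq_cauchy]
  ring

/-- These moments vanish when the numbers ⟨Q, y^k⟩ satisfy the recurrence of `trans_X_pow_succ`. -/
theorem integral_pow_mul_dens₂_X_add_mul (hα : IsWeight α) (hβ : IsWeight β) (h : FiniteBimoments α β)
    (Q : ℂ[X]) (w e₀ e₁ : ℂ) (k : ℕ) :
    ∫ s : ℝ, (s : ℂ) ^ k * dens₂ α β ((X + C w) * Q + C e₀) (e₁ + ∫ s, dens₁ α Q s) s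
      = (-1) ^ k * (pairPow α β Q (k + 1) - w * pairPow α β Q k
        + e₁ * (∫ y : ℝ, (y : ℂ) ^ k * β y) - e₀ * pairPow α β 1 k) := by
  have i0 := integrable_pow_mul_dens₂ hα hβ h Q 0 (k + 1)
  have i1 := (integrable_pow_mul_dens₂ hα hβ h Q 0 k).const_mul w
  have i2 := (integrable_pow_star hα hβ h k).const_mul e₁
  have i3 := (integrable_pow_mul_dens₂ hα hβ h 1 0 k).const_mul e₀
  have i01 : Integrable fun s : ℝ => (s : ℂ) ^ (k + 1) * dens₂ α β Q 0 s
    + w * ((s : ℂ) ^ k * dens₂ α β Q 0 s) := i0.add i1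
  have i23 : Integrable fun s : ℝ => e₁ * ((s : ℂ) ^ k * star β s)
    + e₀ * ((s : ℂ) ^ k * dens₂ α β 1 0 s) := i2.add i3
  -- The moment formula with zero polynomial and c = 1, for which the density is β⋆ itself.
  have e4 : ∫ s : ℝ, (s : ℂ) ^ k * (star β s : ℂ) = (-1) ^ k * ∫ y : ℝ, (y : ℂ) ^ k * β y := by
    have := integral_pow_mul_dens₂ hα hβ h 0 1 k
    simpa [dens₂, dens₁, cauchy, pairPow] using this
  have e : ∀ s : ℝ, (s : ℂ) ^ k * dens₂ α β ((X + C w) * Q + C e₀) (e₁ + ∫ s, dens₁ α Q s) s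
      = ((s : ℂ) ^ (k + 1) * dens₂ α β Q 0 s + w * ((s : ℂ) ^ k * dens₂ α β Q 0 s))
        + (e₁ * ((s : ℂ) ^ k * star β s) + e₀ * ((s : ℂ) ^ k * dens₂ α β 1 0 s)) := fun s => by
    rw [dens₂_X_add_mul hα hβ h]
    ring
  simp_rw [e]
  rw [integral_add i01 i23, integral_add i0 i1, integral_add i2 i3,
    integral_const_mul, integral_const_mul, integral_const_mul, e4,
    integral_pow_mul_dens₂ hα hβ h, integral_pow_mul_dens₂ hα hβ h, integral_pow_mul_dens₂ hα hβ h]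
  ring

/-! ### Behaviour of rows at infinity -/

theorem exists_bound_eval {n : ℕ} {Q : ℂ[X]} (hQ : Q.degree < n) :
    ∃ C, 0 ≤ C ∧ ∀ z : ℂ, 1 ≤ ‖z‖ → ‖Q.eval z‖ ≤ C / ‖z‖ * ‖z ^ n‖ := by
  refine ⟨∑ j ∈ Finset.range n, ‖Q.coeff j‖, Finset.sum_nonneg fun _ _ => norm_nonneg _,
    fun z hz => ?_⟩
  have hz0 : 0 < ‖z‖ := by linarith
  have e : Q.eval z = ∑ j ∈ Finset.range n, Q.coeff j * z ^ j := by
    rcases eq_or_ne Q 0 with rfl | hne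
    · simp
    · exact eval_eq_sum_range' ((natDegree_lt_iff_degree_lt hne).2 hQ) z
  rw [e, Finset.sum_div, Finset.sum_mul]
  refine (norm_sum_le _ _).trans (Finset.sum_le_sum fun j hj => ?_)
  rw [norm_mul, norm_pow, norm_pow, div_mul_eq_mul_div, le_div_iff₀ hz0, mul_assoc, ← pow_succ]
  gcongr
  exact Finset.mem_range.1 hj

/-- The leading coefficients are the coefficient of X^n in P, the constant c, and for n ≥ 1 the
moment of order n - 1: when all lower moments vanish, the third entry starts with z^(-n). For n = 0
no moment condition remains and the third coefficient is d. -/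
theorem exists_isRow (hα : IsWeight α) (hβ : IsWeight β) (h : FiniteBimoments α β)
    {n : ℕ} {P : ℂ[X]} (hP : P.degree ≤ n) {c d : ℂ} (hd : n ≠ 0 → d = 0)
    (hm : ∀ k, k + 1 < n → ∫ s : ℝ, (s : ℂ) ^ k * dens₂ α β P c s = 0) :
    ∃ v, IsRow α β n v (row α β P c d) := by
  have hQ : (P - C (P.coeff n) * X ^ n).degree < (n : WithBot ℕ) := by
    rw [degree_lt_iff_coeff_zero]
    intro m hm
    rw [coeff_sub, coeff_C_mul_X_pow]
    split_ifs with h'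
    · rw [h', sub_self]
    · rw [sub_zero, coeff_eq_zero_of_degree_lt (hP.trans_lt (by
        exact_mod_cast lt_of_le_of_ne hm (Ne.symm h')))]
  obtain ⟨C₀, hC₀, b0⟩ := exists_bound_eval hQ
  obtain ⟨C₁, hC₁, b1⟩ := exists_bound_cauchy (integrable_pow_mul_dens₁ hα hβ h P)
  have hi := integrable_pow_mul_dens₂ hα hβ h P c
  obtain ⟨v₂, C₂, hC₂, b2⟩ : ∃ (v₂ : ℂ) (C₂ : ℝ), 0 ≤ C₂ ∧ ∀ z : ℂ, z.im ≠ 0 →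
      ‖d + cauchy (dens₂ α β P c) z - v₂ * (z ^ n)⁻¹‖
        ≤ C₂ / ‖z‖ * (1 + 1 / |z.im|) * ‖(z ^ n)⁻¹‖ := by
    rcases n with _ | n
    · obtain ⟨C₂, hC₂, b2⟩ := exists_bound_cauchy hi
      exact ⟨d, C₂, hC₂, fun z hz => by simpa using b2 z hz⟩
    · obtain ⟨C₂, hC₂, b2⟩ := exists_bound_cauchy (f := fun s => (s : ℂ) ^ (n + 1) * dens₂ α β P c s)
        (fun k => (hi (k + (n + 1))).congr (ae_of_all _ fun s => by simp only; ring))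
      refine ⟨∫ s : ℝ, (s : ℂ) ^ n * dens₂ α β P c s, C₂, hC₂, fun z hz => ?_⟩
      have hz0 : z ^ (n + 1) ≠ 0 := pow_ne_zero _ fun h0 => hz (by simp [h0])
      have e := pow_succ_mul_cauchy hi hz n fun k hk => hm k (by omega)
      have e' : d + cauchy (dens₂ α β P c) z - (∫ s : ℝ, (s : ℂ) ^ n * dens₂ α β P c s) * (z ^ (n + 1))⁻¹
          = cauchy (fun s => (s : ℂ) ^ (n + 1) * dens₂ α β P c s) z * (z ^ (n + 1))⁻¹ := by
        rw [hd n.succ_ne_zero, zero_add, eq_sub_of_add_eq' e.symm]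
        field_simp
      rw [e', norm_mul]
      gcongr
      exact b2 z hz
  refine ⟨![P.coeff n, c, v₂], differentiableOn_row hα hβ h P c d, hasJump_row hα hβ h P c d,
    C₀ + C₁ + C₂, 1, one_pos, fun z hz hzi j => ?_⟩
  have hpos : 0 ≤ 1 / |z.im| := by positivity
  have hz0 : 0 < ‖z‖ := by linarith
  fin_cases j
  · have e : P.eval z - P.coeff n * z ^ n = (P - C (P.coeff n) * X ^ n).eval z := by simp
    change ‖P.eval z - P.coeff n * z ^ n‖ ≤ (C₀ + C₁ + C₂) / ‖z‖ * (1 + 1 / |z.im|) * ‖z ^ n‖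
    rw [e]
    refine (b0 z hz).trans ?_
    gcongr
    calc C₀ / ‖z‖ ≤ (C₀ + C₁ + C₂) / ‖z‖ := by gcongr; linarith
      _ ≤ (C₀ + C₁ + C₂) / ‖z‖ * (1 + 1 / |z.im|) :=
        le_mul_of_one_le_right (by positivity) (by linarith)
  · have e : c + cauchy (dens₁ α P) z - c * 1 = cauchy (dens₁ α P) z := by ring
    change ‖c + cauchy (dens₁ α P) z - c * 1‖
      ≤ (C₀ + C₁ + C₂) / ‖z‖ * (1 + 1 / |z.im|) * ‖(1 : ℂ)‖
    rw [e, norm_one, mul_one]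
    refine (b1 z hzi).trans ?_
    gcongr
    linarith
  · change ‖d + cauchy (dens₂ α β P c) z - v₂ * (z ^ n)⁻¹‖
      ≤ (C₀ + C₁ + C₂) / ‖z‖ * (1 + 1 / |z.im|) * ‖(z ^ n)⁻¹‖
    refine (b2 z hzi).trans ?_
    gcongr
    linarith

end

/-! ### Reproducing property and the kernel as a function of z -/

theorem exists_sum_C_mul {q : ℕ → ℝ[X]} (hd : ∀ j, (q j).natDegree = j) (h0 : ∀ j, q j ≠ 0)
    (n : ℕ) : ∀ {r : ℝ[X]}, r.degree < n →
      ∃ b : ℕ → ℝ, r = ∑ j ∈ Finset.range n, C (b j) * q j := by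
  induction n with
  | zero =>
    intro r hr
    refine ⟨0, ?_⟩
    simpa using hr
  | succ n ih =>
    intro r hr
    have hq : (q n).coeff n ≠ 0 := by
      have := leadingCoeff_ne_zero.2 (h0 n)
      rwa [leadingCoeff, hd] at this
    obtain ⟨b, hb⟩ := ih (r := r - C (r.coeff n / (q n).coeff n) * q n) (by
      rw [degree_lt_iff_coeff_zero]
      intro m hm
      rw [coeff_sub, coeff_C_mul]
      rcases hm.eq_or_lt with rfl | hlt
      · field_simp; ring
      · rw [coeff_eq_zero_of_degree_lt (p := r) (hr.trans_le (by exact_mod_cast hlt)),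
          coeff_eq_zero_of_natDegree_lt (p := q n) (n := m) (by rw [hd]; exact hlt)]
        simp)
    refine ⟨fun j => if j = n then r.coeff n / (q n).coeff n else b j, ?_⟩
    simp only [Finset.sum_range_succ, if_true]
    rw [← sub_eq_iff_eq_add, hb]
    exact Finset.sum_congr rfl fun j hj => by rw [if_neg (Finset.mem_range.1 hj).ne]

section

variable {α β : ℝ → ℝ}

theorem pairing_eq_ite (hα : IsWeight α) (hβ : IsWeight β) (h : FiniteBimoments α β)
    {p q : ℕ → ℝ[X]} (hpq : IsCauchyBOP α β p q) (j k : ℕ) :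
    pairing α β (p j) (q k) = if j = k then 1 else 0 := by
  rw [← pairing_eq_iterated hα hβ h, hpq.biorthogonal]

/-- The q_j with j < n span the polynomials of degree < n, and pairing with p_i reads off the
coefficients. -/
theorem reproducing (hα : IsWeight α) (hβ : IsWeight β) (h : FiniteBimoments α β)
    {p q : ℕ → ℝ[X]} (hpq : IsCauchyBOP α β p q) {n : ℕ} {r : ℝ[X]}
    (hr : r.degree < n) : r = ∑ j ∈ Finset.range n, C (pairing α β (p j) r) * q j := by
  obtain ⟨b, hb⟩ := exists_sum_C_mul hpq.natDegree_q (fun j h0 => by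
    have h1 := hpq.leadingCoeff_pos j
    rw [hpq.leadingCoeff_eq, h0, leadingCoeff_zero] at h1
    exact lt_irrefl _ h1) n hr
  have hpr : ∀ i < n, pairing α β (p i) r = b i := by
    intro i hi
    change pairingₗ hα hβ h (p i) r = b i
    have e : ∀ j, pairingₗ hα hβ h (p i) (C (b j) * q j) = if i = j then b j else 0 := fun j => by
      rw [← smul_eq_C_mul, map_smul]
      change b j * pairing α β (p i) (q j) = _
      rw [pairing_eq_ite hα hβ h hpq]
      simp
    rw [hb, map_sum]
    simp_rw [e]
    simp [hi]
  conv_lhs => rw [hb]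
  exact Finset.sum_congr rfl fun j hj => by rw [hpr j (Finset.mem_range.1 hj)]

theorem trans_sum {a b : ℝ → ℝ} (ha : IsWeight a) (hb : IsWeight b) (hab : FiniteBimoments a b)
    {w : ℂ} (hw : Sep a w) (hw' : Sep (star b) w) (t : Finset ℕ) (c : ℕ → ℝ) (r : ℕ → ℝ[X])
    (μ : Fin 3) :
    trans a b (∑ j ∈ t, C (c j) * r j) w μ = ∑ j ∈ t, (c j : ℂ) * trans a b (r j) w μ := by
  have e : (∑ j ∈ t, C (c j) * r j).map (algebraMap ℝ ℂ)
      = ∑ j ∈ t, C (c j : ℂ) * (r j).map (algebraMap ℝ ℂ) := by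
    simp [Polynomial.map_sum]
  fin_cases μ
  · simp [trans]
  · change trans₁ a _ w = ∑ j ∈ t, (c j : ℂ) * trans₁ a (r j) w
    simp_rw [trans₁_eq_cauchy ha]
    rw [e, cauchy_dens₁_sum ha hb hab _ _ _ hw]
  · change trans₂ a b _ w = ∑ j ∈ t, (c j : ℂ) * trans₂ a b (r j) w
    simp_rw [trans₂_eq_cauchy ha hb]
    rw [e, cauchy_dens₂_sum ha hb hab _ _ _ hw']

theorem pairPow_symm (k : ℕ) : pairPow β α (X ^ k) 0 = pairPow α β 1 k := by
  rw [pairPow, pairPow, Measure.volume_eq_prod, ← integral_prod_swap]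
  congr 1; funext s
  simp only [Prod.fst_swap, Prod.snd_swap, add_comm (s.2 : ℂ), eval_pow, eval_X, eval_one]
  ring

/-- The recurrence of the transforms of the monomials. -/
theorem trans_X_pow_succ (hα : IsWeight α) (hβ : IsWeight β) (h : FiniteBimoments α β)
    {w : ℂ} (hw : Sep β w) (hw' : Sep (star α) w) (k : ℕ) (μ : Fin 3) :
    trans β α (X ^ (k + 1)) w μ = w * trans β α (X ^ k) w μ
      - (![0, 1, weyl (star α) w] : Fin 3 → ℂ) μ * (∫ y : ℝ, (y : ℂ) ^ k * β y)
      + (![0, 0, 1] : Fin 3 → ℂ) μ * pairPow α β 1 k := by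
  have h' := h.symm hα hβ
  have e : ((X : ℝ[X]) ^ (k + 1)).map (algebraMap ℝ ℂ)
      = (X + C 0) * (X ^ k : ℝ[X]).map (algebraMap ℝ ℂ) + C 0 := by
    simp [pow_succ']
  have e1 : ∫ s : ℝ, dens₁ β ((X ^ k : ℝ[X]).map (algebraMap ℝ ℂ)) s = ∫ y : ℝ, (y : ℂ) ^ k * β y := by
    congr 1; funext s; simp [dens₁]
  fin_cases μ
  · simp [trans, pow_succ']
  · change trans₁ β (X ^ (k + 1)) w = w * trans₁ β (X ^ k) w - 1 * (∫ y : ℝ, (y : ℂ) ^ k * β y)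
      + 0 * pairPow α β 1 k
    rw [trans₁_eq_cauchy hβ, trans₁_eq_cauchy hβ, e,
      cauchy_dens₁_X_add_mul hβ hα h' _ _ _ hw, e1]
    ring
  · change trans₂ β α (X ^ (k + 1)) w = w * trans₂ β α (X ^ k) w
      - weyl (star α) w * (∫ y : ℝ, (y : ℂ) ^ k * β y) + 1 * pairPow α β 1 k
    -- Taking e₁ to be minus the integral makes the additive constant zero, so only pure transforms
    -- of monomials occur.
    have h1 := cauchy_dens₂_X_add_mul hβ hα h' ((X ^ k : ℝ[X]).map (algebraMap ℝ ℂ)) 0 0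
      (-∫ s : ℝ, dens₁ β ((X ^ k : ℝ[X]).map (algebraMap ℝ ℂ)) s) hw'
    rw [neg_add_cancel, ← e, e1] at h1
    have h2 : ∫ s : ℝ, dens₂ β α ((X ^ k : ℝ[X]).map (algebraMap ℝ ℂ)) 0 s = -pairPow α β 1 k := by
      have := integral_pow_mul_dens₂ hβ hα h' ((X ^ k : ℝ[X]).map (algebraMap ℝ ℂ)) 0 0
      simp only [pow_zero, one_mul, zero_mul, zero_sub] at this
      rw [this, Polynomial.map_pow, map_X, pairPow_symm]
    rw [trans₂_eq_cauchy hβ hα, trans₂_eq_cauchy hβ hα, h1, h2]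
    ring

/-- Row μ of 𝔽 is governed by three numbers e₀, e₁, e₂ that do not depend on z; they become the
constants of a row in the sense of `row`. -/
theorem matF_apply (w z : ℂ) (μ ν : Fin 3) : matF α β w z μ ν =
    (![(![0, 0, 1] : Fin 3 → ℂ) μ,
      (![0, 1, weyl (star α) w] : Fin 3 → ℂ) μ + (![0, 0, 1] : Fin 3 → ℂ) μ * weyl α z,
      (![1, weyl β w, weylStar α β w] : Fin 3 → ℂ) μ
        + (![0, 1, weyl (star α) w] : Fin 3 → ℂ) μ * weyl (star β) z
        + (![0, 0, 1] : Fin 3 → ℂ) μ * weylStar β α z] : Fin 3 → ℂ) ν := by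
  fin_cases μ <;> fin_cases ν <;> simp [matF] <;> ring

theorem weylStar_eq_integral_prod (hα : IsWeight α) (hβ : IsWeight β) (h : FiniteBimoments α β)
    {z : ℂ} (hz : Sep α (-z)) :
    Integrable (fun s : ℝ × ℝ => ((α s.1 * β s.2 : ℝ) : ℂ) / ((z + s.1) * (s.1 + s.2))) ∧
      weylStar α β z
        = -∫ s : ℝ × ℝ, ((α s.1 * β s.2 : ℝ) : ℂ) / ((z + s.1) * (s.1 + s.2)) := by
  have hi : Integrable
      (fun s : ℝ × ℝ => ((α s.1 * β s.2 : ℝ) : ℂ) / ((z + s.1) * (s.1 + s.2))) := by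
    obtain ⟨δ, hδ, hd⟩ := hz
    have hmα := hα.measurable
    have hmβ := hβ.measurable
    refine ((h.integrable hα hβ 0 0).const_mul δ⁻¹).mono' (Measurable.aestronglyMeasurable (by fun_prop)) ?_
    filter_upwards [Measure.quasiMeasurePreserving_fst.ae hd] with s hs
    by_cases ha : α s.1 = 0
    · simp [ha]
    by_cases hb : β s.2 = 0
    · simp [hb]
    have p1 : 0 < s.1 := not_le.1 fun h' => ha (hα.eq_zero _ h')
    have p2 : 0 < s.2 := not_le.1 fun h' => hb (hβ.eq_zero _ h')
    have h1 : δ ≤ ‖z + s.1‖ := by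
      rw [← norm_neg, neg_add']; exact hs ha
    have h2 : ‖(s.1 : ℂ) + s.2‖ = s.1 + s.2 := by
      rw [← Complex.ofReal_add, Complex.norm_real, Real.norm_of_nonneg (add_pos p1 p2).le]
    have h3 := mul_nonneg (hα.nonneg s.1) (hβ.nonneg s.2)
    rw [norm_div, norm_mul, h2, Complex.norm_real, Real.norm_of_nonneg h3]
    calc α s.1 * β s.2 / (‖z + s.1‖ * (s.1 + s.2))
        ≤ α s.1 * β s.2 / (δ * (s.1 + s.2)) := by gcongr
      _ = _ := by field_simp
  refine ⟨hi, ?_⟩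
  have e : ∀ x y : ℝ, y ∉ Ioi (0 : ℝ) →
      ((α x * β y : ℝ) : ℂ) / ((z + x) * (x + y)) = 0 := fun x y hy => by
    rw [hβ.eq_zero y (not_lt.1 hy)]; simp
  rw [weylStar, Measure.volume_eq_prod, integral_prod _ hi,
    setIntegral_eq_integral_of_forall_compl_eq_zero fun x hx => by
      simp [hα.eq_zero x (not_lt.1 hx)]]
  congr 2; funext x
  exact setIntegral_eq_integral_of_forall_compl_eq_zero (e x)

/-- Only the corner entry needs an argument: 1/((w + x)(x + y)) + 1/((y - w)(x + y)) = 1/((w + x)(y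
- w)), which turns W_α(-w) W_β(w) into the two iterated Weyl functions. -/
theorem matF_neg (hα : IsWeight α) (hβ : IsWeight β) (h : FiniteBimoments α β)
    {w : ℂ} (hw : Sep α (-w)) (hw' : Sep β w) : matF α β w (-w) = matJ := by
  have h1 : weyl (star α) w = -weyl α (-w) := by simpa using weyl_star_neg α (-w)
  have h2 := weyl_star_neg β w
  obtain ⟨i1, e1⟩ := weylStar_eq_integral_prod hα hβ h hw
  obtain ⟨i2, e2⟩ := weylStar_eq_integral_prod hβ hα (h.symm hα hβ) (z := -w) (by simpa using hw')
  rw [Measure.volume_eq_prod, ← integral_prod_swap] at e2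
  have h3 : weyl α (-w) * weyl β w = (∫ s : ℝ × ℝ, ((α s.1 * β s.2 : ℝ) : ℂ) / ((w + s.1) * (s.1 + s.2)))
      + ∫ s : ℝ × ℝ, ((β s.swap.1 * α s.swap.2 : ℝ) : ℂ) / ((-w + s.swap.1) * (s.swap.1 + s.swap.2)) := by
    refine Eq.trans ?_ (integral_add i1 i2.swap)
    rw [weyl, weyl, ← integral_prod_mul]
    obtain ⟨δ, hδ, hd⟩ := hw
    obtain ⟨δ', hδ', hd'⟩ := hw'
    refine integral_congr_ae ?_
    filter_upwards [Measure.quasiMeasurePreserving_fst.ae hd,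
      Measure.quasiMeasurePreserving_snd.ae hd'] with s hs hs'
    simp only [Prod.fst_swap, Prod.snd_swap]
    by_cases ha : α s.1 = 0
    · simp [ha]
    by_cases hb : β s.2 = 0
    · simp [hb]
    have n1 : -w - s.1 ≠ 0 := norm_pos_iff.1 (hδ.trans_le (hs ha))
    have n2 : w - s.2 ≠ 0 := norm_pos_iff.1 (hδ'.trans_le (hs' hb))
    have n3 : (s.1 : ℂ) + s.2 ≠ 0 := by
      have p1 : 0 < s.1 := not_le.1 fun h' => ha (hα.eq_zero _ h')
      have p2 : 0 < s.2 := not_le.1 fun h' => hb (hβ.eq_zero _ h')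
      exact_mod_cast (add_pos p1 p2).ne'
    have n4 : w + s.1 ≠ 0 := fun h' => n1 (by linear_combination -h')
    have n5 : -w + s.2 ≠ 0 := fun h' => n2 (by linear_combination -h')
    rw [← neg_add', ← neg_sub, sub_eq_neg_add, add_comm (s.2 : ℂ) (s.1 : ℂ)]
    push_cast
    field_simp
    ring
  have h4 : weyl (star α) w * weyl (star β) (-w) + weylStar α β w + weylStar β α (-w) = 0 := by
    rw [e1, e2, h1, h2]
    linear_combination h3
  rw [matF, matJ, h4, h2, h1, neg_add_cancel, add_neg_cancel]

theorem trans_one_eq (hβ : IsWeight β)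
    (w : ℂ) (μ : Fin 3) :
    trans β α 1 w μ = (![1, weyl β w, weylStar α β w] : Fin 3 → ℂ) μ := by
  fin_cases μ
  · simp [trans]
  · change trans₁ β 1 w = weyl β w
    rw [trans₁_eq_cauchy hβ, weyl_eq_cauchy_dens₁, Polynomial.map_one]
  · exact (weylStar_eq_trans₂ β α w).symm

/-- The kernel multiplied by `z + w`. -/
noncomputable def kernelMatrix (α β : ℝ → ℝ) (p q : ℕ → ℝ[X]) (n : ℕ) (z w : ℂ) :
    Matrix (Fin 3) (Fin 3) ℂ :=
  Matrix.of fun μ ν => (z + w) * (∑ j ∈ Finset.range n, trans β α (q j) w μ * trans α β (p j) z ν)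
    + matF α β w z μ ν

theorem matH_eq_smul_kernelMatrix (p q : ℕ → ℝ[X]) (n : ℕ) {z w : ℂ} (hzw : z + w ≠ 0) :
    matH α β p q n z w = (z + w)⁻¹ • kernelMatrix α β p q n z w := by
  ext μ ν
  simp only [matH, kernelMatrix, Matrix.smul_apply, Matrix.of_apply, smul_eq_mul]
  field_simp

/-- As a function of `z`, the kernel multiplied by `z + w` is built from rows. -/
theorem exists_isRow_kernelMatrix (hα : IsWeight α) (hβ : IsWeight β) (h : FiniteBimoments α β)
    {p q : ℕ → ℝ[X]} (hpq : IsCauchyBOP α β p q) (n : ℕ) {w : ℂ}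
    (hw : -w ∈ dom α β) (μ : Fin 3) :
    ∃ (v : Fin 3 → ℂ) (g : ℂ → Fin 3 → ℂ), IsRow α β n v g ∧
      ∀ z ∈ dom α β, g z = kernelMatrix α β p q n z w μ := by
  have hw1 : Sep (star α) w := by simpa using (sep_of_mem_dom hα hw).star
  have hw2 : Sep β w := by simpa [star_star] using (sep_star_of_mem_dom hβ hw).star
  set a : ℕ → ℂ := fun j => trans β α (q j) w μ with ha
  set e₀ : ℂ := (![0, 0, 1] : Fin 3 → ℂ) μ with he₀
  set e₁ : ℂ := (![0, 1, weyl (star α) w] : Fin 3 → ℂ) μ with he₁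
  set e₂ : ℂ := (![1, weyl β w, weylStar α β w] : Fin 3 → ℂ) μ with he₂
  set P : ℕ → ℂ[X] := fun j => (p j).map (algebraMap ℝ ℂ) with hP
  set Q : ℂ[X] := ∑ j ∈ Finset.range n, C (a j) * P j with hQ
  have hPdeg : ∀ j, (P j).degree ≤ j := fun j =>
    (degree_map_le).trans (degree_le_natDegree.trans_eq (by rw [hpq.natDegree_p]))
  have hdeg : ((X + C w) * Q + C e₀).degree ≤ (n : WithBot ℕ) := by
    refine (degree_add_le _ _).trans (max_le ?_ (degree_C_le.trans (by exact_mod_cast Nat.zero_le n)))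
    rw [hQ, Finset.mul_sum]
    refine (degree_sum_le _ _).trans (Finset.sup_le fun j hj => ?_)
    have h1 : (C (a j) * P j).degree ≤ (j : WithBot ℕ) := by
      simpa using degree_mul_le_of_le degree_C_le (hPdeg j)
    refine (degree_mul_le_of_le (degree_X_add_C w).le h1).trans ?_
    have := Finset.mem_range.1 hj
    exact_mod_cast (by omega : 1 + j ≤ n)
  -- Expanding y^k in the q_j by the reproducing property and transforming in w gives the same
  -- coefficients as pairing Q with y^k.
  have hpair : ∀ k < n, pairPow α β Q k = trans β α (X ^ k) w μ := by
    intro k hk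
    have h1 := reproducing hα hβ h hpq (n := n) (r := X ^ k)
      (by rw [degree_X_pow]; exact_mod_cast hk)
    have h2 : trans β α (X ^ k) w μ
        = ∑ j ∈ Finset.range n, (pairing α β (p j) (X ^ k) : ℂ) * trans β α (q j) w μ := by
      conv_lhs => rw [h1]
      exact trans_sum hβ hα (h.symm hα hβ) hw2 hw1 _ _ _ μ
    have h3 : pairPow α β Q k = ∑ j ∈ Finset.range n, a j * pairPow α β (P j) k := by
      rw [hQ]
      generalize Finset.range n = t
      induction t using Finset.induction_on with
      | empty => simp [pairPow]
      | insert i t hi ih =>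
        rw [Finset.sum_insert hi, Finset.sum_insert hi, pairPow_add hα hβ h, pairPow_C_mul, ih]
    rw [h2, h3]
    exact Finset.sum_congr rfl fun j _ => by rw [hP, pairPow_map, ha, mul_comm]
  -- For n ≥ 1 the constant d is e₂ - ⟨Q, 1⟩ and vanishes because ⟨Q, 1⟩ is the transform of 1,
  -- which is e₂. The moments of order k with k + 1 < n need `hpair` at both k and k + 1.
  obtain ⟨v, hv⟩ := exists_isRow hα hβ h (n := n) (P := (X + C w) * Q + C e₀) hdeg
    (c := e₁ + ∫ s, dens₁ α Q s) (d := e₂ + ∫ s, dens₂ α β Q 0 s) (by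
      intro hn
      have h1 := integral_pow_mul_dens₂ hα hβ h Q 0 0
      simp only [pow_zero, one_mul, zero_mul, zero_sub] at h1
      rw [h1, hpair 0 (Nat.pos_of_ne_zero hn), pow_zero, trans_one_eq hβ]
      exact add_neg_cancel _)
    (fun k hk => by
      rw [integral_pow_mul_dens₂_X_add_mul hα hβ h, hpair k (by omega), hpair (k + 1) hk,
        trans_X_pow_succ hα hβ h hw2 hw1]
      ring)
  refine ⟨v, _, hv, fun z hz => ?_⟩
  have hz1 := sep_of_mem_dom hα hz
  have hz2 := sep_star_of_mem_dom hβ hz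
  funext ν
  rw [kernelMatrix, Matrix.of_apply, matF_apply]
  fin_cases ν
  · change ((X + C w) * Q + C e₀).eval z = (z + w) * (∑ j ∈ Finset.range n, a j * aeval z (p j)) + e₀
    simp [hQ, hP, eval_finsetSum, eval_map_algebraMap]
  · change e₁ + (∫ s, dens₁ α Q s) + cauchy (dens₁ α ((X + C w) * Q + C e₀)) z
      = (z + w) * (∑ j ∈ Finset.range n, a j * trans₁ α (p j) z) + (e₁ + e₀ * weyl α z)
    simp_rw [trans₁_eq_cauchy hα]
    rw [cauchy_dens₁_X_add_mul hα hβ h Q w e₀ hz1, hQ, cauchy_dens₁_sum hα hβ h _ _ _ hz1]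
    ring
  · change e₂ + (∫ s, dens₂ α β Q 0 s) + cauchy (dens₂ α β ((X + C w) * Q + C e₀)
        (e₁ + ∫ s, dens₁ α Q s)) z
      = (z + w) * (∑ j ∈ Finset.range n, a j * trans₂ α β (p j) z)
        + (e₂ + e₁ * weyl (star β) z + e₀ * weylStar β α z)
    simp_rw [weylStar_eq_trans₂, trans₂_eq_cauchy hα hβ]
    rw [cauchy_dens₂_X_add_mul hα hβ h Q w e₀ e₁ hz2, hQ, cauchy_dens₂_sum hα hβ h _ _ _ hz2,
      Polynomial.map_one]
    ring

theorem kernelMatrix_neg (hα : IsWeight α) (hβ : IsWeight β) (h : FiniteBimoments α β)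
    (p q : ℕ → ℝ[X]) (n : ℕ) {w : ℂ} (hw : -w ∈ dom α β) :
    kernelMatrix α β p q n (-w) w = matJ := by
  have hw2 : Sep β w := by simpa [star_star] using (sep_star_of_mem_dom hβ hw).star
  rw [← matF_neg hα hβ h (sep_of_mem_dom hα hw) hw2]
  ext μ ν
  simp [kernelMatrix]

/-! ### Uniqueness, existence and the kernel formula -/

theorem eqOn_of_isRHPSolution (hα : IsWeight α) (hβ : IsWeight β) (h : FiniteBimoments α β)
    {n : ℕ} {G G' : ℂ → Matrix (Fin 3) (Fin 3) ℂ}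
    (hG : IsRHPSolution α β n G) (hG' : IsRHPSolution α β n G') : EqOn G' G (dom α β) := by
  intro z hz
  ext i j
  have h1 := (isRow_of_isRHPSolution hG' i).lin hα hβ h (isRow_of_isRHPSolution hG i) 1 (-1)
  rw [← add_smul, add_neg_cancel, zero_smul] at h1
  have h2 := congrFun (h1.eq_zero hα hβ h hz) j
  simpa [← sub_eq_add_neg, sub_eq_zero] using h2

theorem matJ_mul_matJ : matJ * matJ = 1 := by
  ext i j
  fin_cases i <;> fin_cases j <;> simp [matJ, Matrix.mul_apply, Fin.sum_univ_three]

/-- V consists of the leading coefficients of the kernel rows. Row μ minus the combination of the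
rows of Γ with weights V_μ solves the homogeneous problem and vanishes. -/
theorem kernelMatrix_eq_mul (hα : IsWeight α) (hβ : IsWeight β) (h : FiniteBimoments α β)
    {p q : ℕ → ℝ[X]} (hpq : IsCauchyBOP α β p q) {n : ℕ}
    {G : ℂ → Matrix (Fin 3) (Fin 3) ℂ} (hG : IsRHPSolution α β n G) {w : ℂ} (hw : -w ∈ dom α β) :
    ∃ V : Matrix (Fin 3) (Fin 3) ℂ, ∀ z ∈ dom α β, kernelMatrix α β p q n z w = V * G z := by
  choose v g hg hgz using exists_isRow_kernelMatrix hα hβ h hpq n hw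
  refine ⟨Matrix.of v, fun z hz => ?_⟩
  ext μ ν
  have h1 := (hg μ).lin hα hβ h
    (IsRow.sum_fin_three hα hβ h (isRow_of_isRHPSolution hG) (v μ)) 1 (-1)
  have hv : (1 : ℂ) • v μ + (-1 : ℂ) • ∑ i, v μ i • (Pi.single i 1 : Fin 3 → ℂ) = 0 := by
    funext j
    simp [Finset.sum_apply, Pi.single_apply]
  rw [hv] at h1
  have h2 := congrFun (h1.eq_zero hα hβ h hz) ν
  rw [hgz μ z hz] at h2
  simp only [one_smul, neg_smul, Pi.add_apply, Pi.neg_apply, Pi.zero_apply, Finset.sum_apply,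
    Pi.smul_apply, smul_eq_mul, ← sub_eq_add_neg, sub_eq_zero] at h2
  rw [h2, Matrix.mul_apply]
  rfl

/-- The kernel at w = i satisfies all conditions up to its leading coefficient matrix V. If u V = 0,
then u K(·, i) solves the homogeneous problem and vanishes; its value at z = -i is u 𝕁, so u = 0.
Hence V is invertible, and V⁻¹ K(·, i) is a solution. -/
theorem exists_isRHPSolution (hα : IsWeight α) (hβ : IsWeight β) (h : FiniteBimoments α β)
    (n : ℕ) : ∃ G, IsRHPSolution α β n G := by
  obtain ⟨p, q, hpq⟩ := exists_isCauchyBOP hα hβ h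
  have hw : -I ∈ dom α β := mem_dom_of_im_ne_zero (by simp)
  choose v g hg hgz using exists_isRow_kernelMatrix hα hβ h hpq n hw
  set V : Matrix (Fin 3) (Fin 3) ℂ := Matrix.of v with hV
  have hdet : V.det ≠ 0 := by
    intro h0
    obtain ⟨u, hu, huV⟩ := Matrix.exists_vecMul_eq_zero_iff.2 h0
    apply hu
    have h1 := IsRow.sum_fin_three hα hβ h hg u
    have hs : ∑ i, u i • v i = 0 := by
      rw [← huV]
      funext j
      simp [Matrix.vecMul, dotProduct, hV]
    rw [hs] at h1
    have h2 := h1.eq_zero hα hβ h hw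
    simp_rw [hgz _ _ hw, kernelMatrix_neg hα hβ h p q n hw] at h2
    have h3 : Matrix.vecMul u matJ = 0 := by
      rw [← h2]
      funext j
      simp [Matrix.vecMul, dotProduct]
    have h4 := congrArg (fun x => Matrix.vecMul x matJ) h3
    simpa [Matrix.vecMul_vecMul, matJ_mul_matJ] using h4
  refine ⟨fun z => V⁻¹ * Matrix.of fun μ => g μ z, isRHPSolution_of_isRow fun i => ?_⟩
  have h1 := IsRow.sum_fin_three hα hβ h hg (V⁻¹ i)
  have hs : ∑ μ, V⁻¹ i μ • v μ = Pi.single i 1 := by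
    have h2 := Matrix.nonsing_inv_mul V (isUnit_iff_ne_zero.2 hdet)
    funext j
    have h3 := congrFun (congrFun h2 i) j
    rw [Matrix.mul_apply, Matrix.one_apply] at h3
    rw [Pi.single_apply, Finset.sum_apply]
    simp only [eq_comm (a := j)]
    rw [← h3]
    rfl
  rw [hs] at h1
  convert h1 using 1
  funext z j
  simp [Matrix.mul_apply]

end

end CauchyBOP

theorem mainTheorem4 (α β : ℝ → ℝ) (hα : CauchyBOP.IsWeight α) (hβ : CauchyBOP.IsWeight β)
    (hαβ : CauchyBOP.FiniteBimoments α β) :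
    (∃ p q : ℕ → ℝ[X], CauchyBOP.IsCauchyBOP α β p q) ∧
    (∀ n : ℕ, ∃ G : ℂ → Matrix (Fin 3) (Fin 3) ℂ, CauchyBOP.IsRHPSolution α β n G ∧
      ∀ G' : ℂ → Matrix (Fin 3) (Fin 3) ℂ, CauchyBOP.IsRHPSolution α β n G' →
        EqOn G' G (CauchyBOP.dom α β)) ∧
    ∀ p q : ℕ → ℝ[X], CauchyBOP.IsCauchyBOP α β p q →
      ∀ (n : ℕ) (G : ℂ → Matrix (Fin 3) (Fin 3) ℂ), CauchyBOP.IsRHPSolution α β n G →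
        ∀ z w : ℂ, z ∈ CauchyBOP.dom α β → -w ∈ CauchyBOP.dom α β → z + w ≠ 0 →
          IsUnit (G (-w)).det ∧
          CauchyBOP.matH α β p q n z w =
            (z + w)⁻¹ • (CauchyBOP.matJ * (G (-w))⁻¹ * G z) := by
  refine ⟨CauchyBOP.exists_isCauchyBOP hα hβ hαβ, fun n => ?_, fun p q hpq n G hG z w hz hw hzw => ?_⟩
  · obtain ⟨G, hG⟩ := CauchyBOP.exists_isRHPSolution hα hβ hαβ n
    exact ⟨G, hG, fun G' hG' => CauchyBOP.eqOn_of_isRHPSolution hα hβ hαβ hG hG'⟩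
  · obtain ⟨V, hV⟩ := CauchyBOP.kernelMatrix_eq_mul hα hβ hαβ hpq hG hw
    have h1 := hV (-w) hw
    rw [CauchyBOP.kernelMatrix_neg hα hβ hαβ p q n hw] at h1
    -- Evaluation at z = -w gives 𝕁 = V Γ(-w). As 𝕁² = 1, the matrix 𝕁 V is a left inverse of Γ(-w),
    -- so V = 𝕁 Γ(-w)⁻¹.
    have h2 : (CauchyBOP.matJ * V) * G (-w) = 1 := by
      rw [Matrix.mul_assoc, ← h1, CauchyBOP.matJ_mul_matJ]
    refine ⟨Matrix.isUnit_det_of_left_inverse h2, ?_⟩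
    rw [CauchyBOP.matH_eq_smul_kernelMatrix p q n hzw, hV z hz, Matrix.inv_eq_left_inv h2,
      ← Matrix.mul_assoc, CauchyBOP.matJ_mul_matJ, Matrix.one_mul]
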